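/- Let $N\ge 1$ and let $\gamma\subset\mathbb C$ be an oriented, non self-intersecting regular curve of class $C^2$ running from infinity to infinity without finite endpoints, i.e. the image of a proper injective $C^2$ map $\gamma:\mathbb R\to\mathbb C$ with $\gamma'\neq 0$. Let $W$ be an $N\times N$ matrix of weights on $\gamma$ with absolutely convergent moments $W_n=\frac1{2\pi i}\int_\gamma z^nW(z)\,dz$, $n\in\mathbb N=\{0,1,\dots\}$, which is regular: $\det[W_{j+k}]_{j,k=0,\dots,n}\ne0$ for all $n$. Suppose $W=W^LW^R$ on $\gamma$, where $W^L,W^R$ are entire matrix functions which are invertible at every point of $\mathbb C$. There exist monic matrix polynomials $P_n^L,P_n^R$ of degree $n$ and nonsingular matrices $C_n$ such that $$\frac1{2\pi i}\int_\gamma P^L_n(z)W(z)z^k\,dz=\delta_{n,k}C_n^{-1},\qquad \frac1{2\pi i}\int_\gamma z^kW(z)P^R_n(z)\,dz=\delta_{n,k}C_n^{-1},\qquad 0\le k\le n .$$ For any such $P^L_n,P^R_n,C_n$ put $Q_n^L(z)=\frac1{2\pi i}\int_\gamma \frac{P_n^L(z')W(z')}{z'-z}dz'$, $Q_n^R(z)=\frac1{2\pi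 i}\int_\gamma \frac{W(z')P_n^R(z')}{z'-z}dz'$, $\beta^L_n=p^1_{L,n}-p^1_{L,n+1}$ (where $p^1_{L,n}$ is the coefficient of $z^{n-1}$ in $P_n^L$ and $p^1_{L,0}=0$), $\beta^R_n=C_n\beta^L_nC_n^{-1}$, and $$Y_n^L=\begin{bmatrix}P_n^L&Q_n^L\\-C_{n-1}P_{n-1}^L&-C_{n-1}Q_{n-1}^L\end{bmatrix},\quad Y_n^R=\begin{bmatrix}P_n^R&-P_{n-1}^RC_{n-1}\\Q_n^R&-Q_{n-1}^RC_{n-1}\end{bmatrix},$$ $$T_n^L(z)=\begin{bmatrix}zI-\beta_n^L&C_n^{-1}\\-C_n&0\end{bmatrix},\quad T_n^R(z)=\begin{bmatrix}zI-\beta_n^R&-C_n\\C_n^{-1}&0\end{bmatrix},$$ $$Z_n^L=Y_n^L\begin{bmatrix}W^L&0\\0&(W^R)^{-1}\end{bmatrix},\quad Z_n^R=\begin{bmatrix}W^R&0\\0&(W^L)^{-1}\end{bmatrix}Y_n^R,$$ where for $n=0$ the lower block row of $Y_0^L$ is $(0,I)$ and the right block column of $Y_0^R$ is $(0,I)^\top$.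 Let $F_\pm$ denote the limits of $F$ at points of $\gamma$ from its left ($+$) and right ($-$) side. Then for all $n\in\mathbb N$: (1) $Z_n^L,Z_n^R$ are holomorphic and invertible on $\mathbb C\setminus\gamma$; their limits from both sides of $\gamma$ exist, and on $\gamma$ $$(Z_n^L)_+=(Z_n^L)_-\begin{bmatrix}I&I\\0&I\end{bmatrix},\qquad (Z_n^R)_+=\begin{bmatrix}I&0\\I&I\end{bmatrix}(Z_n^R)_- ;$$ and $$Z_n^L(z)=\big(I+O(z^{-1})\big)\begin{bmatrix}z^nW^L(z)&0\\0&z^{-n}W^R(z)^{-1}\end{bmatrix},\qquad Z_n^R(z)=\begin{bmatrix}z^nW^R(z)&0\\0&z^{-n}W^L(z)^{-1}\end{bmatrix}\big(I+O(z^{-1})\big)\qquad(*)$$ as $z\to\infty$ in $\{z:\operatorname{dist}(z,\gamma)\ge\delta\}$, for every $\delta>0$. (2) If moreover $W$ is Hölder continuous on $\gamma$ and $\gamma$ is a Carleson curve (its arc length inside any disc of radius $r$ is at most $Kr$, with $K$ independent of the disc), then $(*)$ holds as $z\to\infty$ in all of $\mathbb C\setminus\gamma$, and $Z_n^L$ (respectively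 $Z_n^R$) is the unique function that is holomorphic on $\mathbb C\setminus\gamma$, has limits from both sides of $\gamma$ satisfying the constant jump condition of (1), and satisfies $(*)$ as $z\to\infty$ in $\mathbb C\setminus\gamma$. (3) $T_n^LZ_n^L=Z_{n+1}^L$ and $Z_n^RT_n^R=Z_{n+1}^R$ on $\mathbb C\setminus\gamma$. (4) The structure matrices $M_n^L=(Z_n^L)'(Z_n^L)^{-1}$ and $M_n^R=(Z_n^R)^{-1}(Z_n^R)'$ extend to entire matrix functions, and on $\mathbb C$, with $D=\begin{bmatrix}I&0\\0&0\end{bmatrix}$, $$D=M_{n+1}^LT_n^L-T_n^LM_n^L,\qquad D=T_n^RM_{n+1}^R-M_n^RT_n^R,$$ $$DM_n^L+M_{n+1}^LD=(M_{n+1}^L)^2T_n^L-T_n^L(M_n^L)^2,\qquad DM_{n+1}^R+M_n^RD=T_n^R(M_{n+1}^R)^2-(M_n^R)^2T_n^R .$$ -/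

import Mathlib

open Filter Topology Polynomial MeasureTheory

namespace ConstantJump

noncomputable section

/-- Complex `N × N` matrices. -/
abbrev Mat (N : ℕ) := Matrix (Fin N) (Fin N) ℂ

/-- Complex `2N × 2N` matrices, in `N × N` blocks. -/
abbrev Mat2 (N : ℕ) := Matrix (Fin N ⊕ Fin N) (Fin N ⊕ Fin N) ℂ

/-! ### Curves, weights, moments -/

/-- A smooth, oriented, non self-intersecting curve in the plane without finite endpoints, running
from infinity to infinity: a proper injective regular parametrisation of class `C²`. The
orientation is that of the parametrisation. -/
structure IsSmoothCurve (γ : ℝ → ℂ) : Prop where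
  smooth : ContDiff ℝ 2 γ
  regular : ∀ t, deriv γ t ≠ 0
  injective : Function.Injective γ
  proper : Tendsto γ (cocompact ℝ) (cocompact ℂ)

/-- A Carleson curve: the arc length of the curve inside a disc is at most a constant times the
radius of the disc. -/
def IsCarlesonCurve (γ : ℝ → ℂ) : Prop :=
  ∃ K : ℝ, ∀ (z : ℂ) (r : ℝ), 0 < r →
    ∫⁻ t in γ ⁻¹' Metric.ball z r, ‖deriv γ t‖ₑ ≤ ENNReal.ofReal (K * r)

/-- The entries of `W` are Hölder continuous on the curve. -/
def IsHolderOn {N : ℕ} (γ : ℝ → ℂ) (W : ℂ → Mat N) : Prop :=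
  ∀ i j, ∃ K r : NNReal, 0 < r ∧ HolderOnWith K r (fun z => W z i j) (Set.range γ)

/-- The integral `(2πi)⁻¹ ∫_γ F(z) dz`, entry by entry. -/
def curveInt {N : ℕ} (γ : ℝ → ℂ) (F : ℂ → Mat N) : Mat N :=
  Matrix.of fun i j => (2 * Real.pi * Complex.I)⁻¹ * ∫ t : ℝ, F (γ t) i j * deriv γ t

/-- The integrals defining the moments of `W` converge absolutely. -/
def HasFiniteMoments {N : ℕ} (γ : ℝ → ℂ) (W : ℂ → Mat N) : Prop :=
  ∀ (n : ℕ) (i j : Fin N), Integrable fun t : ℝ => γ t ^ n * W (γ t) i j * deriv γ t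

/-- The moment of order `n`. -/
def moment {N : ℕ} (γ : ℝ → ℂ) (W : ℂ → Mat N) (n : ℕ) : Mat N :=
  curveInt γ fun z => z ^ n • W z

/-- The block Hankel matrix `[W_{j+k}]`, `j, k = 0, …, n`. -/
def hankel {N : ℕ} (γ : ℝ → ℂ) (W : ℂ → Mat N) (n : ℕ) :
    Matrix (Fin (n + 1) × Fin N) (Fin (n + 1) × Fin N) ℂ :=
  Matrix.of fun a b => moment γ W (a.1 + b.1) a.2 b.2

/-- The weight is regular: all block Hankel determinants are nonzero. -/
def IsRegularWeight {N : ℕ} (γ : ℝ → ℂ) (W : ℂ → Mat N) : Prop :=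
  ∀ n, (hankel γ W n).det ≠ 0

/-! ### Biorthogonal polynomials and functions of the second kind -/

/-- The value at `z` of a polynomial with matrix coefficients. -/
def evalAt {N : ℕ} (P : (Mat N)[X]) (z : ℂ) : Mat N := P.eval (z • (1 : Mat N))

/-- `PL` and `PR` are the monic left and right orthogonal polynomials of `W`, with the
nonsingular matrices `C n` (inverses of the norms). -/
structure IsOrthogonal {N : ℕ} (γ : ℝ → ℂ) (W : ℂ → Mat N)
    (PL PR : ℕ → (Mat N)[X]) (C : ℕ → Mat N) : Prop where
  monicL : ∀ n, (PL n).Monic ∧ (PL n).natDegree = n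
  monicR : ∀ n, (PR n).Monic ∧ (PR n).natDegree = n
  nonsingular : ∀ n, IsUnit (C n)
  orthL : ∀ n, ∀ k ≤ n,
    curveInt γ (fun z => z ^ k • (evalAt (PL n) z * W z)) = if k = n then (C n)⁻¹ else 0
  orthR : ∀ n, ∀ k ≤ n,
    curveInt γ (fun z => z ^ k • (W z * evalAt (PR n) z)) = if k = n then (C n)⁻¹ else 0

/-- Left function of the second kind attached to the polynomial `P`. -/
def secondKindL {N : ℕ} (γ : ℝ → ℂ) (W : ℂ → Mat N) (P : (Mat N)[X]) (z : ℂ) : Mat N :=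
  curveInt γ fun w => (w - z)⁻¹ • (evalAt P w * W w)

/-- Right function of the second kind attached to the polynomial `P`. -/
def secondKindR {N : ℕ} (γ : ℝ → ℂ) (W : ℂ → Mat N) (P : (Mat N)[X]) (z : ℂ) : Mat N :=
  curveInt γ fun w => (w - z)⁻¹ • (W w * evalAt P w)

/-- The second leading coefficient `p_n¹` of the `n`-th polynomial, with `p_0¹ = 0`. -/
def subleading {N : ℕ} (P : ℕ → (Mat N)[X]) : ℕ → Mat N
  | 0 => 0
  | n + 1 => (P (n + 1)).coeff n

/-- Recursion coefficient `β_n^L = p_{L,n}¹ - p_{L,n+1}¹`. -/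
def betaL {N : ℕ} (PL : ℕ → (Mat N)[X]) (n : ℕ) : Mat N :=
  subleading PL n - subleading PL (n + 1)

/-- Recursion coefficient `β_n^R = C_n β_n^L C_n⁻¹`. -/
def betaR {N : ℕ} (PL : ℕ → (Mat N)[X]) (C : ℕ → Mat N) (n : ℕ) : Mat N :=
  C n * betaL PL n * (C n)⁻¹

/-! ### Fundamental, transfer and constant jump matrices -/

/-- Left fundamental matrix. For `n = 0` the conventions `P_{-1} = 0`, `Q_{-1} = -C_{-1}⁻¹` make
the lower row `(0, I)`. -/
def fundL {N : ℕ} (γ : ℝ → ℂ) (W : ℂ → Mat N) (PL : ℕ → (Mat N)[X]) (C : ℕ → Mat N) :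
    ℕ → ℂ → Mat2 N
  | 0, z => Matrix.fromBlocks (evalAt (PL 0) z) (secondKindL γ W (PL 0) z) 0 1
  | n + 1, z => Matrix.fromBlocks
      (evalAt (PL (n + 1)) z) (secondKindL γ W (PL (n + 1)) z)
      (-(C n * evalAt (PL n) z)) (-(C n * secondKindL γ W (PL n) z))

/-- Right fundamental matrix, with the same conventions for `n = 0`. -/
def fundR {N : ℕ} (γ : ℝ → ℂ) (W : ℂ → Mat N) (PR : ℕ → (Mat N)[X]) (C : ℕ → Mat N) :
    ℕ → ℂ → Mat2 N
  | 0, z => Matrix.fromBlocks (evalAt (PR 0) z) 0 (secondKindR γ W (PR 0) z) 1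
  | n + 1, z => Matrix.fromBlocks
      (evalAt (PR (n + 1)) z) (-(evalAt (PR n) z * C n))
      (secondKindR γ W (PR (n + 1)) z) (-(secondKindR γ W (PR n) z * C n))

/-- Left transfer matrix. -/
def transferL {N : ℕ} (PL : ℕ → (Mat N)[X]) (C : ℕ → Mat N) (n : ℕ) (z : ℂ) : Mat2 N :=
  Matrix.fromBlocks (z • (1 : Mat N) - betaL PL n) (C n)⁻¹ (-C n) 0

/-- Right transfer matrix. -/
def transferR {N : ℕ} (PL : ℕ → (Mat N)[X]) (C : ℕ → Mat N) (n : ℕ) (z : ℂ) : Mat2 N :=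
  Matrix.fromBlocks (z • (1 : Mat N) - betaR PL C n) (-C n) (C n)⁻¹ 0

/-- Left constant jump fundamental matrix `Z_n^L`. -/
def constJumpL {N : ℕ} (γ : ℝ → ℂ) (W WL WR : ℂ → Mat N) (PL : ℕ → (Mat N)[X]) (C : ℕ → Mat N)
    (n : ℕ) (z : ℂ) : Mat2 N :=
  fundL γ W PL C n z * Matrix.fromBlocks (WL z) 0 0 (WR z)⁻¹

/-- Right constant jump fundamental matrix `Z_n^R`. -/
def constJumpR {N : ℕ} (γ : ℝ → ℂ) (W WL WR : ℂ → Mat N) (PR : ℕ → (Mat N)[X]) (C : ℕ → Mat N)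
    (n : ℕ) (z : ℂ) : Mat2 N :=
  Matrix.fromBlocks (WR z) 0 0 (WL z)⁻¹ * fundR γ W PR C n z

/-- Entrywise complex derivative. -/
def matDeriv {m : Type*} (F : ℂ → Matrix m m ℂ) (z : ℂ) : Matrix m m ℂ :=
  Matrix.of fun i j => deriv (fun w => F w i j) z

/-- Right logarithmic derivative `F' F⁻¹`. -/
def rightLogDeriv {m : Type*} [Fintype m] [DecidableEq m] (F : ℂ → Matrix m m ℂ) (z : ℂ) :
    Matrix m m ℂ := matDeriv F z * (F z)⁻¹

/-- Left logarithmic derivative `F⁻¹ F'`. -/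
def leftLogDeriv {m : Type*} [Fintype m] [DecidableEq m] (F : ℂ → Matrix m m ℂ) (z : ℂ) :
    Matrix m m ℂ := (F z)⁻¹ * matDeriv F z

/-- The projection `diag(I, 0)`. -/
def proj (N : ℕ) : Mat2 N := Matrix.fromBlocks 1 0 0 0

/-! ### Holomorphy, boundary values, asymptotics -/

/-- All entries are holomorphic on `s`. -/
def IsHolomorphicOn {m : Type*} (F : ℂ → Matrix m m ℂ) (s : Set ℂ) : Prop :=
  ∀ i j, DifferentiableOn ℂ (fun z => F z i j) s

/-- All entries are entire. -/
def IsEntire {m : Type*} (F : ℂ → Matrix m m ℂ) : Prop :=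
  ∀ i j, Differentiable ℂ fun z => F z i j

/-- `A` is the boundary value of `F` at `γ t` from the positive (left) side: the full limit of
`F` from that side, in the normal coordinates `(s, y) ↦ γ s + i y γ'(s)`, `y > 0`. -/
def HasPlusValue {m : Type*} (γ : ℝ → ℂ) (F : ℂ → Matrix m m ℂ) (t : ℝ) (A : Matrix m m ℂ) :
    Prop :=
  Tendsto (fun p : ℝ × ℝ => F (γ p.1 + p.2 * (Complex.I * deriv γ p.1)))
    (𝓝 t ×ˢ 𝓝[>] 0) (𝓝 A)

/-- `A` is the boundary value of `F` at `γ t` from the negative (right) side. -/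
def HasMinusValue {m : Type*} (γ : ℝ → ℂ) (F : ℂ → Matrix m m ℂ) (t : ℝ) (A : Matrix m m ℂ) :
    Prop :=
  Tendsto (fun p : ℝ × ℝ => F (γ p.1 + p.2 * (Complex.I * deriv γ p.1)))
    (𝓝 t ×ˢ 𝓝[<] 0) (𝓝 A)

/-- `Z₊ = Z₋ [[I, I], [0, I]]` on the curve; both boundary values exist. -/
def HasConstJumpL {N : ℕ} (γ : ℝ → ℂ) (Z : ℂ → Mat2 N) : Prop :=
  ∀ t, ∃ Zp Zm : Mat2 N, HasPlusValue γ Z t Zp ∧ HasMinusValue γ Z t Zm ∧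
    Zp = Zm * Matrix.fromBlocks 1 1 0 1

/-- `Z₊ = [[I, 0], [I, I]] Z₋` on the curve; both boundary values exist. -/
def HasConstJumpR {N : ℕ} (γ : ℝ → ℂ) (Z : ℂ → Mat2 N) : Prop :=
  ∀ t, ∃ Zp Zm : Mat2 N, HasPlusValue γ Z t Zp ∧ HasMinusValue γ Z t Zm ∧
    Zp = Matrix.fromBlocks 1 0 1 1 * Zm

/-- `Z(z) = (I + O(1/z)) diag(zⁿ W^L(z), z⁻ⁿ W^R(z)⁻¹)` as `z → ∞` in `s`. -/
def HasAsymptoticsL {N : ℕ} (WL WR : ℂ → Mat N) (n : ℕ) (Z : ℂ → Mat2 N) (s : Set ℂ) : Prop :=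
  ∃ E : ℂ → Mat2 N,
    (∀ i j, (fun z => E z i j) =O[cocompact ℂ ⊓ 𝓟 s] fun z => z⁻¹) ∧
    ∀ᶠ z in cocompact ℂ ⊓ 𝓟 s,
      Z z = (1 + E z) * Matrix.fromBlocks (z ^ n • WL z) 0 0 ((z ^ n)⁻¹ • (WR z)⁻¹)

/-- `Z(z) = diag(zⁿ W^R(z), z⁻ⁿ W^L(z)⁻¹) (I + O(1/z))` as `z → ∞` in `s`. -/
def HasAsymptoticsR {N : ℕ} (WL WR : ℂ → Mat N) (n : ℕ) (Z : ℂ → Mat2 N) (s : Set ℂ) : Prop :=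
  ∃ E : ℂ → Mat2 N,
    (∀ i j, (fun z => E z i j) =O[cocompact ℂ ⊓ 𝓟 s] fun z => z⁻¹) ∧
    ∀ᶠ z in cocompact ℂ ⊓ 𝓟 s,
      Z z = Matrix.fromBlocks (z ^ n • WR z) 0 0 ((z ^ n)⁻¹ • (WL z)⁻¹) * (1 + E z)

/-- The left Riemann–Hilbert problem with constant jump. -/
structure SolvesRHL {N : ℕ} (γ : ℝ → ℂ) (WL WR : ℂ → Mat N) (n : ℕ) (Z : ℂ → Mat2 N) : Prop where
  holomorphic : IsHolomorphicOn Z (Set.range γ)ᶜ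
  asymptotics : HasAsymptoticsL WL WR n Z (Set.range γ)ᶜ
  jump : HasConstJumpL γ Z

/-- The right Riemann–Hilbert problem with constant jump. -/
structure SolvesRHR {N : ℕ} (γ : ℝ → ℂ) (WL WR : ℂ → Mat N) (n : ℕ) (Z : ℂ → Mat2 N) : Prop where
  holomorphic : IsHolomorphicOn Z (Set.range γ)ᶜ
  asymptotics : HasAsymptoticsR WL WR n Z (Set.range γ)ᶜ
  jump : HasConstJumpR γ Z

/-- The points at distance at least `δ` from the curve. -/
def awayFrom (γ : ℝ → ℂ) (δ : ℝ) : Set ℂ := {z | δ ≤ Metric.infDist z (Set.range γ)}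

end

end ConstantJump

open ConstantJump

/-! Only the left half is proved directly. Transposition replaces `W` by its transpose, interchanges
the two families of polynomials and the two entire factors, and turns every right object into a left
one (`constJumpR_eq_transpose`, `IsOrthogonal.transferR_eq`). For the transfer matrices this needs
`subleading_conj`, since the right recursion coefficient is defined through the left polynomials.

The algebra rests on one functional, `momL`. Depending on the sequence fed to it, it gives the
values of a polynomial, its moments, or its function of the second kind. The three-term recurrence
is an identity between polynomials, so it passes to both columns of the fundamental matrix and gives
the transfer relation (`transferL_mul_fundL`). Iterating, the `n`-th constant jump matrix is a
product of polynomial invertible matrices times the one of index zero, which is block triangular and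
contains only the Cauchy transform `A` of `W` and the factors of `W` (`constJumpL_eq`). All the
analysis therefore concerns `A` and its analogues for the weights `w ^ k • W`.

Because `W` agrees on the curve with an entire function, `A` extends holomorphically across the
curve from each side, and the two extensions differ by `W` (`exists_sides`): freezing the density at
`z` leaves a regular integral and an integral of `dw / (w - z)`, which is a difference of logarithms
with two branches. This gives the boundary values and the jump. The upper right block of the
structure matrix of index zero is the same for both extensions, hence entire; the higher structure
matrices come from the transfer relation.

For the asymptotics, `A_{k+1} = z A_k + W_k` for the Cauchy transforms `A_k` of `w ^ k • W`, so
bounds for all `A_k` make all of them `O(1/z)`, and orthogonality supplies the powers of `z`. The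
bounds are immediate at a positive distance from the curve. Up to the curve they are
`exists_cauchy_bound`: subtract the value of the density at the point nearest to `z`, use the Hölder
condition for the difference, and bound the integral of `dw / (w - z)` over the arcs inside a unit
disc. A simple arc contributes at most `2π` (`norm_integral_arc_le`), and the Carleson condition
limits the number of arcs reaching the half-size disc.

Uniqueness is Liouville's theorem: the quotient of two solutions is continuous across the curve, a
smooth curve is removable for continuous functions (`differentiable_of_continuous`), and the
quotient tends to the identity at infinity. -/

namespace ConstantJump

/-! ### Matrix polynomials and moment functionals -/

section Algebra

variable {R : Type*} [Ring R]

/-- The functional `p ↦ ∑ pᵢ w_{i+k}` on polynomials with coefficients on the left. -/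
noncomputable def momL (w : ℕ → R) (p : R[X]) (k : ℕ) : R := p.sum fun i a => a * w (i + k)

/-- The functional `p ↦ ∑ w_{i+k} pᵢ` on polynomials with coefficients on the right. -/
noncomputable def momR (w : ℕ → R) (p : R[X]) (k : ℕ) : R := p.sum fun i a => w (i + k) * a

lemma momL_eq_sum (w : ℕ → R) {p : R[X]} {m : ℕ} (h : p.natDegree < m) (k : ℕ) :
    momL w p k = ∑ i ∈ Finset.range m, p.coeff i * w (i + k) :=
  Polynomial.sum_over_range' _ (by simp) _ h

lemma momR_eq_sum (w : ℕ → R) {p : R[X]} {m : ℕ} (h : p.natDegree < m) (k : ℕ) :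
    momR w p k = ∑ i ∈ Finset.range m, w (i + k) * p.coeff i :=
  Polynomial.sum_over_range' _ (by simp) _ h

lemma momL_sub (w : ℕ → R) (p q : R[X]) (k : ℕ) :
    momL w (p - q) k = momL w p k - momL w q k := by
  have h1 : p.natDegree < max p.natDegree q.natDegree + 1 := by omega
  have h2 : q.natDegree < max p.natDegree q.natDegree + 1 := by omega
  have h3 := (natDegree_sub_le p q).trans_lt (Nat.lt_succ_self _)
  rw [momL_eq_sum w h1, momL_eq_sum w h2, momL_eq_sum w h3, ← Finset.sum_sub_distrib]
  simp [sub_mul]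

lemma momL_C_mul (w : ℕ → R) (a : R) (p : R[X]) (k : ℕ) :
    momL w (C a * p) k = a * momL w p k := by
  have h1 : (C a * p).natDegree < p.natDegree + 1 := by
    have := natDegree_C_mul_le a p
    omega
  rw [momL_eq_sum w h1, momL_eq_sum w (Nat.lt_succ_self _), Finset.mul_sum]
  simp [mul_assoc]

lemma momL_X_mul (w : ℕ → R) (p : R[X]) (k : ℕ) :
    momL w (X * p) k = momL w p (k + 1) := by
  have h1 : (X * p).natDegree < p.natDegree + 2 := by
    have : (X * p).natDegree ≤ (X : R[X]).natDegree + p.natDegree := natDegree_mul_le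
    have := natDegree_X_le (R := R)
    omega
  rw [momL_eq_sum w h1, momL_eq_sum w (Nat.lt_succ_self _), Finset.sum_range_succ']
  simp only [coeff_X_mul, mul_coeff_zero, coeff_X_zero, zero_mul, add_zero]
  refine Finset.sum_congr rfl fun i _ => ?_
  congr 2
  omega

/-- The two ways of evaluating `∑ pᵢ w_{i+j} qⱼ` agree. -/
lemma sum_momL_mul (w : ℕ → R) {p q : R[X]} {m m' : ℕ} (hp : p.natDegree < m)
    (hq : q.natDegree < m') (s : ℕ) :
    ∑ j ∈ Finset.range m', momL w p (j + s) * q.coeff j =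
      ∑ i ∈ Finset.range m, p.coeff i * momR w q (i + s) := by
  simp only [momL_eq_sum w hp, momR_eq_sum w hq, Finset.sum_mul, Finset.mul_sum]
  rw [Finset.sum_comm]
  refine Finset.sum_congr rfl fun i _ => Finset.sum_congr rfl fun j _ => ?_
  rw [mul_assoc, show i + (j + s) = j + (i + s) by omega]

/-- Monic polynomials biorthogonal with respect to a moment sequence with values in a ring. -/
structure IsBiorthogonal (w : ℕ → R) (PL PR : ℕ → R[X]) (H : ℕ → R) : Prop where
  monicL : ∀ n, (PL n).Monic ∧ (PL n).natDegree = n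
  monicR : ∀ n, (PR n).Monic ∧ (PR n).natDegree = n
  unit : ∀ n, IsUnit (H n)
  orthL : ∀ n, ∀ k ≤ n, momL w (PL n) k = if k = n then H n else 0
  orthR : ∀ n, ∀ k ≤ n, momR w (PR n) k = if k = n then H n else 0

namespace IsBiorthogonal

variable {w : ℕ → R} {PL PR : ℕ → R[X]} {H : ℕ → R} (h : IsBiorthogonal w PL PR H)
include h

lemma coeffL_self (n : ℕ) : (PL n).coeff n = 1 := by
  have := (h.monicL n).1
  rwa [Monic, leadingCoeff, (h.monicL n).2] at this

lemma coeffR_self (n : ℕ) : (PR n).coeff n = 1 := by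
  have := (h.monicR n).1
  rwa [Monic, leadingCoeff, (h.monicR n).2] at this

lemma coeffL_of_lt {n k : ℕ} (hk : n < k) : (PL n).coeff k = 0 :=
  coeff_eq_zero_of_natDegree_lt (by rwa [(h.monicL n).2])

lemma ltL (n : ℕ) : (PL n).natDegree < n + 1 := by rw [(h.monicL n).2]; omega

lemma ltR (n : ℕ) : (PR n).natDegree < n + 1 := by rw [(h.monicR n).2]; omega

/-- Pair a nonzero `p` with the right orthogonal polynomial of index `deg p`. Summed one way the
pairing vanishes by hypothesis; summed the other way only the leading coefficient of `p` times a
unit survives. -/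
lemma eq_zero_of_momL_eq_zero {p : R[X]} {n : ℕ} (hp : p.degree < n)
    (h0 : ∀ k < n, momL w p k = 0) : p = 0 := by
  by_contra hne
  have hd : p.natDegree < n := (natDegree_lt_iff_degree_lt hne).2 hp
  have key := sum_momL_mul w (Nat.lt_succ_self p.natDegree) (h.ltR p.natDegree) 0
  rw [Finset.sum_eq_zero fun j hj => ?_, Finset.sum_range_succ, Finset.sum_eq_zero fun j hj => ?_]
    at key
  · rw [add_zero, zero_add, h.orthR _ _ le_rfl, if_pos rfl] at key
    exact hne (leadingCoeff_eq_zero.1 ((h.unit _).mul_left_eq_zero.1 key.symm))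
  · have : j < p.natDegree := Finset.mem_range.1 hj
    rw [add_zero, h.orthR _ _ this.le, if_neg this.ne, mul_zero]
  · rw [add_zero, h0 j (by have := Finset.mem_range.1 hj; omega), zero_mul]

/-- The three-term recurrence. -/
lemma recurrence (n : ℕ) {c : R} (hc : c * H n = H (n + 1)) :
    X * PL (n + 1) = PL (n + 2) +
      C ((PL (n + 1)).coeff n - (PL (n + 2)).coeff (n + 1)) * PL (n + 1) + C c * PL n := by
  rw [← sub_eq_zero, ← sub_sub, ← sub_sub]
  -- The coefficients are chosen so that the two top coefficients cancel; `c * H n = H (n + 1)`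
  -- cancels the moment of order `n`, and the lower moments vanish by orthogonality.
  refine h.eq_zero_of_momL_eq_zero (n := n + 1) ?_ fun k hk => ?_
  · rw [degree_lt_iff_coeff_zero]
    intro k hk
    have hk1 : k = n + 1 ∨ k = n + 2 ∨ n + 2 < k := by omega
    rcases hk1 with rfl | rfl | hk1
    · simp only [coeff_sub, coeff_X_mul, coeff_C_mul, h.coeffL_self,
        h.coeffL_of_lt (Nat.lt_succ_self n), mul_one, mul_zero, sub_self]
    · simp only [coeff_sub, coeff_X_mul, coeff_C_mul, h.coeffL_self,
        h.coeffL_of_lt (Nat.lt_succ_self (n + 1)), h.coeffL_of_lt (show n < n + 2 by omega),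
        mul_zero, sub_self]
    · obtain ⟨l, rfl⟩ : ∃ l, k = l + 1 := ⟨k - 1, by omega⟩
      simp only [coeff_sub, coeff_X_mul, coeff_C_mul, h.coeffL_of_lt hk1,
        h.coeffL_of_lt (show n + 1 < l + 1 by omega), h.coeffL_of_lt (show n < l + 1 by omega),
        h.coeffL_of_lt (show n + 1 < l by omega), mul_zero, sub_zero]
  · rw [momL_sub, momL_sub, momL_sub, momL_C_mul, momL_C_mul, momL_X_mul,
      h.orthL (n + 1) (k + 1) (by omega), h.orthL (n + 2) k (by omega),
      h.orthL (n + 1) k (by omega), h.orthL n k (by omega), if_neg (show k ≠ n + 2 by omega),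
      if_neg (show k ≠ n + 1 by omega), mul_zero, sub_zero, sub_zero]
    by_cases hkn : k = n
    · simp [hkn, hc]
    · simp [hkn]

lemma PL_zero : PL 0 = 1 := (h.monicL 0).1.natDegree_eq_zero.1 (h.monicL 0).2

lemma recurrence_zero : X * PL 0 = PL 1 - C ((PL 1).coeff 0) * PL 0 := by
  have h1 : PL 1 = C ((PL 1).coeff 1) * X + C ((PL 1).coeff 0) :=
    eq_X_add_C_of_natDegree_le_one (h.monicL 1).2.le
  rw [h.PL_zero]
  nth_rw 1 [h1]
  simp [h.coeffL_self 1]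

/-- The second leading coefficients on both sides are conjugate. -/
lemma subleading_conj (n : ℕ) (sL sR : R)
    (hL : n = 0 ∧ sL = 0 ∨ ∃ m, n = m + 1 ∧ sL = (PL n).coeff m)
    (hR : n = 0 ∧ sR = 0 ∨ ∃ m, n = m + 1 ∧ sR = (PR n).coeff m) :
    (sL - (PL (n + 1)).coeff n) * H n = H n * (sR - (PR (n + 1)).coeff n) := by
  -- Three pairings, each summed in two ways. The first two express the moments of order `n + 1` of
  -- the left and right `n`-th polynomials through the next subleading coefficients; the third,
  -- shifted by one, compares these two moments.
  have e1 := sum_momL_mul w (h.ltL n) (h.ltR (n + 1)) 0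
  have e2 := sum_momL_mul w (h.ltL (n + 1)) (h.ltR n) 0
  have e3 := sum_momL_mul w (h.ltL n) (h.ltR n) 1
  have zL : ∀ a b, b < a → momL w (PL a) b = 0 := fun a b hab => by
    rw [h.orthL a b hab.le, if_neg hab.ne]
  have zR : ∀ a b, b < a → momR w (PR a) b = 0 := fun a b hab => by
    rw [h.orthR a b hab.le, if_neg hab.ne]
  have dL : momL w (PL n) n = H n := by rw [h.orthL n n le_rfl, if_pos rfl]
  have dR : momR w (PR n) n = H n := by rw [h.orthR n n le_rfl, if_pos rfl]
  have z1 : ∑ j ∈ Finset.range n, momL w (PL n) (j + 0) * (PR (n + 1)).coeff j = 0 :=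
    Finset.sum_eq_zero fun j hj => by rw [add_zero, zL _ _ (Finset.mem_range.1 hj), zero_mul]
  have z2 : ∑ j ∈ Finset.range (n + 1), (PL n).coeff j * momR w (PR (n + 1)) (j + 0) = 0 :=
    Finset.sum_eq_zero fun j hj => by rw [add_zero, zR _ _ (Finset.mem_range.1 hj), mul_zero]
  have z3 : ∑ j ∈ Finset.range n, (PL (n + 1)).coeff j * momR w (PR n) (j + 0) = 0 :=
    Finset.sum_eq_zero fun j hj => by rw [add_zero, zR _ _ (Finset.mem_range.1 hj), mul_zero]
  have z4 : ∑ j ∈ Finset.range (n + 1), momL w (PL (n + 1)) (j + 0) * (PR n).coeff j = 0 :=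
    Finset.sum_eq_zero fun j hj => by rw [add_zero, zL _ _ (Finset.mem_range.1 hj), zero_mul]
  rw [z2, Finset.sum_range_succ, Finset.sum_range_succ, z1] at e1
  rw [z4, Finset.sum_range_succ, Finset.sum_range_succ, z3] at e2
  simp only [add_zero, zero_add, h.coeffR_self, h.coeffL_self, mul_one, one_mul, dL, dR] at e1 e2
  have lhs : ∑ j ∈ Finset.range (n + 1), momL w (PL n) (j + 1) * (PR n).coeff j =
      momL w (PL n) (n + 1) + H n * sR := by
    rw [Finset.sum_range_succ, h.coeffR_self, mul_one, add_comm]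
    congr 1
    rcases hR with ⟨rfl, rfl⟩ | ⟨m, rfl, rfl⟩
    · simp
    · rw [Finset.sum_range_succ, dL, Finset.sum_eq_zero fun j hj => ?_, zero_add]
      have := Finset.mem_range.1 hj; rw [zL _ _ (by omega), zero_mul]
  have rhs : ∑ j ∈ Finset.range (n + 1), (PL n).coeff j * momR w (PR n) (j + 1) =
      momR w (PR n) (n + 1) + sL * H n := by
    rw [Finset.sum_range_succ, h.coeffL_self, one_mul, add_comm]
    congr 1
    rcases hL with ⟨rfl, rfl⟩ | ⟨m, rfl, rfl⟩
    · simp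
    · rw [Finset.sum_range_succ, dR, Finset.sum_eq_zero fun j hj => ?_, zero_add]
      have := Finset.mem_range.1 hj; rw [zR _ _ (by omega), mul_zero]
  rw [lhs, rhs] at e3
  rw [eq_neg_of_add_eq_zero_right e1, eq_neg_of_add_eq_zero_right e2.symm] at e3
  rw [sub_mul, mul_sub, sub_eq_add_neg, sub_eq_add_neg, add_comm, ← e3, add_comm]

end IsBiorthogonal

end Algebra

/-! ### Existence of the orthogonal polynomials -/

section Existence

variable {N : ℕ}

/-- The block Hankel matrix of a sequence of matrices. -/
def blockHankel (w : ℕ → Mat N) (n : ℕ) :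
    Matrix (Fin (n + 1) × Fin N) (Fin (n + 1) × Fin N) ℂ :=
  Matrix.of fun a b => w (a.1 + b.1) a.2 b.2

/-- The row index `m` is arbitrary because the identity serves both for matrix coefficients and for
a single row vector. -/
lemma vecMul_blockHankel (w : ℕ → Mat N) (n : ℕ) {m : Type*} (a : ℕ → Matrix m (Fin N) ℂ)
    (r : m) (k : Fin (n + 1)) (c : Fin N) :
    ∑ x : Fin (n + 1) × Fin N, a x.1 r x.2 * blockHankel w n x (k, c) =
      (∑ i ∈ Finset.range (n + 1), a i * w (i + k)) r c := by
  rw [Fintype.sum_prod_type, Finset.sum_range, Matrix.sum_apply]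
  simp [blockHankel, Matrix.mul_apply]

/-- Orthogonality to the lower powers is a linear system for the lower coefficients whose matrix is
the block Hankel matrix of order `n - 1`. -/
lemma exists_monic_momL (w : ℕ → Mat N) (hw : ∀ n, (blockHankel w n).det ≠ 0) (n : ℕ) :
    ∃ p : (Mat N)[X], p.coeff n = 1 ∧ p.natDegree ≤ n ∧ ∀ k < n, momL w p k = 0 := by
  rcases n with _ | n
  · exact ⟨1, by simp, by simp, by simp⟩
  let B : Matrix (Fin N) (Fin (n + 1) × Fin N) ℂ := Matrix.of fun r x => -w (n + 1 + x.1) r x.2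
  let A := B * (blockHankel w n)⁻¹
  have hA : A * blockHankel w n = B := by
    rw [Matrix.mul_assoc, Matrix.nonsing_inv_mul _ (isUnit_iff_ne_zero.2 (hw n)), Matrix.mul_one]
  let a : ℕ → Mat N := fun i =>
    Matrix.of fun r s => if h : i < n + 1 then A r (⟨i, h⟩, s) else 0
  let p : (Mat N)[X] := X ^ (n + 1) + ∑ i ∈ Finset.range (n + 1), C (a i) * X ^ i
  have hcoeff : ∀ i < n + 1, p.coeff i = a i := by
    intro i hi
    simp only [p, coeff_add, coeff_X_pow, hi.ne, if_false, zero_add, finsetSum_coeff,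
      coeff_C_mul]
    rw [Finset.sum_eq_single i]
    · simp
    · intro j _ hj; simp [Ne.symm hj]
    · intro h; exact absurd (Finset.mem_range.2 hi) h
  have htop : p.coeff (n + 1) = 1 := by
    simp only [p, coeff_add, coeff_X_pow, if_true, finsetSum_coeff, coeff_C_mul]
    rw [Finset.sum_eq_zero, add_zero]
    intro j hj
    have := Finset.mem_range.1 hj
    rw [if_neg (by omega), mul_zero]
  have hdeg : p.natDegree ≤ n + 1 := by
    refine (natDegree_add_le _ _).trans (max_le (natDegree_X_pow_le _) ?_)
    refine natDegree_sum_le_of_forall_le _ _ fun i hi => ?_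
    have := Finset.mem_range.1 hi
    exact (natDegree_C_mul_X_pow_le _ _).trans (by omega)
  refine ⟨p, htop, hdeg, fun k hk => ?_⟩
  rw [momL_eq_sum w (Nat.lt_succ_of_le hdeg), Finset.sum_range_succ, htop, one_mul]
  ext r c
  have h1 := vecMul_blockHankel w n a r ⟨k, hk⟩ c
  have h2 := congrFun (congrFun hA r) (⟨k, hk⟩, c)
  rw [Matrix.mul_apply] at h2
  simp only [a, Matrix.of_apply, Fin.is_lt, dif_pos] at h1
  rw [h2] at h1
  simp only [B, Matrix.of_apply] at h1
  rw [Finset.sum_congr rfl fun i hi => by rw [hcoeff i (Finset.mem_range.1 hi)], Matrix.add_apply]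
  simp only [a]
  rw [← h1]
  simp

/-- If a row vector `v` annihilates the norm, the coefficients of `v p` form a left null vector of
the Hankel matrix. The top coefficient of `v p` is `v`, so `v = 0`. -/
lemma isUnit_momL (w : ℕ → Mat N) (hw : ∀ n, (blockHankel w n).det ≠ 0) {n : ℕ} {p : (Mat N)[X]}
    (h1 : p.coeff n = 1) (hd : p.natDegree ≤ n) (h0 : ∀ k < n, momL w p k = 0) :
    IsUnit (momL w p n) := by
  rw [Matrix.isUnit_iff_isUnit_det, isUnit_iff_ne_zero]
  intro hdet
  obtain ⟨v, hv, hv0⟩ := Matrix.exists_vecMul_eq_zero_iff.2 hdet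
  let V : Matrix Unit (Fin N) ℂ := Matrix.of fun _ s => v s
  have hV0 : V * momL w p n = 0 := by
    ext _ c
    have := congrFun hv0 c
    simpa [V, Matrix.mul_apply, Matrix.vecMul, dotProduct] using this
  have hu : (fun x : Fin (n + 1) × Fin N => (V * p.coeff x.1) () x.2) = 0 := by
    refine Matrix.eq_zero_of_vecMul_eq_zero (hw n) ?_
    ext ⟨k, c⟩
    have := vecMul_blockHankel w n (fun i => V * p.coeff i) () k c
    simp only [Matrix.vecMul, dotProduct]
    rw [this]
    simp only [Matrix.mul_assoc]
    rw [← Matrix.mul_sum, ← momL_eq_sum w (Nat.lt_succ_of_le hd)]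
    rcases Nat.lt_succ_iff_lt_or_eq.1 k.2 with hk | hk
    · rw [h0 _ hk]; simp
    · rw [hk, hV0]; simp
  refine hv (funext fun s => ?_)
  have := congrFun hu (Fin.last n, s)
  simpa [h1, V] using this

end Existence

end ConstantJump

namespace ConstantJump

/-! ### Curve integrals of matrix functions -/

lemma IsSmoothCurve.isClosed_range {γ : ℝ → ℂ} (hγ : IsSmoothCurve γ) :
    IsClosed (Set.range γ) :=
  (isProperMap_iff_tendsto_cocompact.2 ⟨hγ.smooth.continuous, hγ.proper⟩).isClosedMap.isClosed_range

lemma IsSmoothCurve.continuous_deriv {γ : ℝ → ℂ} (hγ : IsSmoothCurve γ) :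
    Continuous (deriv γ) :=
  hγ.smooth.continuous_deriv (by norm_num)

lemma IsSmoothCurve.hasDerivAt {γ : ℝ → ℂ} (hγ : IsSmoothCurve γ) (t : ℝ) :
    HasDerivAt γ (deriv γ t) t :=
  (hγ.smooth.differentiable (by norm_num) t).hasDerivAt

/-- Entrywise integrability of `F(z) dz` on the curve. -/
def CurveIntegrable {N : ℕ} (γ : ℝ → ℂ) (F : ℂ → Mat N) : Prop :=
  ∀ i j, Integrable fun t : ℝ => F (γ t) i j * deriv γ t

section CurveInt

variable {N : ℕ} {γ : ℝ → ℂ}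

lemma CurveIntegrable.const_mul {F : ℂ → Mat N} (hF : CurveIntegrable γ F) (A : Mat N) :
    CurveIntegrable γ fun z => A * F z := by
  intro i j
  simp only [Matrix.mul_apply, Finset.sum_mul, mul_assoc]
  exact integrable_finsetSum _ fun l _ => (hF l j).const_mul _

lemma curveInt_const_mul {F : ℂ → Mat N} (hF : CurveIntegrable γ F) (A : Mat N) :
    curveInt γ (fun z => A * F z) = A * curveInt γ F := by
  ext i j
  simp only [curveInt, Matrix.of_apply, Matrix.mul_apply, Finset.sum_mul, mul_assoc]
  rw [integral_finsetSum _ fun l _ => (hF l j).const_mul _, Finset.mul_sum, ]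
  refine Finset.sum_congr rfl fun l _ => ?_
  rw [integral_const_mul]
  ring

lemma curveInt_sum {ι : Type*} (s : Finset ι) {F : ι → ℂ → Mat N}
    (hF : ∀ i ∈ s, CurveIntegrable γ (F i)) :
    curveInt γ (fun z => ∑ i ∈ s, F i z) = ∑ i ∈ s, curveInt γ (F i) := by
  ext i j
  simp only [curveInt, Matrix.of_apply, Matrix.sum_apply, Finset.sum_mul]
  rw [integral_finsetSum _ fun l hl => hF l hl i j, Finset.mul_sum]

lemma curveInt_transpose (F : ℂ → Mat N) :
    curveInt γ (fun z => (F z).transpose) = (curveInt γ F).transpose := rfl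

lemma curveInt_congr {F G : ℂ → Mat N} (h : ∀ z ∈ Set.range γ, F z = G z) :
    curveInt γ F = curveInt γ G := by
  ext i j
  simp only [curveInt, Matrix.of_apply, h _ (Set.mem_range_self _)]

lemma HasFiniteMoments.curveIntegrable {W : ℂ → Mat N} (h : HasFiniteMoments γ W) (n : ℕ) :
    CurveIntegrable γ fun z => z ^ n • W z := h n

lemma continuous_inv_sub {γ : ℝ → ℂ} (hγ : Continuous γ) {z : ℂ} (hz : z ∉ Set.range γ) :
    Continuous fun t => (γ t - z)⁻¹ :=
  (hγ.sub continuous_const).inv₀ fun t h => hz ⟨t, sub_eq_zero.1 h⟩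

lemma norm_inv_sub_le {γ : ℝ → ℂ} {z : ℂ} {δ : ℝ} (hδ : 0 < δ)
    (h : δ ≤ Metric.infDist z (Set.range γ)) (t : ℝ) : ‖(γ t - z)⁻¹‖ ≤ δ⁻¹ := by
  rw [norm_inv]
  refine inv_anti₀ hδ (h.trans ?_)
  rw [← dist_eq_norm, dist_comm]
  exact Metric.infDist_le_dist_of_mem (Set.mem_range_self t)

lemma IsSmoothCurve.infDist_pos (hγ : IsSmoothCurve γ) {z : ℂ} (hz : z ∉ Set.range γ) :
    0 < Metric.infDist z (Set.range γ) :=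
  (hγ.isClosed_range.notMem_iff_infDist_pos (Set.range_nonempty γ)).1 hz

lemma IsSmoothCurve.integrable_div (hγ : IsSmoothCurve γ) {g : ℝ → ℂ} (hg : Integrable g)
    {z : ℂ} (hz : z ∉ Set.range γ) : Integrable fun t => (γ t - z)⁻¹ * g t :=
  hg.bdd_mul (continuous_inv_sub hγ.smooth.continuous hz).aestronglyMeasurable
    (Eventually.of_forall (norm_inv_sub_le (hγ.infDist_pos hz) le_rfl))

lemma HasFiniteMoments.curveIntegrable_cauchy {W : ℂ → Mat N} (h : HasFiniteMoments γ W)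
    (hγ : IsSmoothCurve γ) {z : ℂ} (hz : z ∉ Set.range γ) (k : ℕ) :
    CurveIntegrable γ fun w => (w - z)⁻¹ • (w ^ k • W w) := by
  intro i j
  simpa [mul_assoc] using hγ.integrable_div (h k i j) hz

/-- The Cauchy transforms of `z ^ k W(z)`. -/
noncomputable def cauchyMoment (γ : ℝ → ℂ) (W : ℂ → Mat N) (z : ℂ) (k : ℕ) : Mat N :=
  curveInt γ fun w => (w - z)⁻¹ • (w ^ k • W w)

/-- This is `w ^ (k + 1) / (w - z) = z * w ^ k / (w - z) + w ^ k` under the integral. -/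
lemma cauchyMoment_succ {W : ℂ → Mat N} (h : HasFiniteMoments γ W)
    (hγ : IsSmoothCurve γ) {z : ℂ} (hz : z ∉ Set.range γ) (k : ℕ) :
    cauchyMoment γ W z (k + 1) = z • cauchyMoment γ W z k + moment γ W k := by
  have e1 := curveInt_const_mul (h.curveIntegrable_cauchy hγ hz k) (z • (1 : Mat N))
  -- Additivity for two summands, written as a sum over `Bool`.
  have e2 := curveInt_sum (γ := γ) (Finset.univ : Finset Bool)
    (F := fun b w => if b then (z • (1 : Mat N)) * ((w - z)⁻¹ • (w ^ k • W w)) else w ^ k • W w)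
    (by
      rintro (_ | _) -
      · simpa using h.curveIntegrable k
      · simpa using (h.curveIntegrable_cauchy hγ hz k).const_mul (z • (1 : Mat N)))
  simp only [Fintype.sum_bool, if_true, Bool.false_eq_true, if_false] at e2
  rw [e1, smul_one_mul] at e2
  unfold cauchyMoment moment
  rw [← e2]
  refine curveInt_congr fun w hw => ?_
  have hne : w - z ≠ 0 := fun h0 => hz (sub_eq_zero.1 h0 ▸ hw)
  ext i j
  simp only [Matrix.smul_apply, Matrix.add_apply, smul_one_mul, smul_eq_mul]
  field_simp
  ring

/-- Evaluation is itself a moment functional, so linear identities for `momL` treat the polynomials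
and the functions of the second kind together. -/
lemma evalAt_eq_momL (P : (Mat N)[X]) (z : ℂ) :
    evalAt P z = momL (fun k => z ^ k • (1 : Mat N)) P 0 := by
  rw [evalAt, eval_eq_sum, momL]
  simp [_root_.smul_pow]

lemma evalAt_eq_sum {P : (Mat N)[X]} {m : ℕ} (h : P.natDegree < m) (z : ℂ) :
    evalAt P z = ∑ i ∈ Finset.range m, z ^ i • P.coeff i := by
  rw [evalAt_eq_momL, momL_eq_sum _ h]
  simp

/-- The scalar `g` is a power of `w` in the orthogonality relations and the Cauchy kernel in the
functions of the second kind. -/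
lemma curveInt_evalAt_mul {W : ℂ → Mat N} {g : ℂ → ℂ}
    (h : ∀ k : ℕ, CurveIntegrable γ fun w => g w • (w ^ k • W w)) (P : (Mat N)[X]) :
    curveInt γ (fun w => g w • (evalAt P w * W w)) =
      momL (fun k => curveInt γ fun w => g w • (w ^ k • W w)) P 0 := by
  rw [momL_eq_sum _ (Nat.lt_succ_self _)]
  simp only [add_zero]
  rw [← Finset.sum_congr rfl fun i _ => curveInt_const_mul (h i) (P.coeff i),
    ← curveInt_sum _ fun i _ => (h i).const_mul (P.coeff i)]
  refine curveInt_congr fun w _ => ?_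
  rw [evalAt_eq_sum (Nat.lt_succ_self _), Finset.sum_mul, Finset.smul_sum]
  simp

lemma secondKindL_eq {W : ℂ → Mat N} (h : HasFiniteMoments γ W)
    (hγ : IsSmoothCurve γ) {z : ℂ} (hz : z ∉ Set.range γ) (P : (Mat N)[X]) :
    secondKindL γ W P z = momL (cauchyMoment γ W z) P 0 :=
  curveInt_evalAt_mul (fun k => h.curveIntegrable_cauchy hγ hz k) P

lemma curveInt_pow_evalAt {W : ℂ → Mat N} (h : HasFiniteMoments γ W) (P : (Mat N)[X]) (k : ℕ) :
    curveInt γ (fun z => z ^ k • (evalAt P z * W z)) = momL (moment γ W) P k := by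
  have e (i : ℕ) : (fun z : ℂ => z ^ k • z ^ i • W z) = fun z => z ^ (i + k) • W z := by
    funext z
    rw [smul_smul, ← pow_add, add_comm]
  rw [curveInt_evalAt_mul (g := fun z => z ^ k) fun i => by rw [e]; exact h.curveIntegrable _]
  simp only [momL, e, add_zero]
  rfl

end CurveInt

/-! ### Transposition -/

section Transpose

variable {N : ℕ} {γ : ℝ → ℂ}

/-- Transposition of the coefficients of a matrix polynomial. -/
noncomputable def polyTranspose (P : (Mat N)[X]) : (Mat N)[X] :=
  ∑ i ∈ Finset.range (P.natDegree + 1), monomial i (P.coeff i).transpose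

@[simp] lemma coeff_polyTranspose (P : (Mat N)[X]) (k : ℕ) :
    (polyTranspose P).coeff k = (P.coeff k).transpose := by
  simp only [polyTranspose, finsetSum_coeff, coeff_monomial, Finset.sum_ite_eq',
    Finset.mem_range]
  split_ifs with h
  · rfl
  · rw [coeff_eq_zero_of_natDegree_lt (by omega), Matrix.transpose_zero]

@[simp] lemma polyTranspose_polyTranspose (P : (Mat N)[X]) :
    polyTranspose (polyTranspose P) = P := by
  ext1 k; simp

@[simp] lemma natDegree_polyTranspose (P : (Mat N)[X]) :
    (polyTranspose P).natDegree = P.natDegree := by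
  have key (Q : (Mat N)[X]) : (polyTranspose Q).natDegree ≤ Q.natDegree :=
    natDegree_le_iff_coeff_eq_zero.2 fun k hk => by
      rw [coeff_polyTranspose, coeff_eq_zero_of_natDegree_lt hk, Matrix.transpose_zero]
  refine (key P).antisymm ?_
  simpa using key (polyTranspose P)

lemma monic_polyTranspose {P : (Mat N)[X]} (h : P.Monic) : (polyTranspose P).Monic := by
  rw [Monic, leadingCoeff] at *
  simp [h]

lemma evalAt_polyTranspose (P : (Mat N)[X]) (z : ℂ) :
    evalAt (polyTranspose P) z = (evalAt P z).transpose := by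
  rw [evalAt_eq_sum (m := P.natDegree + 1) (by simp), evalAt_eq_sum (Nat.lt_succ_self _),
    Matrix.transpose_sum]
  simp

lemma momL_polyTranspose (w : ℕ → Mat N) (P : (Mat N)[X]) (k : ℕ) :
    momL (fun k => (w k).transpose) (polyTranspose P) k = (momR w P k).transpose := by
  rw [momL_eq_sum (m := P.natDegree + 1) _ (by simp), momR_eq_sum w (Nat.lt_succ_self _),
    Matrix.transpose_sum]
  simp

lemma IsOrthogonal.transpose {W : ℂ → Mat N} {PL PR : ℕ → (Mat N)[X]} {C : ℕ → Mat N}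
    (h : IsOrthogonal γ W PL PR C) :
    IsOrthogonal γ (fun z => (W z).transpose) (fun n => polyTranspose (PR n))
      (fun n => polyTranspose (PL n)) fun n => (C n).transpose where
  monicL n := ⟨monic_polyTranspose (h.monicR n).1, by simp [(h.monicR n).2]⟩
  monicR n := ⟨monic_polyTranspose (h.monicL n).1, by simp [(h.monicL n).2]⟩
  nonsingular n := by
    rw [Matrix.isUnit_transpose]
    exact h.nonsingular n
  orthL n k hk := by
    have := congrArg Matrix.transpose (h.orthR n k hk)
    rw [← curveInt_transpose] at this
    simp only [evalAt_polyTranspose, ← Matrix.transpose_mul, ← Matrix.transpose_smul]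
    rw [this]
    split_ifs <;> simp [Matrix.transpose_nonsing_inv]
  orthR n k hk := by
    have := congrArg Matrix.transpose (h.orthL n k hk)
    rw [← curveInt_transpose] at this
    simp only [evalAt_polyTranspose, ← Matrix.transpose_mul, ← Matrix.transpose_smul]
    rw [this]
    split_ifs <;> simp [Matrix.transpose_nonsing_inv]

lemma HasFiniteMoments.transpose {W : ℂ → Mat N} (h : HasFiniteMoments γ W) :
    HasFiniteMoments γ fun z => (W z).transpose := fun n i j => h n j i

lemma moment_transpose (W : ℂ → Mat N) (n : ℕ) :
    moment γ (fun z => (W z).transpose) n = (moment γ W n).transpose := rfl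

lemma curveInt_pow_evalAt_right {W : ℂ → Mat N} (h : HasFiniteMoments γ W) (P : (Mat N)[X])
    (k : ℕ) : curveInt γ (fun z => z ^ k • (W z * evalAt P z)) = momR (moment γ W) P k := by
  have e1 := curveInt_pow_evalAt h.transpose (polyTranspose P) k
  have e2 := momL_polyTranspose (moment γ W) P k
  simp only [evalAt_polyTranspose, ← Matrix.transpose_mul, ← Matrix.transpose_smul] at e1
  rw [curveInt_transpose] at e1
  exact Matrix.transpose_injective (e1.trans e2)

lemma IsOrthogonal.isBiorthogonal {W : ℂ → Mat N} (hmom : HasFiniteMoments γ W)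
    {PL PR : ℕ → (Mat N)[X]} {C : ℕ → Mat N} (h : IsOrthogonal γ W PL PR C) :
    IsBiorthogonal (moment γ W) PL PR fun n => (C n)⁻¹ where
  monicL := h.monicL
  monicR := h.monicR
  unit n := Matrix.isUnit_nonsing_inv_iff.2 (h.nonsingular n)
  orthL n k hk := by rw [← curveInt_pow_evalAt hmom, h.orthL n k hk]
  orthR n k hk := by rw [← curveInt_pow_evalAt_right hmom, h.orthR n k hk]

lemma secondKindR_eq_transpose (W : ℂ → Mat N) (P : (Mat N)[X]) (z : ℂ) :
    secondKindR γ W P z =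
      (secondKindL γ (fun z => (W z).transpose) (polyTranspose P) z).transpose := by
  simp only [secondKindL, evalAt_polyTranspose, ← Matrix.transpose_mul, ← Matrix.transpose_smul]
  rfl

lemma fundR_eq_transpose (W : ℂ → Mat N) (PR : ℕ → (Mat N)[X]) (C : ℕ → Mat N) (n : ℕ) (z : ℂ) :
    fundR γ W PR C n z = (fundL γ (fun z => (W z).transpose) (fun n => polyTranspose (PR n))
      (fun n => (C n).transpose) n z).transpose := by
  cases n <;>
  simp [fundR, fundL, Matrix.fromBlocks_transpose, secondKindR_eq_transpose, evalAt_polyTranspose]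

lemma constJumpR_eq_transpose (W WL WR : ℂ → Mat N) (PR : ℕ → (Mat N)[X]) (C : ℕ → Mat N)
    (n : ℕ) (z : ℂ) :
    constJumpR γ W WL WR PR C n z = (constJumpL γ (fun z => (W z).transpose)
      (fun z => (WR z).transpose) (fun z => (WL z).transpose) (fun n => polyTranspose (PR n))
      (fun n => (C n).transpose) n z).transpose := by
  simp [constJumpR, constJumpL, fundR_eq_transpose, Matrix.fromBlocks_transpose,
    Matrix.transpose_nonsing_inv]

lemma subleading_polyTranspose (PR : ℕ → (Mat N)[X]) (n : ℕ) :
    subleading (fun n => polyTranspose (PR n)) n = (subleading PR n).transpose := by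
  cases n <;> simp [subleading]

lemma subleading_cases (P : ℕ → (Mat N)[X]) (n : ℕ) :
    n = 0 ∧ subleading P n = 0 ∨ ∃ m, n = m + 1 ∧ subleading P n = (P n).coeff m := by
  cases n with
  | zero => exact Or.inl ⟨rfl, rfl⟩
  | succ m => exact Or.inr ⟨m, rfl, rfl⟩

/-- Conjugation by `C n` turns differences of left subleading coefficients into those of the right
polynomials, by `subleading_conj`. This identifies the right transfer matrix with a transposed left
one. -/
lemma IsOrthogonal.betaR_eq {W : ℂ → Mat N} (hmom : HasFiniteMoments γ W)
    {PL PR : ℕ → (Mat N)[X]} {C : ℕ → Mat N} (h : IsOrthogonal γ W PL PR C) (n : ℕ) :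
    betaR PL C n = (betaL (fun n => polyTranspose (PR n)) n).transpose := by
  have := (h.isBiorthogonal hmom).subleading_conj n _ _ (subleading_cases PL n)
    (subleading_cases PR n)
  have hu := (Matrix.isUnit_iff_isUnit_det _).1 (h.nonsingular n)
  simp only [betaR, betaL, subleading_polyTranspose, ← Matrix.transpose_sub,
    Matrix.transpose_transpose]
  simp only [subleading] at this ⊢
  rw [Matrix.mul_assoc, this, ← Matrix.mul_assoc, Matrix.mul_nonsing_inv _ hu, Matrix.one_mul]

lemma IsOrthogonal.transferR_eq {W : ℂ → Mat N} (hmom : HasFiniteMoments γ W)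
    {PL PR : ℕ → (Mat N)[X]} {C : ℕ → Mat N} (h : IsOrthogonal γ W PL PR C) (n : ℕ) (z : ℂ) :
    transferR PL C n z = (transferL (fun n => polyTranspose (PR n))
      (fun n => (C n).transpose) n z).transpose := by
  simp [transferR, transferL, h.betaR_eq hmom, Matrix.fromBlocks_transpose,
    Matrix.transpose_nonsing_inv]

lemma IsRegularWeight.blockHankel {W : ℂ → Mat N} (h : IsRegularWeight γ W) (n : ℕ) :
    (blockHankel (moment γ W) n).det ≠ 0 := h n

lemma IsRegularWeight.transpose {W : ℂ → Mat N} (h : IsRegularWeight γ W) :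
    IsRegularWeight γ fun z => (W z).transpose := by
  intro n
  have : hankel γ (fun z => (W z).transpose) n = (hankel γ W n).transpose := by
    ext a b
    simp [hankel, moment_transpose, add_comm]
  rw [this, Matrix.det_transpose]
  exact h n

/-- The right polynomials are the transposes of left polynomials for the transposed weight. -/
theorem exists_isOrthogonal {W : ℂ → Mat N} (hN : 0 < N) (hmom : HasFiniteMoments γ W)
    (hreg : IsRegularWeight γ W) :
    ∃ (PL PR : ℕ → (Mat N)[X]) (C : ℕ → Mat N), IsOrthogonal γ W PL PR C := by
  -- For matrices of size zero `1 = 0`, and a monic polynomial would not have degree `n`.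
  have : Nonempty (Fin N) := ⟨⟨0, hN⟩⟩
  choose PL l1 l2 l3 using exists_monic_momL (moment γ W) hreg.blockHankel
  choose PR' r1 r2 r3 using exists_monic_momL (moment γ fun z => (W z).transpose)
    hreg.transpose.blockHankel
  have hdeg {p : (Mat N)[X]} {n : ℕ} (h1 : p.coeff n = 1) (h2 : p.natDegree ≤ n) :
      p.Monic ∧ p.natDegree = n := by
    have : p.natDegree = n := h2.antisymm (le_natDegree_of_ne_zero (by rw [h1]; exact one_ne_zero))
    exact ⟨by rw [Monic, leadingCoeff, this, h1], this⟩
  have hPR (n k : ℕ) : momR (moment γ W) (polyTranspose (PR' n)) k =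
      (momL (moment γ fun z => (W z).transpose) (PR' n) k).transpose := by
    rw [← Matrix.transpose_transpose (momR _ _ _), ← momL_polyTranspose,
      polyTranspose_polyTranspose]
    rfl
  have hu n := isUnit_momL (moment γ W) hreg.blockHankel (l1 n) (l2 n) (l3 n)
  -- Both norms equal the pairing of the left with the right polynomial of index `n`, so a single `C
  -- n` serves both sides.
  have hH (n : ℕ) : momL (moment γ W) (PL n) n =
      momR (moment γ W) (polyTranspose (PR' n)) n := by
    have key := sum_momL_mul (moment γ W) (Nat.lt_succ_of_le (l2 n))
      (q := polyTranspose (PR' n)) (m' := n + 1) (by simpa [Nat.lt_succ_iff] using r2 n) 0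
    rw [Finset.sum_range_succ, Finset.sum_range_succ, Finset.sum_eq_zero fun j hj => ?_,
      Finset.sum_eq_zero fun j hj => ?_] at key
    · simpa [l1, r1] using key
    · rw [add_zero, hPR, r3 _ _ (Finset.mem_range.1 hj), Matrix.transpose_zero, mul_zero]
    · rw [add_zero, l3 _ _ (Finset.mem_range.1 hj), zero_mul]
  refine ⟨PL, fun n => polyTranspose (PR' n), fun n => (momL (moment γ W) (PL n) n)⁻¹,
    ⟨fun n => hdeg (l1 n) (l2 n), fun n => hdeg (by simp [r1]) (by simpa using r2 n),
      fun n => Matrix.isUnit_nonsing_inv_iff.2 (hu n), fun n k hk => ?_, fun n k hk => ?_⟩⟩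
  · rw [curveInt_pow_evalAt hmom,
      Matrix.nonsing_inv_nonsing_inv _ ((Matrix.isUnit_iff_isUnit_det _).1 (hu n))]
    split_ifs with h
    · rw [h]
    · exact l3 n k (by omega)
  · rw [curveInt_pow_evalAt_right hmom,
      Matrix.nonsing_inv_nonsing_inv _ ((Matrix.isUnit_iff_isUnit_det _).1 (hu n))]
    split_ifs with h
    · rw [h, hH]
    · rw [hPR, r3 n k (by omega), Matrix.transpose_zero]

end Transpose

/-! ### Transfer matrices -/

section Transfer

variable {N : ℕ} {γ : ℝ → ℂ}

lemma momL_cauchyMoment_succ {W : ℂ → Mat N} (h : HasFiniteMoments γ W)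
    (hγ : IsSmoothCurve γ) {z : ℂ} (hz : z ∉ Set.range γ) (P : (Mat N)[X]) (k : ℕ) :
    momL (cauchyMoment γ W z) P (k + 1) =
      z • momL (cauchyMoment γ W z) P k + momL (moment γ W) P k := by
  simp only [momL_eq_sum _ (Nat.lt_succ_self P.natDegree), ← add_assoc,
    cauchyMoment_succ h hγ hz, Finset.smul_sum, ← Finset.sum_add_distrib]
  simp [mul_add]

lemma momL_cauchyMoment_X_mul {W : ℂ → Mat N} (h : HasFiniteMoments γ W)
    (hγ : IsSmoothCurve γ) {z : ℂ} (hz : z ∉ Set.range γ) (P : (Mat N)[X]) :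
    momL (cauchyMoment γ W z) (X * P) 0 =
      z • momL (cauchyMoment γ W z) P 0 + momL (moment γ W) P 0 := by
  rw [momL_X_mul, momL_cauchyMoment_succ h hγ hz]

lemma evalAt_X_mul (P : (Mat N)[X]) (z : ℂ) : evalAt (X * P) z = z • evalAt P z := by
  rw [evalAt_eq_momL, evalAt_eq_momL, momL_X_mul]
  simp only [momL_eq_sum _ (Nat.lt_succ_self P.natDegree), Finset.smul_sum]
  simp [pow_succ', mul_smul]

/-- The recurrence is evaluated once at `z` and once under the Cauchy moments. Multiplication by `X`
produces an extra zeroth moment in the second case: it is zero for positive index, and for index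
zero it is `(C 0)⁻¹`, matching the block `I` in the lower row of the initial matrix. -/
theorem transferL_mul_fundL {W : ℂ → Mat N} (hγ : IsSmoothCurve γ) (hmom : HasFiniteMoments γ W)
    {PL PR : ℕ → (Mat N)[X]} {C : ℕ → Mat N} (h : IsOrthogonal γ W PL PR C) (n : ℕ) {z : ℂ}
    (hz : z ∉ Set.range γ) :
    transferL PL C n z * fundL γ W PL C n z = fundL γ W PL C (n + 1) z := by
  have hb := h.isBiorthogonal hmom
  have hu n := (Matrix.isUnit_iff_isUnit_det _).1 (h.nonsingular n)
  cases n with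
  | zero =>
    have e := hb.recurrence_zero
    have e1 := congrArg (fun p => evalAt p z) e
    have e2 := congrArg (fun p => momL (cauchyMoment γ W z) p 0) e
    simp only [evalAt_X_mul] at e1
    simp only [momL_cauchyMoment_X_mul hmom hγ hz, momL_sub, momL_C_mul,
      hb.orthL 0 0 le_rfl, if_true] at e2
    simp only [evalAt_eq_momL, momL_sub, momL_C_mul] at e1
    simp only [transferL, fundL, Matrix.fromBlocks_multiply, betaL, subleading, zero_sub, sub_neg_eq_add,
      secondKindL_eq hmom hγ hz, evalAt_eq_momL, Matrix.add_mul, smul_one_mul]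
    rw [e1]
    congr 1
    · simp
    · rw [Matrix.mul_one, add_right_comm, e2]; simp
    · simp
    · simp
  | succ n =>
    have e := hb.recurrence n (c := (C (n + 1))⁻¹ * C n) (by
      rw [Matrix.mul_assoc, Matrix.mul_nonsing_inv _ (hu n), Matrix.mul_one])
    rw [← sub_eq_iff_eq_add, ← sub_eq_iff_eq_add] at e
    have e1 := congrArg (fun p => evalAt p z) e
    have e2 := congrArg (fun p => momL (cauchyMoment γ W z) p 0) e
    simp only [evalAt_eq_momL, momL_sub, momL_C_mul] at e1
    rw [← evalAt_eq_momL, evalAt_X_mul] at e1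
    simp only [momL_cauchyMoment_X_mul hmom hγ hz, momL_sub, momL_C_mul,
      hb.orthL (n + 1) 0 (by omega), if_neg (Nat.succ_ne_zero n).symm, add_zero] at e2
    simp only [transferL, fundL, Matrix.fromBlocks_multiply, betaL, subleading,
      secondKindL_eq hmom hγ hz, evalAt_eq_momL]
    rw [evalAt_eq_momL] at e1
    rw [← e1, ← e2]
    congr 1
    · simp [sub_mul, Matrix.mul_assoc]; abel
    · simp [sub_mul, Matrix.mul_assoc]; abel
    · simp
    · simp

theorem transferL_mul_constJumpL {W : ℂ → Mat N} (WL WR : ℂ → Mat N) (hγ : IsSmoothCurve γ)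
    (hmom : HasFiniteMoments γ W)
    {PL PR : ℕ → (Mat N)[X]} {C : ℕ → Mat N} (h : IsOrthogonal γ W PL PR C) (n : ℕ) {z : ℂ}
    (hz : z ∉ Set.range γ) :
    transferL PL C n z * constJumpL γ W WL WR PL C n z = constJumpL γ W WL WR PL C (n + 1) z := by
  rw [constJumpL, ← Matrix.mul_assoc, transferL_mul_fundL hγ hmom h n hz, constJumpL]

end Transfer

end ConstantJump

namespace ConstantJump

/-! ### Holomorphic dependence of integrals on a parameter -/

/-- An integral of a dominated family of holomorphic functions is holomorphic. -/
lemma differentiableOn_integral_of_dominated {α : Type*} [MeasurableSpace α] {μ : Measure α}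
    {F : ℂ → α → ℂ} {U : Set ℂ} (hU : IsOpen U) {bound : α → ℝ}
    (hmeas : ∀ z ∈ U, AEStronglyMeasurable (F z) μ)
    (hdiff : ∀ s, DifferentiableOn ℂ (fun z => F z s) U)
    (hb : ∀ s, ∀ z ∈ U, ‖F z s‖ ≤ bound s) (hint : Integrable bound μ) :
    DifferentiableOn ℂ (fun z => ∫ s, F z s ∂μ) U := by
  intro z₀ hz₀
  obtain ⟨r, hr, hrU⟩ := Metric.isOpen_iff.1 hU z₀ hz₀
  have hsub : ∀ z ∈ Metric.ball z₀ (r / 2), Metric.closedBall z (r / 4) ⊆ U := by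
    intro z hz w hw
    apply hrU
    rw [Metric.mem_ball] at hz ⊢
    rw [Metric.mem_closedBall] at hw
    have := dist_triangle w z z₀
    linarith
  have hUz : ∀ z ∈ Metric.ball z₀ (r / 2), z ∈ U := fun z hz =>
    hsub z hz (Metric.mem_closedBall_self (by positivity))
  have hderiv : ∀ s, ∀ z ∈ U, HasDerivAt (fun w => F w s) (deriv (fun w => F w s) z) z :=
    fun s z hz => ((hdiff s).differentiableAt (hU.mem_nhds hz)).hasDerivAt
  -- A sequence of difference quotients, needed only to see that the derivative at `z₀` is
  -- measurable in the parameter.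
  have hseq : Tendsto (fun n : ℕ => z₀ + ((r / 4 / (n + 1) : ℝ) : ℂ)) atTop (𝓝[≠] z₀) := by
    refine tendsto_nhdsWithin_iff.2 ⟨?_, Eventually.of_forall fun n => ?_⟩
    · have h1 : Tendsto (fun n : ℕ => r / 4 / ((n : ℝ) + 1)) atTop (𝓝 0) :=
        tendsto_const_nhds.div_atTop
          (tendsto_atTop_add_const_right _ _ tendsto_natCast_atTop_atTop)
      have h2 := (Complex.continuous_ofReal.tendsto 0).comp h1
      simpa using h2.const_add z₀
    · have : (0 : ℝ) < r / 4 / (n + 1) := by positivity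
      simp only [Set.mem_compl_iff, Set.mem_singleton_iff, add_eq_left]
      exact_mod_cast this.ne'
  have hseqU : ∀ n : ℕ, z₀ + ((r / 4 / (n + 1) : ℝ) : ℂ) ∈ U := by
    intro n
    refine hsub z₀ (Metric.mem_ball_self (by positivity)) ?_
    have h0 : (0 : ℝ) ≤ r / 4 / (n + 1) := by positivity
    rw [Metric.mem_closedBall, dist_eq_norm, add_sub_cancel_left, Complex.norm_real,
      Real.norm_of_nonneg h0]
    exact div_le_self (by positivity) (by linarith [n.cast_nonneg (α := ℝ)])
  have hmeas' : AEStronglyMeasurable (fun s => deriv (fun w => F w s) z₀) μ := by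
    refine aestronglyMeasurable_of_tendsto_ae atTop
      (f := fun (n : ℕ) s => slope (fun w => F w s) z₀ (z₀ + ((r / 4 / (n + 1) : ℝ) : ℂ)))
      (fun n => ?_) (Eventually.of_forall fun s => ?_)
    · simp only [slope_def_field]
      exact ((hmeas _ (hseqU n)).sub (hmeas _ hz₀)).mul_const _
    · exact ((hasDerivAt_iff_tendsto_slope.1 (hderiv s z₀ hz₀)).comp hseq)
  have key := hasDerivAt_integral_of_dominated_loc_of_deriv_le (μ := μ) (𝕜 := ℂ)
    (F := F) (x₀ := z₀) (s := Metric.ball z₀ (r / 2)) (bound := fun s => bound s / (r / 4))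
    (F' := fun z s => deriv (fun w => F w s) z)
    (Metric.ball_mem_nhds _ (by positivity))
    (Filter.mem_of_superset (hU.mem_nhds hz₀) hmeas)
    (hint.mono' (hmeas _ hz₀) (Eventually.of_forall fun s => hb s _ hz₀)) hmeas'
    (Eventually.of_forall fun s z hz => ?_) (hint.div_const _)
    (Eventually.of_forall fun s z hz => hderiv s z (hUz z hz))
  · exact key.2.differentiableAt.differentiableWithinAt
  -- Cauchy's estimate on circles of radius `r / 4` dominates the derivative.
  · refine Complex.norm_deriv_le_of_forall_mem_sphere_norm_le (by positivity) ?_ fun w hw =>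
      hb s w (hsub z hz (Metric.sphere_subset_closedBall hw))
    refine DifferentiableOn.diffContOnCl ?_
    rw [closure_ball _ (by positivity)]
    exact (hdiff s).mono (hsub z hz)

/-- A Cauchy integral over a part of the curve is holomorphic away from this part. -/
lemma differentiableOn_cauchy {γ : ℝ → ℂ} (hγ : Continuous γ) {g : ℝ → ℂ} {s : Set ℝ}
    (hs : MeasurableSet s) (hg : IntegrableOn g s) {U : Set ℂ}
    (hd : ∀ z ∈ U, ∃ δ > 0, ∀ w ∈ Metric.ball z δ, ∀ t ∈ s, δ ≤ ‖γ t - w‖) :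
    DifferentiableOn ℂ (fun z => ∫ t in s, (γ t - z)⁻¹ * g t) U := by
  intro z₀ hz₀
  obtain ⟨δ, hδ, h⟩ := hd z₀ hz₀
  -- Extending by zero makes holomorphy and the bound hold for every parameter, not only for those
  -- in `s`.
  let F : ℂ → ℝ → ℂ := fun z => s.indicator fun t => (γ t - z)⁻¹ * g t
  have hF : (fun z => ∫ t in s, (γ t - z)⁻¹ * g t) = fun z => ∫ t, F z t := by
    funext z
    rw [integral_indicator hs]
  rw [hF]
  have key : DifferentiableOn ℂ (fun z => ∫ t, F z t) (Metric.ball z₀ δ) := by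
    refine differentiableOn_integral_of_dominated Metric.isOpen_ball
      (bound := s.indicator fun t => δ⁻¹ * ‖g t‖) (fun z hz => ?_) (fun t => ?_) (fun t z hz => ?_)
      ((integrable_indicator_iff hs).2 (hg.norm.const_mul _))
    · refine (aestronglyMeasurable_indicator_iff hs).2 ?_
      exact ((hγ.measurable.sub_const z).inv.aestronglyMeasurable).mul hg.aestronglyMeasurable
    · by_cases ht : t ∈ s
      · simp only [F, Set.indicator_of_mem ht]
        refine DifferentiableOn.mul_const (DifferentiableOn.inv (by fun_prop) fun z hz h0 => ?_) _
        have := h z hz t ht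
        rw [h0, norm_zero] at this
        linarith
      · simp only [F, Set.indicator_of_notMem ht]
        exact differentiableOn_const _
    · by_cases ht : t ∈ s
      · simp only [F, Set.indicator_of_mem ht, norm_mul, norm_inv]
        gcongr
        exact h z hz t ht
      · simp [F, Set.indicator_of_notMem ht]
  exact ((key z₀ (Metric.mem_ball_self hδ)).differentiableAt
    (Metric.ball_mem_nhds z₀ hδ)).differentiableWithinAt

/-- The integral of a difference quotient of an entire function is entire. -/
lemma differentiable_integral_dslope {γ : ℝ → ℂ} (hγ : Continuous γ) {g : ℝ → ℂ}
    (hg : Continuous g) {Φ : ℂ → ℂ} (hΦ : Differentiable ℂ Φ) (a b : ℝ) :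
    Differentiable ℂ fun z => ∫ t in Set.Icc a b, dslope Φ z (γ t) * g t := by
  -- Symmetry moves the variable `z` out of the base point, where holomorphy of `dslope` is known.
  have hsymm : ∀ z w, dslope Φ z w = dslope Φ w z := by
    intro z w
    rcases eq_or_ne z w with rfl | h
    · rfl
    · rw [dslope_of_ne _ h, dslope_of_ne _ h.symm, slope_comm]
  have hdiff : ∀ w, Differentiable ℂ (dslope Φ w) := fun w => by
    rw [← differentiableOn_univ, Complex.differentiableOn_dslope univ_mem]
    exact hΦ.differentiableOn
  intro z₀
  obtain ⟨R, hR⟩ := (isCompact_Icc.image hγ : IsCompact (γ '' Set.Icc a b)).isBounded.subset_ball z₀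
  have hΦ' : Continuous (deriv Φ) := (hΦ.contDiff (n := 1)).continuous_deriv le_rfl
  obtain ⟨M, hM⟩ := (isCompact_closedBall z₀ (|R| + 1)).exists_bound_of_continuousOn
    hΦ'.continuousOn
  have hb : ∀ t ∈ Set.Icc a b, ∀ z ∈ Metric.ball z₀ 1, ‖dslope Φ z (γ t)‖ ≤ M := by
    intro t ht z hz
    have h1 : γ t ∈ Metric.closedBall z₀ (|R| + 1) :=
      Metric.ball_subset_closedBall (Metric.ball_subset_ball (by linarith [le_abs_self R])
        (hR ⟨t, ht, rfl⟩))
    have h2 : z ∈ Metric.closedBall z₀ (|R| + 1) :=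
      Metric.ball_subset_closedBall (Metric.ball_subset_ball (by linarith [abs_nonneg R]) hz)
    rcases eq_or_ne (γ t) z with h | h
    · rw [h, dslope_same]; exact hM _ h2
    · rw [dslope_of_ne _ h, slope_def_field, norm_div]
      refine div_le_of_le_mul₀ (norm_nonneg _) ((norm_nonneg _).trans (hM _ h2)) ?_
      exact (convex_closedBall z₀ (|R| + 1)).norm_image_sub_le_of_norm_deriv_le
        (fun x _ => hΦ x) hM h2 h1
  have key : DifferentiableOn ℂ (fun z => ∫ t in Set.Icc a b, (Set.Icc a b).indicator
      (fun t => dslope Φ z (γ t) * g t) t) (Metric.ball z₀ 1) := by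
    refine differentiableOn_integral_of_dominated Metric.isOpen_ball
      (bound := fun t => (Set.Icc a b).indicator (fun t => M * ‖g t‖) t)
      (fun z hz => ?_) (fun t => ?_) (fun t z hz => ?_) ?_
    · refine AEStronglyMeasurable.indicator ?_ measurableSet_Icc
      exact (((hdiff z).continuous.comp hγ).mul hg).aestronglyMeasurable
    · by_cases ht : t ∈ Set.Icc a b
      · simp only [Set.indicator_of_mem ht, hsymm _ (γ t)]
        exact ((hdiff (γ t)).mul_const _).differentiableOn
      · simp only [Set.indicator_of_notMem ht]
        exact differentiableOn_const _
    · by_cases ht : t ∈ Set.Icc a b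
      · simp only [Set.indicator_of_mem ht, norm_mul]
        gcongr
        exact hb t ht z hz
      · simp [Set.indicator_of_notMem ht]
    · refine Integrable.indicator ?_ measurableSet_Icc
      exact (continuous_const.mul hg.norm).continuousOn.integrableOn_Icc
  have hcongr : (fun z => ∫ t in Set.Icc a b, (Set.Icc a b).indicator
      (fun t => dslope Φ z (γ t) * g t) t) =
      fun z => ∫ t in Set.Icc a b, dslope Φ z (γ t) * g t := by
    funext z
    exact setIntegral_congr_fun measurableSet_Icc fun t ht => Set.indicator_of_mem ht _
  rw [hcongr] at key
  exact key.differentiableAt (Metric.ball_mem_nhds z₀ one_pos)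

end ConstantJump

namespace ConstantJump

/-! ### The two sides of the curve near one of its points -/

lemma log_sub_log_neg_of_im_pos {w : ℂ} (h : 0 < w.im) :
    Complex.log w - Complex.log (-w) = Real.pi * Complex.I := by
  rw [Complex.log, Complex.log, Complex.arg_neg_eq_arg_sub_pi_of_im_pos h, norm_neg]
  push_cast
  ring

lemma log_sub_log_neg_of_im_neg {w : ℂ} (h : w.im < 0) :
    Complex.log w - Complex.log (-w) = -(Real.pi * Complex.I) := by
  rw [Complex.log, Complex.log, Complex.arg_neg_eq_arg_add_pi_of_im_neg h, norm_neg]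
  push_cast
  ring

/-- The point with normal coordinates `p` with respect to the curve. -/
noncomputable def normalPoint (γ : ℝ → ℂ) (p : ℝ × ℝ) : ℂ :=
  γ p.1 + p.2 * (Complex.I * deriv γ p.1)

/-- A parameter interval around `t₀` on which the curve is close to its tangent. -/
lemma IsSmoothCurve.exists_almost_linear {γ : ℝ → ℂ} (hγ : IsSmoothCurve γ) (t₀ : ℝ) :
    ∃ η > 0, (∀ s ∈ Set.Icc (t₀ - η) (t₀ + η), ‖deriv γ s / deriv γ t₀ - 1‖ ≤ 1 / 4) ∧
      ∀ s ∈ Set.Icc (t₀ - η) (t₀ + η), ∀ p ∈ Set.Icc (t₀ - η) (t₀ + η),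
        ‖(γ s - γ p) / deriv γ t₀ - (s - p : ℝ)‖ ≤ 1 / 4 * |s - p| := by
  have hc := hγ.regular t₀
  have h1 : Tendsto (fun s => deriv γ s / deriv γ t₀) (𝓝 t₀) (𝓝 1) := by
    have := (hγ.continuous_deriv.tendsto t₀).div_const (deriv γ t₀)
    rwa [div_self hc] at this
  obtain ⟨ε, hε, h2⟩ := Metric.tendsto_nhds_nhds.1 h1 (1 / 4) (by norm_num)
  have h3 : ∀ s ∈ Set.Icc (t₀ - ε / 2) (t₀ + ε / 2), ‖deriv γ s / deriv γ t₀ - 1‖ ≤ 1 / 4 := by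
    intro s hs
    rw [← dist_eq_norm]
    refine (h2 ?_).le
    rw [Real.dist_eq, abs_lt]
    constructor <;> linarith [hs.1, hs.2]
  refine ⟨ε / 2, by positivity, h3, fun s hs p hp => ?_⟩
  have key := (convex_Icc (t₀ - ε / 2) (t₀ + ε / 2)).norm_image_sub_le_of_norm_hasDerivWithin_le
    (f := fun s : ℝ => γ s / deriv γ t₀ - (s : ℂ)) (f' := fun s => deriv γ s / deriv γ t₀ - 1)
    (fun x _ => (((hγ.hasDerivAt x).div_const _).sub
      (Complex.ofRealCLM.hasDerivAt)).hasDerivWithinAt) h3 hp hs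
  rw [Real.norm_eq_abs] at key
  refine le_trans (le_of_eq ?_) key
  congr 1
  push_cast
  ring

/-- The rest of the curve stays away from one of its points. -/
lemma IsSmoothCurve.exists_far {γ : ℝ → ℂ} (hγ : IsSmoothCurve γ) {t₀ η : ℝ} (hη : 0 < η) :
    ∃ ρ > 0, ∀ t ∉ Set.Icc (t₀ - η) (t₀ + η), 2 * ρ ≤ ‖γ t - γ t₀‖ := by
  have hcl : IsClosed (γ '' (Set.Ioo (t₀ - η) (t₀ + η))ᶜ) :=
    (isProperMap_iff_tendsto_cocompact.2 ⟨hγ.smooth.continuous, hγ.proper⟩).isClosedMap _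
      isOpen_Ioo.isClosed_compl
  have hn : γ t₀ ∈ (γ '' (Set.Ioo (t₀ - η) (t₀ + η))ᶜ)ᶜ := by
    rintro ⟨s, hs, h⟩
    rw [hγ.injective h] at hs
    exact hs ⟨by linarith, by linarith⟩
  obtain ⟨ε, hε, h⟩ := Metric.isOpen_iff.1 hcl.isOpen_compl _ hn
  refine ⟨ε / 2, by positivity, fun t ht => ?_⟩
  by_contra! hlt
  refine h (a := γ t) (by rw [Metric.mem_ball, dist_eq_norm]; linarith) ⟨t, fun h' => ht ?_, rfl⟩
  exact Set.Ioo_subset_Icc_self h'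

/-- Membership of `I u` in the slit plane. -/
lemma I_mul_mem_slitPlane {u : ℂ} (h : u.re = 0 → u.im < 0) :
    Complex.I * u ∈ Complex.slitPlane := by
  rw [Complex.mem_slitPlane_iff]
  by_cases hu : u.re = 0
  · left; simpa using h hu
  · right; simpa using hu

lemma re_im_of_I_mul_notMem {u : ℂ} (h : Complex.I * u ∉ Complex.slitPlane) :
    u.re = 0 ∧ 0 ≤ u.im := by
  rw [Complex.mem_slitPlane_iff] at h
  push Not at h
  simpa using h.symm

/-- The curve near `t₀` separates a disc around `γ t₀` into two sides, and Cauchy integrals of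
entire functions over the curve extend holomorphically across the curve from each side. -/
theorem IsSmoothCurve.exists_sides {γ : ℝ → ℂ} (hγ : IsSmoothCurve γ) (t₀ : ℝ) :
    ∃ ρ > 0, ∃ Up Um : Set ℂ, IsOpen Up ∧ IsOpen Um ∧
      (∀ z ∈ Metric.ball (γ t₀) ρ, z ∉ Set.range γ ↔ z ∈ Up ∨ z ∈ Um) ∧
      (∀ᶠ p in 𝓝 t₀ ×ˢ 𝓝[>] 0, normalPoint γ p ∈ Up) ∧
      (∀ᶠ p in 𝓝 t₀ ×ˢ 𝓝[<] 0, normalPoint γ p ∈ Um) ∧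
      ∀ Φ : ℂ → ℂ, Differentiable ℂ Φ → Integrable (fun t => Φ (γ t) * deriv γ t) →
        ∃ qp qm : ℂ → ℂ, DifferentiableOn ℂ qp (Metric.ball (γ t₀) ρ) ∧
          DifferentiableOn ℂ qm (Metric.ball (γ t₀) ρ) ∧
          (∀ z ∈ Metric.ball (γ t₀) ρ, qp z - qm z = 2 * Real.pi * Complex.I * Φ z) ∧
          (∀ z ∈ Metric.ball (γ t₀) ρ, z ∈ Up →
            ∫ t, (γ t - z)⁻¹ * (Φ (γ t) * deriv γ t) = qp z) ∧
          (∀ z ∈ Metric.ball (γ t₀) ρ, z ∈ Um →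
            ∫ t, (γ t - z)⁻¹ * (Φ (γ t) * deriv γ t) = qm z) := by
  obtain ⟨η, hη, hder, hlin⟩ := hγ.exists_almost_linear t₀
  set c := deriv γ t₀ with hcdef
  have hc : c ≠ 0 := hγ.regular t₀
  set J := Set.Icc (t₀ - η) (t₀ + η) with hJ
  have ht₀ : t₀ ∈ J := ⟨by linarith, by linarith⟩
  have hbJ : t₀ + η ∈ J := ⟨by linarith, le_rfl⟩
  have haJ : t₀ - η ∈ J := ⟨le_rfl, by linarith⟩
  obtain ⟨ρ₁, hρ₁, hfar⟩ := hγ.exists_far hη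
  -- The first bound keeps the rest of the curve off the disc. The second keeps the end points of
  -- the arc strictly to the right and left of `z` in the coordinate `u`, so the logarithms there
  -- are holomorphic on the whole disc.
  set ρ := min ρ₁ (‖c‖ * η / 4) with hρdef
  have hρ : 0 < ρ := lt_min hρ₁ (by positivity)
  let u : ℝ → ℂ → ℂ := fun s z => (γ s - z) / c
  -- In the coordinate `u` the tangent at `t₀` is the real axis. `Up` requires the arc to miss the
  -- upward vertical ray from `z`, and `Um` the downward one; these are exactly the conditions for
  -- the principal logarithm of `I * u`, respectively `-(I * u)`, to be continuous along the arc.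
  let Up : Set ℂ := {z | ∀ s ∈ J, Complex.I * u s z ∈ Complex.slitPlane}
  let Um : Set ℂ := {z | ∀ s ∈ J, -(Complex.I * u s z) ∈ Complex.slitPlane}
  -- Otherwise the arc meets both rays, at two points with the same real part of `u`. Almost
  -- linearity forces the two parameters to agree, and then `z` lies on the curve.
  have hcover : ∀ z, z ∉ Set.range γ → z ∈ Up ∨ z ∈ Um := by
    intro z hz
    by_contra! hno
    obtain ⟨h1, h2⟩ := hno
    simp only [Up, Um, Set.mem_ofPred_eq, not_forall] at h1 h2
    obtain ⟨s, hs, h1⟩ := h1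
    obtain ⟨s', hs', h2⟩ := h2
    rw [← mul_neg] at h2
    have e1 := re_im_of_I_mul_notMem h1
    have e2 := re_im_of_I_mul_notMem h2
    have h3 := (Complex.abs_re_le_norm _).trans (hlin s hs s' hs')
    have h4 : (γ s - γ s') / c = u s z - u s' z := by simp only [u]; ring
    rw [Complex.neg_re, neg_eq_zero] at e2
    rw [h4, Complex.sub_re, Complex.sub_re, e1.1, e2.1, Complex.ofReal_re, sub_zero, zero_sub,
      abs_neg] at h3
    have h5 : s = s' := by
      have : |s - s'| ≤ 0 := by linarith [abs_nonneg (s - s')]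
      exact sub_eq_zero.1 (abs_nonpos_iff.1 this)
    subst h5
    have h6 : u s z = 0 := Complex.ext e1.1 (by
      have := e2.2
      rw [Complex.neg_im] at this
      simp only [Complex.zero_im]
      linarith [e1.2])
    refine hz ⟨s, ?_⟩
    simpa [u, hc, sub_eq_zero] using h6
  have hfar' : ∀ z ∈ Metric.ball (γ t₀) ρ, ∀ t ∉ J, ρ ≤ ‖γ t - z‖ := by
    intro z hz t ht
    have h1 := hfar t ht
    rw [Metric.mem_ball, dist_eq_norm] at hz
    have h2 : ‖γ t - γ t₀‖ ≤ ‖γ t - z‖ + ‖z - γ t₀‖ := by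
      simpa using norm_add_le (γ t - z) (z - γ t₀)
    have h3 : ρ ≤ ρ₁ := min_le_left _ _
    linarith
  have hside : ∀ z ∈ Metric.ball (γ t₀) ρ, z ∈ Up ∨ z ∈ Um → z ∉ Set.range γ := by
    rintro z hz h ⟨t, rfl⟩
    by_cases ht : t ∈ J
    · rcases h with h | h
      · exact Complex.slitPlane_ne_zero (h t ht) (by simp [u])
      · exact Complex.slitPlane_ne_zero (h t ht) (by simp [u])
    · have := hfar' _ hz t ht
      rw [sub_self, norm_zero] at this
      linarith
  -- geometry of normal points
  have hnormal : ∀ s ∈ J, ∀ p ∈ J, ∀ y : ℝ, (u s (normalPoint γ (p, y))).re = 0 →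
      (0 < y → (u s (normalPoint γ (p, y))).im < 0) ∧
      (y < 0 → 0 < (u s (normalPoint γ (p, y))).im) := by
    intro s hs p hp y hre
    set e₁ := (γ s - γ p) / c - (s - p : ℝ) with he₁
    set e₂ := deriv γ p / c - 1 with he₂
    have hu : u s (normalPoint γ (p, y)) =
        (s - p : ℝ) + e₁ - y * (Complex.I * (1 + e₂)) := by
      simp only [u, normalPoint, he₁, he₂]
      ring
    have b₁ := hlin s hs p hp
    have b₂ := hder p hp
    rw [← he₁] at b₁
    rw [← he₂] at b₂
    have r1 := abs_le.1 ((Complex.abs_re_le_norm _).trans b₁)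
    have r2 := abs_le.1 ((Complex.abs_im_le_norm _).trans b₁)
    have r3 := abs_le.1 ((Complex.abs_re_le_norm _).trans b₂)
    have r4 := abs_le.1 ((Complex.abs_im_le_norm _).trans b₂)
    rw [hu] at hre ⊢
    simp only [Complex.sub_re, Complex.add_re, Complex.ofReal_re, Complex.mul_re, Complex.I_re,
      Complex.I_im, Complex.one_re, Complex.one_im, Complex.ofReal_im, Complex.add_im,
      Complex.mul_im, Complex.sub_im, zero_mul, one_mul, zero_add, zero_sub, sub_zero,
      add_zero] at hre ⊢
    -- Hence `|s - p| ≤ |y| / 3`, and the error terms in the imaginary part cannot outweigh the main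
    -- term `-y`.
    have hsp : |s - p| ≤ 1 / 4 * |s - p| + |y| * (1 / 4) := by
      have h1 : s - p = -e₁.re - y * e₂.im := by linarith
      calc |s - p| = |-e₁.re - y * e₂.im| := by rw [← h1]
        _ ≤ |-e₁.re| + |y * e₂.im| := abs_sub _ _
        _ ≤ _ := by
          rw [abs_neg, abs_mul]
          exact add_le_add (abs_le.2 r1) (mul_le_mul_of_nonneg_left (abs_le.2 r4) (abs_nonneg _))
    constructor
    · intro hy
      rw [abs_of_pos hy] at hsp
      nlinarith [r2.2, r3.1]
    · intro hy
      rw [abs_of_neg hy] at hsp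
      nlinarith [r2.1, r3.1]
  have hJnhds : ∀ᶠ p in 𝓝 t₀, p ∈ J := Icc_mem_nhds (by linarith) (by linarith)
  -- the logarithms at the end points
  have hend : ∀ z ∈ Metric.ball (γ t₀) ρ, 0 < (u (t₀ + η) z).re ∧ (u (t₀ - η) z).re < 0 := by
    intro z hz
    have h1 : ‖(z - γ t₀) / c‖ < η / 4 := by
      rw [Metric.mem_ball, dist_eq_norm] at hz
      rw [norm_div, div_lt_iff₀ (norm_pos_iff.2 hc)]
      calc _ < _ := hz
        _ ≤ _ := min_le_right _ _
        _ = _ := by ring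
    have h2 := abs_lt.1 ((Complex.abs_re_le_norm _).trans_lt h1)
    have key : ∀ s, u s z = (γ s - γ t₀) / c - (z - γ t₀) / c := fun s => by simp only [u]; ring
    have h3 := abs_le.1 ((Complex.abs_re_le_norm _).trans (hlin _ hbJ _ ht₀))
    have h4 := abs_le.1 ((Complex.abs_re_le_norm _).trans (hlin _ haJ _ ht₀))
    rw [Complex.sub_re, Complex.ofReal_re] at h3 h4
    rw [show t₀ + η - t₀ = η by ring, abs_of_pos hη] at h3
    rw [show t₀ - η - t₀ = -η by ring, abs_neg, abs_of_pos hη] at h4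
    rw [key, key, Complex.sub_re, Complex.sub_re]
    constructor <;> linarith
  let lp : ℂ → ℂ := fun z =>
    Complex.log (Complex.I * u (t₀ + η) z) - Complex.log (Complex.I * u (t₀ - η) z)
  let lm : ℂ → ℂ := fun z =>
    Complex.log (-(Complex.I * u (t₀ + η) z)) - Complex.log (-(Complex.I * u (t₀ - η) z))
  have hudiff : ∀ s, Differentiable ℂ (u s) := fun s => by
    simp only [u]; fun_prop
  have hlp : DifferentiableOn ℂ lp (Metric.ball (γ t₀) ρ) := by
    intro z hz
    refine (DifferentiableAt.sub (((hudiff _ z).const_mul _).clog ?_)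
      (((hudiff _ z).const_mul _).clog ?_)).differentiableWithinAt
    · exact Or.inr (by simpa using (hend z hz).1.ne')
    · exact Or.inr (by simpa using (hend z hz).2.ne)
  have hlm : DifferentiableOn ℂ lm (Metric.ball (γ t₀) ρ) := by
    intro z hz
    refine (DifferentiableAt.sub (((hudiff _ z).const_mul _).neg.clog ?_)
      (((hudiff _ z).const_mul _).neg.clog ?_)).differentiableWithinAt
    · exact Or.inr (by simpa using (hend z hz).1.ne')
    · exact Or.inr (by simpa using (hend z hz).2.ne)
  -- The right end point contributes `πi` and the left one `-πi`, which is subtracted.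
  have hjump : ∀ z ∈ Metric.ball (γ t₀) ρ, lp z - lm z = 2 * Real.pi * Complex.I := by
    intro z hz
    have h1 := log_sub_log_neg_of_im_pos (w := Complex.I * u (t₀ + η) z)
      (by simpa using (hend z hz).1)
    have h2 := log_sub_log_neg_of_im_neg (w := Complex.I * u (t₀ - η) z)
      (by simpa using (hend z hz).2)
    simp only [lp, lm]
    linear_combination h1 - h2
  have hne : ∀ z ∈ Metric.ball (γ t₀) ρ, z ∉ Set.range γ → ∀ t, γ t - z ≠ 0 :=
    fun z _ hz t h => hz ⟨t, sub_eq_zero.1 h⟩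
  have hcont_int : ∀ z ∉ Set.range γ, Continuous fun t => (γ t - z)⁻¹ * deriv γ t := fun z hz =>
    (continuous_inv_sub hγ.smooth.continuous hz).mul hγ.continuous_deriv
  have hud : ∀ z t, HasDerivAt (fun s => u s z) (deriv γ t / c) t := fun z t =>
    ((hγ.hasDerivAt t).sub_const z).div_const c
  have hIp : ∀ z ∈ Metric.ball (γ t₀) ρ, z ∈ Up →
      ∫ t in J, (γ t - z)⁻¹ * deriv γ t = lp z := by
    intro z hz hzU
    have hzr := hside z hz (Or.inl hzU)
    rw [hJ, integral_Icc_eq_integral_Ioc,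
      ← intervalIntegral.integral_of_le (by linarith : t₀ - η ≤ t₀ + η)]
    refine intervalIntegral.integral_eq_sub_of_hasDerivAt
      (f := fun s => Complex.log (Complex.I * u s z)) (fun t ht => ?_)
      (hcont_int z hzr).continuousOn.intervalIntegrable
    rw [Set.uIcc_of_le (by linarith)] at ht
    have h0 := hne z hz hzr t
    have h1 : (γ t - z)⁻¹ * deriv γ t = Complex.I * (deriv γ t / c) / (Complex.I * u t z) := by
      simp only [u]
      field_simp
    rw [h1]
    exact ((hud z t).const_mul Complex.I).clog_real (hzU t ht)
  have hIm : ∀ z ∈ Metric.ball (γ t₀) ρ, z ∈ Um →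
      ∫ t in J, (γ t - z)⁻¹ * deriv γ t = lm z := by
    intro z hz hzU
    have hzr := hside z hz (Or.inr hzU)
    rw [hJ, integral_Icc_eq_integral_Ioc,
      ← intervalIntegral.integral_of_le (by linarith : t₀ - η ≤ t₀ + η)]
    refine intervalIntegral.integral_eq_sub_of_hasDerivAt
      (f := fun s => Complex.log (-(Complex.I * u s z))) (fun t ht => ?_)
      (hcont_int z hzr).continuousOn.intervalIntegrable
    rw [Set.uIcc_of_le (by linarith)] at ht
    have h0 := hne z hz hzr t
    have h1 : (γ t - z)⁻¹ * deriv γ t =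
        -(Complex.I * (deriv γ t / c)) / (-(Complex.I * u t z)) := by
      simp only [u]
      field_simp
    rw [h1]
    exact ((hud z t).const_mul Complex.I).neg.clog_real (hzU t ht)
  have hucont : Continuous fun x : ℂ × ℝ => Complex.I * u x.2 x.1 := by
    have := hγ.smooth.continuous
    simp only [u]
    fun_prop
  have hopen : ∀ f : ℂ × ℝ → ℂ, Continuous f →
      IsOpen {z | ∀ s ∈ J, f (z, s) ∈ Complex.slitPlane} := fun f hf =>
    isOpen_iff_mem_nhds.2 fun z hz => isCompact_Icc.eventually_forall_of_forall_eventually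
      (P := fun z s => f (z, s) ∈ Complex.slitPlane) fun s hs =>
        hf.continuousAt.eventually (Complex.isOpen_slitPlane.mem_nhds (hz s hs))
  refine ⟨ρ, hρ, Up, Um, hopen _ hucont, hopen _ hucont.neg, fun z hz => ⟨hcover z, hside z hz⟩, ?_, ?_, fun Φ hΦ hint => ?_⟩
  · filter_upwards [prod_mem_prod hJnhds self_mem_nhdsWithin] with p hp s hs
    exact I_mul_mem_slitPlane fun h => (hnormal s hs p.1 hp.1 p.2 h).1 hp.2
  · filter_upwards [prod_mem_prod hJnhds self_mem_nhdsWithin] with p hp s hs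
    rw [← mul_neg]
    refine I_mul_mem_slitPlane fun h => ?_
    rw [Complex.neg_re, neg_eq_zero] at h
    have := (hnormal s hs p.1 hp.1 p.2 h).2 hp.2
    rw [Complex.neg_im]
    linarith
  let far : ℂ → ℂ := fun z => ∫ t in Jᶜ, (γ t - z)⁻¹ * (Φ (γ t) * deriv γ t)
  let reg : ℂ → ℂ := fun z => ∫ t in J, dslope Φ z (γ t) * deriv γ t
  have hfard : DifferentiableOn ℂ far (Metric.ball (γ t₀) ρ) := by
    refine differentiableOn_cauchy hγ.smooth.continuous measurableSet_Icc.compl hint.integrableOn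
      fun z hz => ?_
    obtain ⟨δ, hδ, hsub⟩ := Metric.isOpen_iff.1 Metric.isOpen_ball z hz
    refine ⟨min δ ρ, lt_min hδ hρ, fun w hw t ht => (min_le_right _ _).trans ?_⟩
    exact hfar' w (hsub (Metric.ball_subset_ball (min_le_left _ _) hw)) t ht
  have hregd : Differentiable ℂ reg :=
    differentiable_integral_dslope hγ.smooth.continuous hγ.continuous_deriv hΦ _ _
  -- On the arc the density is `Φ z + (γ t - z) * dslope Φ z (γ t)`. The second term cancels the
  -- kernel, so only the logarithmic integral distinguishes the two sides.
  have hsplit : ∀ z ∈ Metric.ball (γ t₀) ρ, z ∉ Set.range γ →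
      ∫ t, (γ t - z)⁻¹ * (Φ (γ t) * deriv γ t) =
        far z + reg z + Φ z * ∫ t in J, (γ t - z)⁻¹ * deriv γ t := by
    intro z hz hzr
    rw [← integral_add_compl measurableSet_Icc (hγ.integrable_div hint hzr), add_comm, add_assoc]
    congr 1
    have hreg : ∀ t, dslope Φ z (γ t) * deriv γ t =
        (γ t - z)⁻¹ * (Φ (γ t) * deriv γ t) - Φ z * ((γ t - z)⁻¹ * deriv γ t) := by
      intro t
      have h0 := hne z hz hzr t
      rw [dslope_of_ne _ (sub_ne_zero.1 h0), slope_def_field]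
      field_simp
    simp only [reg, hreg]
    rw [integral_sub, integral_const_mul]
    · ring
    · exact (hγ.integrable_div hint hzr).integrableOn
    · exact ((hcont_int z hzr).const_mul _).continuousOn.integrableOn_Icc
  refine ⟨fun z => far z + reg z + Φ z * lp z, fun z => far z + reg z + Φ z * lm z,
    (hfard.add hregd.differentiableOn).add (hΦ.differentiableOn.mul hlp),
    (hfard.add hregd.differentiableOn).add (hΦ.differentiableOn.mul hlm),
    fun z hz => ?_, fun z hz hzU => ?_, fun z hz hzU => ?_⟩
  · linear_combination Φ z * hjump z hz
  · rw [hsplit z hz (hside z hz (Or.inl hzU)), hIp z hz hzU]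
  · rw [hsplit z hz (hside z hz (Or.inr hzU)), hIm z hz hzU]

lemma IsSmoothCurve.continuous_normalPoint {γ : ℝ → ℂ} (hγ : IsSmoothCurve γ) :
    Continuous (normalPoint γ) := by
  have h1 := hγ.smooth.continuous
  have h2 := hγ.continuous_deriv
  unfold normalPoint
  fun_prop

lemma IsSmoothCurve.tendsto_normalPoint {γ : ℝ → ℂ} (hγ : IsSmoothCurve γ) (t₀ : ℝ) (s : Set ℝ) :
    Tendsto (normalPoint γ) (𝓝 t₀ ×ˢ 𝓝[s] 0) (𝓝 (γ t₀)) := by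
  have h := hγ.continuous_normalPoint.tendsto (t₀, 0)
  rw [nhds_prod_eq] at h
  simpa [normalPoint] using h.mono_left (Filter.prod_mono le_rfl nhdsWithin_le_nhds)

/-- The complement of the curve is dense. -/
lemma IsSmoothCurve.dense_compl {γ : ℝ → ℂ} (hγ : IsSmoothCurve γ) : Dense (Set.range γ)ᶜ := by
  intro z
  by_cases hz : z ∈ Set.range γ
  · obtain ⟨t, rfl⟩ := hz
    obtain ⟨ρ, hρ, Up, Um, -, -, h1, h2, -, -⟩ := hγ.exists_sides t
    have hlim := hγ.tendsto_normalPoint t (Set.Ioi 0)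
    refine mem_closure_of_tendsto hlim ?_
    filter_upwards [h2, hlim (Metric.ball_mem_nhds _ hρ)] with p hp hpb
    exact (h1 _ hpb).2 (Or.inl hp)
  · exact subset_closure hz

end ConstantJump

namespace ConstantJump

/-! ### The winding of a simple arc in a disc -/

/-- A continuous nowhere vanishing function on a square has a continuous logarithm. -/
lemma exists_continuous_log {G : ℝ × ℝ → ℂ} (hG : Continuous G) (h0 : ∀ x, G x ≠ 0) :
    ∃ L : ℝ × ℝ → ℂ, Continuous L ∧ ∀ x, Complex.exp (L x) = G x := by
  obtain ⟨F, ⟨-, hF⟩, -⟩ := Complex.isCoveringMapOn_exp.existsUnique_continuousMap_lifts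
    (⟨G, hG⟩ : C(ℝ × ℝ, ℂ)) (a₀ := (0, 0)) (e₀ := Complex.log (G (0, 0)))
    (Complex.exp_log (h0 _)) fun a => h0 a
  exact ⟨F, F.continuous, fun x => congrFun hF x⟩

/-- The fibre of `exp` over `1` is discrete, so a continuous path in it is constant. -/
lemma eq_of_exp_eq_one {f : ℝ → ℂ} {a b : ℝ} (hab : a ≤ b) (hf : ContinuousOn f (Set.Icc a b))
    (h : ∀ t ∈ Set.Icc a b, Complex.exp (f t) = 1) : f a = f b := by
  have : DiscreteTopology (Complex.exp ⁻¹' {(1 : ℂ)}) :=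
    (Complex.isCoveringMapOn_exp 1 (by simp)).1
  exact isPreconnected_Icc.constant_of_mapsTo (T := Complex.exp ⁻¹' {(1 : ℂ)}) ⟨this⟩ hf
    (fun t ht => h t ht) (Set.left_mem_Icc.2 hab) (Set.right_mem_Icc.2 hab)

/-- The variation of a logarithm along a path in a slit plane. -/
lemma log_sub_log_eq {f : ℝ → ℂ} {a b : ℝ} (hab : a ≤ b) (hf : ContinuousOn f (Set.Icc a b))
    {c : ℂ} (hc : c ≠ 0) (h : ∀ t ∈ Set.Icc a b, c * Complex.exp (f t) ∈ Complex.slitPlane) :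
    f b - f a = Complex.log (c * Complex.exp (f b)) - Complex.log (c * Complex.exp (f a)) := by
  have key := eq_of_exp_eq_one (f := fun t =>
      f t - Complex.log (c * Complex.exp (f t)) + Complex.log c) hab
    (by
      refine (hf.sub (ContinuousOn.clog ?_ h)).add continuousOn_const
      exact continuousOn_const.mul (Complex.continuous_exp.comp_continuousOn hf))
    (fun t _ => by
      rw [Complex.exp_add, Complex.exp_sub, Complex.exp_log hc,
        Complex.exp_log (mul_ne_zero hc (Complex.exp_ne_zero _))]
      field_simp)
  linear_combination -key

lemma log_im_of_pos {y : ℝ} (hy : 0 < y) : (Complex.log (y * Complex.I)).im = Real.pi / 2 := by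
  rw [Complex.log_im, Complex.arg_real_mul _ hy, Complex.arg_I]

lemma log_im_of_neg {y : ℝ} (hy : y < 0) : (Complex.log (y * Complex.I)).im = -(Real.pi / 2) := by
  have : (y : ℂ) * Complex.I = (-y : ℝ) * (-Complex.I) := by push_cast; ring
  rw [this, Complex.log_im, Complex.arg_real_mul _ (neg_pos.2 hy), Complex.arg_neg_I]

/-- A path in the left half-plane with end points on the boundary which is disjoint from its
translate by `2πi` has end points at distance at most `2π`. -/
lemma im_sub_le_of_disjoint_translate {l : ℝ → ℂ} {a b : ℝ} (hab : a ≤ b)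
    (hl : ContinuousOn l (Set.Icc a b)) (hre : ∀ t ∈ Set.Icc a b, (l t).re ≤ 0)
    (ha : (l a).re = 0) (hb : (l b).re = 0)
    (hdisj : ∀ s ∈ Set.Icc a b, ∀ t ∈ Set.Icc a b, l s - l t ≠ 2 * Real.pi * Complex.I) :
    (l b - l a).im ≤ 2 * Real.pi := by
  by_contra! hΔ
  have haI : a ∈ Set.Icc a b := Set.left_mem_Icc.2 hab
  have hbI : b ∈ Set.Icc a b := Set.right_mem_Icc.2 hab
  let π' : ℝ → ℝ := fun s => Set.projIcc a b hab s
  have hπ : ∀ s, π' s ∈ Set.Icc a b := fun s => (Set.projIcc a b hab s).2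
  have hπ' : ∀ s ∈ Set.Icc a b, π' s = s := fun s hs => by
    simp only [π', Set.projIcc_of_mem hab hs]
  have hlπ : Continuous fun s => l (π' s) :=
    hl.comp_continuous (continuous_subtype_val.comp continuous_projIcc) hπ
  -- Disjointness from the translate says that `G` has no zero, so it has a continuous logarithm on
  -- the square. If the end points were too far apart, the argument of `G` would wind once around
  -- the boundary.
  let G : ℝ × ℝ → ℂ := fun x => l (π' x.1) - l (π' x.2) - 2 * Real.pi * Complex.I
  have hG : Continuous G :=
    ((hlπ.comp continuous_fst).sub (hlπ.comp continuous_snd)).sub continuous_const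
  have hG0 : ∀ x, G x ≠ 0 := fun x h => hdisj _ (hπ _) _ (hπ _) (sub_eq_zero.1 h)
  obtain ⟨L, hL, hexp⟩ := exists_continuous_log hG hG0
  have hGeq : ∀ s ∈ Set.Icc a b, ∀ t ∈ Set.Icc a b,
      G (s, t) = l s - l t - 2 * Real.pi * Complex.I := fun s hs t ht => by
    simp only [G, hπ' s hs, hπ' t ht]
  have hGre : ∀ s ∈ Set.Icc a b, ∀ t ∈ Set.Icc a b, (G (s, t)).re = (l s).re - (l t).re := by
    intro s hs t ht
    rw [hGeq s hs t ht]
    simp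
  have hslit : ∀ w : ℂ, w ≠ 0 → 0 ≤ w.re → w ∈ Complex.slitPlane := by
    intro w hw hre
    rw [Complex.mem_slitPlane_iff]
    by_contra! h
    exact hw (Complex.ext (by simpa using le_antisymm h.1 hre) h.2)
  set Δ := (l b - l a).im with hΔdef
  have hba : l b - l a = Δ * Complex.I := by
    apply Complex.ext <;> simp [ha, hb, hΔdef]
  have v1 : G (a, b) = ((-(Δ + 2 * Real.pi) : ℝ) : ℂ) * Complex.I := by
    rw [hGeq a haI b hbI]; push_cast; linear_combination -hba
  have v2 : G (a, a) = ((-(2 * Real.pi) : ℝ) : ℂ) * Complex.I := by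
    rw [hGeq a haI a haI]; push_cast; ring
  have v3 : G (b, b) = ((-(2 * Real.pi) : ℝ) : ℂ) * Complex.I := by
    rw [hGeq b hbI b hbI]; push_cast; ring
  have v4 : G (b, a) = ((Δ - 2 * Real.pi : ℝ) : ℂ) * Complex.I := by
    rw [hGeq b hbI a haI]; push_cast; linear_combination hba
  have hp := Real.pi_pos
  -- On each side of the square one coordinate is an end point, where the real part of `l` is zero;
  -- so the real part of `G` has a constant sign there and the change of argument is determined by
  -- the corners. Via `(a, b)` the argument does not change from `(a, a)` to `(b, b)`; via `(b, a)`,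
  -- where `G` lies on the positive imaginary axis if `Δ > 2π`, it changes by `-2π`.
  have e1 := congrArg Complex.im (log_sub_log_eq (f := fun t => L (a, t)) hab
    (hL.comp (by fun_prop)).continuousOn one_ne_zero fun t ht => by
      rw [one_mul, hexp]
      exact hslit _ (hG0 _) (by rw [hGre a haI t ht]; linarith [hre t ht]))
  have e2 := congrArg Complex.im (log_sub_log_eq (f := fun s => L (s, b)) hab
    (hL.comp (by fun_prop)).continuousOn (neg_ne_zero.2 one_ne_zero) fun s hs => by
      rw [hexp, neg_one_mul]
      exact hslit _ (neg_ne_zero.2 (hG0 _))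
        (by rw [Complex.neg_re, hGre s hs b hbI]; linarith [hre s hs]))
  have e3 := congrArg Complex.im (log_sub_log_eq (f := fun s => L (s, a)) hab
    (hL.comp (by fun_prop)).continuousOn (neg_ne_zero.2 one_ne_zero) fun s hs => by
      rw [hexp, neg_one_mul]
      exact hslit _ (neg_ne_zero.2 (hG0 _))
        (by rw [Complex.neg_re, hGre s hs a haI]; linarith [hre s hs]))
  have e4 := congrArg Complex.im (log_sub_log_eq (f := fun t => L (b, t)) hab
    (hL.comp (by fun_prop)).continuousOn one_ne_zero fun t ht => by
      rw [one_mul, hexp]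
      exact hslit _ (hG0 _) (by rw [hGre b hbI t ht]; linarith [hre t ht]))
  simp only [hexp, one_mul, neg_one_mul, Complex.sub_im, v1, v2, v3, v4, ← neg_mul,
    ← Complex.ofReal_neg] at e1 e2 e3 e4
  rw [log_im_of_neg (by linarith), log_im_of_neg (by linarith)] at e1
  rw [log_im_of_pos (by linarith), log_im_of_pos (by linarith)] at e2
  rw [log_im_of_neg (by linarith), log_im_of_pos (by linarith)] at e3
  rw [log_im_of_neg (by linarith), log_im_of_pos (by linarith)] at e4
  linarith

/-- The integral of `dw / (w - z)` over an arc of a simple curve inside the disc of radius `r`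
around `z`, with end points on the circle, is bounded by `2π`. -/
lemma IsSmoothCurve.norm_integral_arc_le {γ : ℝ → ℂ} (hγ : IsSmoothCurve γ) {z : ℂ} {r : ℝ}
    (hr : 0 < r) (hz : z ∉ Set.range γ) {a b : ℝ} (hab : a ≤ b) (ha : ‖γ a - z‖ = r)
    (hb : ‖γ b - z‖ = r) (hle : ∀ t ∈ Set.Icc a b, ‖γ t - z‖ ≤ r) :
    ‖∫ t in a..b, (γ t - z)⁻¹ * deriv γ t‖ ≤ 2 * Real.pi := by
  have hne : ∀ t, γ t - z ≠ 0 := fun t h => hz ⟨t, sub_eq_zero.1 h⟩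
  have hr' : (r : ℂ) ≠ 0 := by exact_mod_cast hr.ne'
  have hcont : Continuous fun t => (γ t - z)⁻¹ * deriv γ t :=
    (continuous_inv_sub hγ.smooth.continuous hz).mul hγ.continuous_deriv
  -- With this constant `l` is a logarithm of `(γ - z) / r` along the arc: the disc becomes the
  -- closed left half-plane and the circle its boundary.
  let w₀ := Complex.log ((γ a - z) / r)
  let l : ℝ → ℂ := fun t => (∫ s in a..t, (γ s - z)⁻¹ * deriv γ s) + w₀
  have hl : ∀ t, HasDerivAt l ((γ t - z)⁻¹ * deriv γ t) t := fun t =>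
    (hcont.integral_hasStrictDerivAt a t).hasDerivAt.add_const w₀
  have hexp : ∀ t, Complex.exp (l t) = (γ t - z) / r := by
    have hd : ∀ t, HasDerivAt (fun t => Complex.exp (-l t) * ((γ t - z) / r)) 0 t := by
      intro t
      have h1 := ((hl t).fun_neg.cexp).fun_mul (((hγ.hasDerivAt t).sub_const z).div_const (r : ℂ))
      convert! h1 using 1
      have := hne t
      field_simp
      ring
    intro t
    have hconst := is_const_of_deriv_eq_zero (fun t => (hd t).differentiableAt)
      (fun t => (hd t).deriv) t a
    have hla : l a = w₀ := by simp [l]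
    have h0 : (γ a - z) / r ≠ 0 := div_ne_zero (hne a) hr'
    rw [hla, Complex.exp_neg, Complex.exp_neg, Complex.exp_log h0, inv_mul_cancel₀ h0] at hconst
    have := Complex.exp_ne_zero (l t)
    rw [inv_mul_eq_one₀ this] at hconst
    exact hconst
  have hlre : ∀ t, Real.exp (l t).re = ‖γ t - z‖ / r := fun t => by
    rw [← Complex.norm_exp, hexp, norm_div, Complex.norm_real, Real.norm_of_nonneg hr.le]
  have hre : ∀ t ∈ Set.Icc a b, (l t).re ≤ 0 := fun t ht => by
    rw [← Real.exp_le_one_iff, hlre]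
    exact (div_le_one hr).2 (hle t ht)
  have hre0 : ∀ t, ‖γ t - z‖ = r → (l t).re = 0 := fun t ht => by
    rw [← Real.exp_eq_one_iff, hlre, ht, div_self hr.ne']
  have hlc : Continuous l := continuous_iff_continuousAt.2 fun t => (hl t).continuousAt
  -- A difference of `2πi` would give two equal points of the curve, contradicting injectivity.
  have hdisj : ∀ s t, l s - l t ≠ 2 * Real.pi * Complex.I := by
    intro s t h
    have h1 : Complex.exp (l s) = Complex.exp (l t) := by
      rw [← sub_add_cancel (l s) (l t), h, Complex.exp_add, Complex.exp_two_pi_mul_I, one_mul]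
    rw [hexp, hexp, div_left_inj' hr', sub_left_inj] at h1
    rw [hγ.injective h1, sub_self] at h
    exact Complex.two_pi_I_ne_zero h.symm
  have hup := im_sub_le_of_disjoint_translate hab hlc.continuousOn hre (hre0 a ha) (hre0 b hb)
    fun s _ t _ => hdisj s t
  have hrefl : ∀ t ∈ Set.Icc a b, a + b - t ∈ Set.Icc a b := fun t ht => by
    constructor <;> linarith [ht.1, ht.2]
  -- The arc run backwards gives the lower bound.
  have hlow := im_sub_le_of_disjoint_translate (l := fun t => l (a + b - t)) hab
    (hlc.comp (by fun_prop)).continuousOn (fun t ht => hre _ (hrefl t ht))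
    (by simpa using hre0 b hb) (by simpa using hre0 a ha) fun s _ t _ => hdisj _ _
  simp only [add_sub_cancel_left, add_sub_cancel_right] at hlow
  have hint : ∫ t in a..b, (γ t - z)⁻¹ * deriv γ t = l b - l a := by simp [l]
  have hpure : l b - l a = ((l b - l a).im : ℂ) * Complex.I := by
    apply Complex.ext <;> simp [hre0 a ha, hre0 b hb]
  rw [hint, hpure, norm_mul, Complex.norm_I, mul_one, Complex.norm_real, Real.norm_eq_abs, abs_le]
  refine ⟨?_, hup⟩
  rw [Complex.sub_im] at hlow ⊢
  linarith

end ConstantJump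

namespace ConstantJump

/-! ### Arcs of the curve inside a disc -/

lemma exists_first_hit {φ : ℝ → ℝ} (hφ : Continuous φ) {t r : ℝ} (ht : φ t < r)
    (hex : ∃ s ≥ t, r ≤ φ s) : ∃ b > t, φ b = r ∧ ∀ s ∈ Set.Ico t b, φ s < r := by
  let F := Set.Ici t ∩ {s | r ≤ φ s}
  have hF : IsClosed F := isClosed_Ici.inter (isClosed_le continuous_const hφ)
  have hne : F.Nonempty := hex.imp fun s hs => hs
  have hbdd : BddBelow F := ⟨t, fun s hs => hs.1⟩
  have hmem := hF.csInf_mem hne hbdd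
  have hlt : ∀ s ∈ Set.Ico t (sInf F), φ s < r := fun s hs => by
    by_contra! h
    exact absurd (csInf_le hbdd ⟨hs.1, h⟩) (not_le.2 hs.2)
  have htb : t < sInf F := lt_of_le_of_ne hmem.1 fun h => by
    have := hmem.2
    rw [Set.mem_ofPred_eq, ← h] at this
    linarith
  refine ⟨sInf F, htb, le_antisymm ?_ hmem.2, hlt⟩
  have : Set.Icc t (sInf F) ⊆ {s | φ s ≤ r} := by
    rw [← closure_Ico htb.ne]
    exact closure_minimal (fun s hs => (hlt s hs).le) (isClosed_le hφ continuous_const)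
  exact this ⟨htb.le, le_rfl⟩

variable {γ : ℝ → ℂ}

lemma IsSmoothCurve.tendsto_norm_sub (hγ : IsSmoothCurve γ) (z : ℂ) :
    Tendsto (fun t => ‖γ t - z‖) (cocompact ℝ) atTop := by
  have h1 : Tendsto (fun w : ℂ => ‖w - z‖) (cocompact ℂ) atTop := by
    refine tendsto_atTop_mono (f := fun w : ℂ => ‖w‖ + -‖z‖)
      (fun w => by linarith [norm_sub_norm_le w z]) ?_
    exact tendsto_atTop_add_const_right _ _ (tendsto_norm_cocompact_atTop (E := ℂ))
  exact h1.comp hγ.proper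

/-- The arc of the curve inside a disc that contains a given point. -/
lemma IsSmoothCurve.exists_arc (hγ : IsSmoothCurve γ) {z : ℂ} {r t : ℝ} (ht : ‖γ t - z‖ < r) :
    ∃ a b, t ∈ Set.Ioo a b ∧ ‖γ a - z‖ = r ∧ ‖γ b - z‖ = r ∧
      ∀ s ∈ Set.Ioo a b, ‖γ s - z‖ < r := by
  have hc : Continuous fun t => ‖γ t - z‖ := (hγ.smooth.continuous.sub continuous_const).norm
  have hev := (hγ.tendsto_norm_sub z).eventually_ge_atTop r
  rw [cocompact_eq_atBot_atTop, eventually_sup] at hev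
  obtain ⟨b, hb, hbr, hbi⟩ := exists_first_hit hc ht
    ((hev.2.and (eventually_ge_atTop t)).exists.imp fun s hs => ⟨hs.2, hs.1⟩)
  obtain ⟨a, ha, har, hai⟩ := exists_first_hit (φ := fun t => ‖γ (-t) - z‖) (t := -t)
    (hc.comp continuous_neg) (by simpa using ht)
    ((hev.1.and (eventually_le_atBot t)).exists.elim fun s hs =>
      ⟨-s, by linarith [hs.2], by simpa using hs.1⟩)
  refine ⟨-a, b, ⟨by linarith, hb⟩, har, hbr, fun s hs => ?_⟩
  rcases le_total t s with h | h
  · exact hbi s ⟨h, hs.2⟩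
  · simpa using hai (-s) ⟨by linarith, by linarith [hs.1]⟩

lemma IsSmoothCurve.norm_sub_le_arcLength (hγ : IsSmoothCurve γ) {a b : ℝ} (hab : a ≤ b) :
    ENNReal.ofReal ‖γ b - γ a‖ ≤ ∫⁻ t in Set.Ioo a b, ‖deriv γ t‖ₑ := by
  have h := intervalIntegral.integral_eq_sub_of_hasDerivAt (a := a) (b := b)
    (fun t _ => hγ.hasDerivAt t) (hγ.continuous_deriv.intervalIntegrable _ _)
  rw [intervalIntegral.integral_of_le hab, integral_Ioc_eq_integral_Ioo] at h
  rw [← h, ofReal_norm]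
  exact enorm_integral_le_lintegral_enorm _

/-- For a Carleson curve the integral of `dw / (w - z)` over a suitable part of the curve near `z`
is bounded independently of `z`. -/
lemma IsSmoothCurve.exists_near_part (hγ : IsSmoothCurve γ) {K : ℝ}
    (hK : ∀ (z : ℂ) (r : ℝ), 0 < r →
      ∫⁻ t in γ ⁻¹' Metric.ball z r, ‖deriv γ t‖ₑ ≤ ENNReal.ofReal (K * r))
    (hK0 : 0 ≤ K) {z : ℂ} (hz : z ∉ Set.range γ) :
    ∃ S : Set ℝ, MeasurableSet S ∧ (∀ t ∈ S, ‖γ t - z‖ < 1) ∧ (∀ t ∉ S, 1 / 2 < ‖γ t - z‖) ∧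
      IntegrableOn (fun t => (γ t - z)⁻¹ * deriv γ t) S ∧
      ‖∫ t in S, (γ t - z)⁻¹ * deriv γ t‖ ≤ 4 * Real.pi * K := by
  -- Through each point inside the unit disc runs an arc with end points on the circle. By
  -- compactness finitely many of them cover the part of the curve in the disc of radius `1 / 2`;
  -- their union is `S`.
  choose! a b hmem ha hb hlt using fun t (ht : ‖γ t - z‖ < 1) => hγ.exists_arc ht
  let T : Set ℝ := γ ⁻¹' Metric.closedBall z (1 / 2)
  have hT : IsCompact T :=
    (isProperMap_iff_tendsto_cocompact.2 ⟨hγ.smooth.continuous, hγ.proper⟩).isCompact_preimage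
      (isCompact_closedBall _ _)
  have hTlt : ∀ t ∈ T, ‖γ t - z‖ ≤ 1 / 2 := fun t ht => by
    simpa [T, dist_eq_norm] using ht
  have hT1 : ∀ t ∈ T, ‖γ t - z‖ < 1 := fun t ht => (hTlt t ht).trans_lt (by norm_num)
  obtain ⟨s, hsT, hcov⟩ := hT.elim_nhds_subcover (fun t => Set.Ioo (a t) (b t))
    fun t ht => Ioo_mem_nhds (hmem t (hT1 t ht)).1 (hmem t (hT1 t ht)).2
  -- Indexing by end points rather than by the chosen parameters identifies repeated arcs, so
  -- distinct members are disjoint: no end point, being on the circle, lies inside another arc.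
  let I : Finset (ℝ × ℝ) := s.image fun t => (a t, b t)
  have hI : ∀ p ∈ I, ∃ t, p.1 < t ∧ t < p.2 ∧ ‖γ t - z‖ ≤ 1 / 2 ∧ ‖γ p.1 - z‖ = 1 ∧
      ‖γ p.2 - z‖ = 1 ∧ ∀ x ∈ Set.Ioo p.1 p.2, ‖γ x - z‖ < 1 := by
    intro p hp
    obtain ⟨t, ht, rfl⟩ := Finset.mem_image.1 hp
    have h1 := hT1 t (hsT t ht)
    exact ⟨t, (hmem t h1).1, (hmem t h1).2, hTlt t (hsT t ht), ha t h1, hb t h1, hlt t h1⟩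
  let S : Set ℝ := ⋃ p ∈ I, Set.Ioo p.1 p.2
  have hdisj : Set.Pairwise (I : Set (ℝ × ℝ)) (Function.onFun Disjoint fun p => Set.Ioo p.1 p.2) := by
    intro p hp q hq hpq
    obtain ⟨-, -, -, -, pa, pb, plt⟩ := hI p hp
    obtain ⟨-, -, -, -, qa, qb, qlt⟩ := hI q hq
    refine Set.disjoint_left.2 fun x hxp hxq => hpq (Prod.ext ?_ ?_)
    · rcases lt_trichotomy p.1 q.1 with h | h | h
      · exact absurd qa (plt _ ⟨h, hxq.1.trans hxp.2⟩).ne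
      · exact h
      · exact absurd pa (qlt _ ⟨h, hxp.1.trans hxq.2⟩).ne
    · rcases lt_trichotomy p.2 q.2 with h | h | h
      · exact absurd pb (qlt _ ⟨hxq.1.trans hxp.2, h⟩).ne
      · exact h
      · exact absurd qb (plt _ ⟨hxp.1.trans hxq.2, h⟩).ne
  have hcont : Continuous fun t => (γ t - z)⁻¹ * deriv γ t :=
    (continuous_inv_sub hγ.smooth.continuous hz).mul hγ.continuous_deriv
  have hint : ∀ p ∈ I, IntegrableOn (fun t => (γ t - z)⁻¹ * deriv γ t) (Set.Ioo p.1 p.2) :=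
    fun p _ => (hcont.continuousOn.integrableOn_Icc).mono_set Set.Ioo_subset_Icc_self
  have hSlt : ∀ t ∈ S, ‖γ t - z‖ < 1 := by
    intro t ht
    simp only [S, Set.mem_iUnion] at ht
    obtain ⟨p, hp, ht⟩ := ht
    obtain ⟨-, -, -, -, -, -, plt⟩ := hI p hp
    exact plt t ht
  refine ⟨S, Finset.measurableSet_biUnion _ fun _ _ => measurableSet_Ioo, hSlt, ?_, ?_, ?_⟩
  · intro t ht
    by_contra! h
    refine ht ?_
    have h1 := hcov (show t ∈ T by simpa [T, dist_eq_norm] using h)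
    simp only [Set.mem_iUnion] at h1
    obtain ⟨x, hx, h1⟩ := h1
    simp only [S, Set.mem_iUnion]
    exact ⟨_, Finset.mem_image_of_mem _ hx, h1⟩
  · exact integrableOn_finset_iUnion.2 hint
  -- Each arc runs from the unit circle into the disc of radius `1 / 2`, so its length is at least
  -- `1 / 2`, and the total length is at most `K`.
  · have hcard : (I.card : ℝ) * (1 / 2) ≤ K := by
      have h1 : ∑ p ∈ I, ∫⁻ t in Set.Ioo p.1 p.2, ‖deriv γ t‖ₑ ≤ ENNReal.ofReal (K * 1) := by
        rw [← lintegral_biUnion_finset hdisj fun _ _ => measurableSet_Ioo]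
        refine le_trans (lintegral_mono_set fun t ht => ?_) (hK z 1 one_pos)
        rw [Set.mem_preimage, Metric.mem_ball, dist_eq_norm]
        exact hSlt t ht
      have h2 : ∑ p ∈ I, ENNReal.ofReal (1 / 2) ≤
          ∑ p ∈ I, ∫⁻ t in Set.Ioo p.1 p.2, ‖deriv γ t‖ₑ := by
        refine Finset.sum_le_sum fun p hp => ?_
        obtain ⟨t, h1, h2, h3, h4, -, -⟩ := hI p hp
        refine le_trans ?_ ((hγ.norm_sub_le_arcLength h1.le).trans
          (lintegral_mono_set (Set.Ioo_subset_Ioo_right h2.le)))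
        refine ENNReal.ofReal_le_ofReal ?_
        have := norm_sub_le_norm_sub_add_norm_sub (γ p.1) (γ t) z
        rw [norm_sub_rev (γ p.1) (γ t)] at this
        linarith
      have h3 := h2.trans h1
      rw [Finset.sum_const, ← ENNReal.ofReal_nsmul, ENNReal.ofReal_le_ofReal_iff (by simpa),
        nsmul_eq_mul, mul_one] at h3
      exact h3
    rw [integral_biUnion_finset _ (fun _ _ => measurableSet_Ioo) hdisj hint]
    calc _ ≤ ∑ p ∈ I, ‖∫ t in Set.Ioo p.1 p.2, (γ t - z)⁻¹ * deriv γ t‖ := norm_sum_le _ _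
      _ ≤ ∑ p ∈ I, 2 * Real.pi := Finset.sum_le_sum fun p hp => by
          obtain ⟨t, h1, h2, -, h4, h5, h6⟩ := hI p hp
          have hab : p.1 ≤ p.2 := (h1.trans h2).le
          rw [← integral_Ioc_eq_integral_Ioo, ← intervalIntegral.integral_of_le hab]
          refine hγ.norm_integral_arc_le one_pos hz hab h4 h5 fun x hx => ?_
          rcases eq_or_lt_of_le hx.1 with h | h
          · rw [← h, h4]
          rcases eq_or_lt_of_le hx.2 with h' | h'
          · rw [h', h5]
          exact (h6 x ⟨h, h'⟩).le
      _ = I.card * (1 / 2) * (4 * Real.pi) := by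
          rw [Finset.sum_const, nsmul_eq_mul]; ring
      _ ≤ K * (4 * Real.pi) := by gcongr
      _ = _ := by ring

/-- The dyadic estimate of a weakly singular integral on a Carleson curve. -/
lemma exists_lintegral_rpow_le (hγ : Continuous γ) {K : ℝ}
    (hK : ∀ (z : ℂ) (r : ℝ), 0 < r →
      ∫⁻ t in γ ⁻¹' Metric.ball z r, ‖deriv γ t‖ₑ ≤ ENNReal.ofReal (K * r))
    {σ : ℝ} (hσ : 0 < σ) (hσ1 : σ ≤ 1) :
    ∃ B : ENNReal, B ≠ ⊤ ∧ ∀ z ∉ Set.range γ, ∀ S : Set ℝ, (∀ t ∈ S, ‖γ t - z‖ < 1) →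
      MeasurableSet S →
      ∫⁻ t in S, ENNReal.ofReal (‖γ t - z‖ ^ (σ - 1)) * ‖deriv γ t‖ₑ ≤ B := by
  -- The maximum of the integrand on the shell of distances between `2 ^ (-k - 1)` and `2 ^ (-k)`.
  -- The shell is put into an open ball of twice its outer radius, and the resulting series is
  -- geometric with ratio `2 ^ (-σ) < 1`.
  let c : ℕ → ℝ := fun k => ((1 / 2 : ℝ) ^ (k + 1)) ^ (σ - 1)
  have hc : ∀ k, 0 ≤ c k := fun k => by positivity
  have hceq : ∀ k, c k * (K * (2 * (1 / 2 : ℝ) ^ k)) =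
      (2 * K * (1 / 2 : ℝ) ^ (σ - 1)) * ((1 / 2 : ℝ) ^ σ) ^ k := by
    intro k
    have h2 : (0 : ℝ) < 1 / 2 := by norm_num
    have e1 : c k = (1 / 2 : ℝ) ^ (σ - 1) * ((1 / 2 : ℝ) ^ k) ^ (σ - 1) := by
      simp only [c]
      rw [pow_succ', Real.mul_rpow h2.le (by positivity)]
    have e2 : ((1 / 2 : ℝ) ^ σ) ^ k = ((1 / 2 : ℝ) ^ k) ^ (σ - 1) * (1 / 2 : ℝ) ^ k := by
      rw [← Real.rpow_add_one (by positivity), sub_add_cancel, ← Real.rpow_natCast,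
        ← Real.rpow_natCast, ← Real.rpow_mul h2.le, ← Real.rpow_mul h2.le, mul_comm]
    rw [e1, e2]
    ring
  refine ⟨∑' k, ENNReal.ofReal (c k * (K * (2 * (1 / 2 : ℝ) ^ k))), ?_, fun z hz S hS hSm => ?_⟩
  · simp only [hceq]
    refine Summable.tsum_ofReal_ne_top (Summable.mul_left _ (summable_geometric_of_lt_one
      (by positivity) ?_))
    exact Real.rpow_lt_one (by norm_num) (by norm_num) hσ
  have hpt : ∀ t ∈ S, ENNReal.ofReal (‖γ t - z‖ ^ (σ - 1)) * ‖deriv γ t‖ₑ ≤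
      ∑' k, (γ ⁻¹' Metric.ball z (2 * (1 / 2 : ℝ) ^ k)).indicator
        (fun t => ENNReal.ofReal (c k) * ‖deriv γ t‖ₑ) t := by
    intro t ht
    have h0 : 0 < ‖γ t - z‖ := norm_pos_iff.2 fun h => hz ⟨t, sub_eq_zero.1 h⟩
    obtain ⟨k, hk1, hk2⟩ := exists_nat_pow_near_of_lt_one h0 (hS t ht).le
      (by norm_num : (0 : ℝ) < 1 / 2) (by norm_num)
    refine le_trans ?_ (ENNReal.le_tsum k)
    rw [Set.indicator_of_mem]
    · gcongr
      exact Real.rpow_le_rpow_of_nonpos (by positivity) hk1.le (by linarith)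
    · rw [Set.mem_preimage, Metric.mem_ball, dist_eq_norm]
      have : (0 : ℝ) < (1 / 2) ^ k := by positivity
      linarith
  have hbm : ∀ k : ℕ, MeasurableSet (γ ⁻¹' Metric.ball z (2 * (1 / 2 : ℝ) ^ k)) := fun k =>
    hγ.measurable measurableSet_ball
  calc _ ≤ ∫⁻ t in S, ∑' k, (γ ⁻¹' Metric.ball z (2 * (1 / 2 : ℝ) ^ k)).indicator
        (fun t => ENNReal.ofReal (c k) * ‖deriv γ t‖ₑ) t := setLIntegral_mono' hSm hpt
    _ ≤ ∫⁻ t, ∑' k, (γ ⁻¹' Metric.ball z (2 * (1 / 2 : ℝ) ^ k)).indicator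
        (fun t => ENNReal.ofReal (c k) * ‖deriv γ t‖ₑ) t := setLIntegral_le_lintegral _ _
    _ = ∑' k, ∫⁻ t, (γ ⁻¹' Metric.ball z (2 * (1 / 2 : ℝ) ^ k)).indicator
        (fun t => ENNReal.ofReal (c k) * ‖deriv γ t‖ₑ) t := by
      refine lintegral_tsum fun k => Measurable.aemeasurable ?_
      exact (((measurable_deriv γ).enorm).const_mul _).indicator (hbm k)
    _ ≤ _ := ENNReal.tsum_le_tsum fun k => by
      rw [lintegral_indicator (hbm k), lintegral_const_mul _ (measurable_deriv γ).enorm,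
        ENNReal.ofReal_mul (hc k)]
      gcongr
      exact hK z _ (by positivity)

end ConstantJump

namespace ConstantJump

/-! ### Bounds for Cauchy transforms near the curve -/

variable {γ : ℝ → ℂ}

/-- A Hölder continuous weight with finite moments decays faster than any power. -/
lemma IsSmoothCurve.exists_decay (hγ : IsSmoothCurve γ) {v : ℂ → ℂ} {K r : ℝ} (hK : 0 ≤ K)
    (hr : 0 < r) (hv : ∀ s t, ‖v (γ s) - v (γ t)‖ ≤ K * ‖γ s - γ t‖ ^ r)
    (hmom : ∀ n : ℕ, Integrable fun t => γ t ^ n * v (γ t) * deriv γ t) (m : ℕ) :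
    ∃ B, ∀ t, (‖γ t‖ + 2) ^ m * ‖v (γ t)‖ ≤ B := by
  have hc := hγ.smooth.continuous
  have hvc : Continuous fun t => v (γ t) := by
    refine continuous_iff_continuousAt.2 fun t => ?_
    rw [ContinuousAt, tendsto_iff_norm_sub_tendsto_zero]
    refine squeeze_zero (fun _ => norm_nonneg _) (fun s => hv s t) ?_
    have h1 : Tendsto (fun s => ‖γ s - γ t‖) (𝓝 t) (𝓝 0) := by
      have := ((hc.tendsto t).sub_const (γ t)).norm
      simpa using this
    have h2 := (h1.rpow_const (Or.inr hr.le)).const_mul K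
    simpa [Real.zero_rpow hr.ne'] using h2
  -- the bounded part of the curve
  have hcpt : IsCompact (γ ⁻¹' Metric.closedBall 0 2) :=
    (isProperMap_iff_tendsto_cocompact.2 ⟨hc, hγ.proper⟩).isCompact_preimage
      (isCompact_closedBall _ _)
  obtain ⟨B₀, hB₀⟩ := hcpt.exists_bound_of_continuousOn hvc.continuousOn
  -- the lower bound for the moments
  let ρ : ℝ → ℝ := fun x => min 1 ((x / (2 * (K + 1))) ^ (1 / r))
  have hlow : ∀ n : ℕ, ∃ B, 0 ≤ B ∧ ∀ t, 2 ≤ ‖γ t‖ → v (γ t) ≠ 0 →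
      ‖γ t‖ ^ n * ‖v (γ t)‖ * ρ ‖v (γ t)‖ ≤ B := by
    intro n
    refine ⟨2 ^ (n + 1) * (∫⁻ t, ‖γ t ^ n * v (γ t) * deriv γ t‖ₑ).toReal, by positivity,
      fun t₀ hb hx0 => ?_⟩
    set x := ‖v (γ t₀)‖ with hx
    set b := ‖γ t₀‖ with hbdef
    have hxpos : 0 < x := norm_pos_iff.2 hx0
    have hy : 0 < x / (2 * (K + 1)) := by positivity
    have hρpos : 0 < ρ x := lt_min one_pos (Real.rpow_pos_of_pos hy _)
    -- Until it leaves the disc of radius `ρ x`, the curve has length at least `ρ x`, the weight is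
    -- at least `x / 2` and the modulus of `γ` at least `b / 2`. The absolute moment thus controls
    -- `b ^ n * x * ρ x`.
    obtain ⟨a', b', hmem, -, hb', hlt⟩ := hγ.exists_arc (z := γ t₀) (r := ρ x) (t := t₀) (by simpa)
    have hpt : ∀ t ∈ Set.Ioo t₀ b', ENNReal.ofReal ((b / 2) ^ n * (x / 2)) * ‖deriv γ t‖ₑ ≤
        ‖γ t ^ n * v (γ t) * deriv γ t‖ₑ := by
      intro t ht
      have hd := hlt t ⟨hmem.1.trans ht.1, ht.2⟩
      rw [enorm_mul]
      gcongr
      rw [← ofReal_norm, norm_mul, norm_pow]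
      have h1 : b / 2 ≤ ‖γ t‖ := by
        have h2 := norm_sub_norm_le (γ t₀) (γ t)
        rw [norm_sub_rev] at h2
        have h3 : ρ x ≤ 1 := min_le_left _ _
        linarith
      have h2 : x / 2 ≤ ‖v (γ t)‖ := by
        have h3 : ‖γ t - γ t₀‖ ^ r ≤ x / (2 * (K + 1)) := by
          calc _ ≤ ((x / (2 * (K + 1))) ^ (1 / r)) ^ r :=
                Real.rpow_le_rpow (norm_nonneg _) (hd.le.trans (min_le_right _ _)) hr.le
            _ = _ := by
              rw [← Real.rpow_mul hy.le, one_div_mul_cancel hr.ne', Real.rpow_one]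
        have h4 : K * ‖γ t - γ t₀‖ ^ r ≤ x / 2 := by
          calc _ ≤ (K + 1) * (x / (2 * (K + 1))) := by gcongr; linarith
            _ = _ := by field_simp
        have h5 := norm_sub_norm_le (v (γ t₀)) (v (γ t))
        rw [norm_sub_rev] at h5
        linarith [hv t t₀]
      gcongr
    have h1 : ENNReal.ofReal ((b / 2) ^ n * (x / 2)) * ENNReal.ofReal (ρ x) ≤
        ∫⁻ t, ‖γ t ^ n * v (γ t) * deriv γ t‖ₑ := by
      calc _ ≤ ENNReal.ofReal ((b / 2) ^ n * (x / 2)) * ∫⁻ t in Set.Ioo t₀ b', ‖deriv γ t‖ₑ := by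
            gcongr
            rw [← hb']
            exact hγ.norm_sub_le_arcLength hmem.2.le
        _ = ∫⁻ t in Set.Ioo t₀ b', ENNReal.ofReal ((b / 2) ^ n * (x / 2)) * ‖deriv γ t‖ₑ :=
            (lintegral_const_mul _ (measurable_deriv γ).enorm).symm
        _ ≤ ∫⁻ t in Set.Ioo t₀ b', ‖γ t ^ n * v (γ t) * deriv γ t‖ₑ :=
            setLIntegral_mono' measurableSet_Ioo hpt
        _ ≤ _ := setLIntegral_le_lintegral _ _
    rw [← ENNReal.ofReal_mul (by positivity),
      ENNReal.ofReal_le_iff_le_toReal (hmom n).2.ne] at h1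
    calc _ = 2 ^ (n + 1) * ((b / 2) ^ n * (x / 2) * ρ x) := by
          rw [div_pow, pow_succ]; field_simp
      _ ≤ _ := by gcongr
  -- When `ρ x` is given by the power `1 / r`, the bound controls `b ^ n * x ^ (1 + 1 / r)`; this
  -- choice of `n` makes it dominate `(b ^ m * x) ^ (1 + 1 / r)`.
  obtain ⟨n, hn⟩ := exists_nat_ge ((m : ℝ) * (1 + 1 / r))
  have hmn : m ≤ n := by
    have : (m : ℝ) ≤ n := le_trans (le_mul_of_one_le_right m.cast_nonneg
      (by linarith [one_div_pos.2 hr])) hn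
    exact_mod_cast this
  obtain ⟨B₁, hB₁, hlow⟩ := hlow n
  set D := (2 * (K + 1)) ^ (1 / r) with hD
  have hDpos : 0 < D := by positivity
  have key : ∀ t, 2 ≤ ‖γ t‖ → ‖γ t‖ ^ m * ‖v (γ t)‖ ≤ B₁ + (1 + B₁ * D) := by
    intro t ht
    by_cases hx0 : v (γ t) = 0
    · rw [hx0, norm_zero, mul_zero]; positivity
    have h1 := hlow t ht hx0
    set x := ‖v (γ t)‖ with hx
    set b := ‖γ t‖ with hbdef
    have hxpos : 0 < x := norm_pos_iff.2 hx0
    have hb1 : 1 ≤ b := by linarith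
    have hbmn : b ^ m ≤ b ^ n := pow_le_pow_right₀ hb1 hmn
    rcases le_total 1 ((x / (2 * (K + 1))) ^ (1 / r)) with h | h
    · have h2 : ρ x = 1 := min_eq_left h
      rw [h2, mul_one] at h1
      have : b ^ m * x ≤ b ^ n * x := by gcongr
      have : 0 ≤ B₁ * D := by positivity
      linarith
    · have h2 : ρ x = x ^ (1 / r) / D := by
        simp only [ρ, min_eq_right h]
        rw [Real.div_rpow hxpos.le (by positivity)]
      rw [h2, ← mul_div_assoc, div_le_iff₀ hDpos] at h1
      by_cases hy : b ^ m * x ≤ 1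
      · have : 0 ≤ B₁ * D := by positivity
        linarith
      · push Not at hy
        have h3 : b ^ m * x ≤ (b ^ m * x) ^ (1 + 1 / r) :=
          Real.self_le_rpow_of_one_le hy.le (by linarith [one_div_pos.2 hr])
        have h4 : (b ^ m * x) ^ (1 + 1 / r) ≤ b ^ n * x * x ^ (1 / r) := by
          rw [Real.mul_rpow (by positivity) hxpos.le, Real.rpow_add hxpos, Real.rpow_one,
            mul_assoc]
          gcongr
          rw [← Real.rpow_natCast, ← Real.rpow_mul (by linarith), ← Real.rpow_natCast b n]
          exact Real.rpow_le_rpow_of_exponent_le hb1 hn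
        linarith
  refine ⟨max (4 ^ m * B₀) (2 ^ m * (B₁ + (1 + B₁ * D))), fun t => ?_⟩
  rcases le_total ‖γ t‖ 2 with h | h
  · refine le_trans ?_ (le_max_left _ _)
    gcongr
    · linarith
    · exact hB₀ t (by simpa using h)
  · refine le_trans ?_ (le_max_right _ _)
    calc (‖γ t‖ + 2) ^ m * ‖v (γ t)‖ ≤ (2 * ‖γ t‖) ^ m * ‖v (γ t)‖ := by gcongr; linarith
      _ = 2 ^ m * (‖γ t‖ ^ m * ‖v (γ t)‖) := by ring
      _ ≤ _ := by gcongr; exact key t h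

/-- The product of a power and a rapidly decaying Hölder function is Hölder on unit scale. -/
lemma exists_local_holder {v : ℂ → ℂ} {K r : ℝ} (hK : 0 ≤ K)
    (hr : 0 < r) (hv : ∀ s t, ‖v (γ s) - v (γ t)‖ ≤ K * ‖γ s - γ t‖ ^ r)
    (hdec : ∀ m : ℕ, ∃ B, ∀ t, (‖γ t‖ + 2) ^ m * ‖v (γ t)‖ ≤ B) (k : ℕ) :
    ∃ B σ : ℝ, 0 ≤ B ∧ 0 < σ ∧ σ ≤ 1 ∧ ∀ s t, ‖γ s - γ t‖ ≤ 2 →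
      ‖γ s ^ k * v (γ s) - γ t ^ k * v (γ t)‖ ≤ B * ‖γ s - γ t‖ ^ σ := by
  obtain ⟨B₁, hB₁⟩ := hdec (2 * k)
  obtain ⟨B₂, hB₂⟩ := hdec k
  have hB₁0 : 0 ≤ B₁ := le_trans (by positivity) (hB₁ 0)
  have hB₂0 : 0 ≤ B₂ := le_trans (by positivity) (hB₂ 0)
  -- Half of the Hölder exponent is given up: the square of the increment of `v` is at most the
  -- Hölder bound times the sum of the two values, whose decay of order `2 * k` absorbs the square
  -- of the polynomial factor.
  set σ := min (r / 2) 1 with hσ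
  have hσ0 : 0 < σ := lt_min (by positivity) one_pos
  have hpow : ∀ d τ : ℝ, 0 < d → d ≤ 2 → σ ≤ τ → d ^ τ ≤ 2 ^ τ * d ^ σ := by
    intro d τ hd0 hd hτ
    calc d ^ τ = 2 ^ τ * (d / 2) ^ τ := by
          rw [← Real.mul_rpow (by norm_num) (by positivity)]; congr 1; ring
      _ ≤ 2 ^ τ * (d / 2) ^ σ := by
          gcongr 2 ^ τ * ?_
          exact Real.rpow_le_rpow_of_exponent_ge (by positivity) (by linarith) hτ
      _ ≤ 2 ^ τ * d ^ σ := by gcongr; linarith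
  refine ⟨Real.sqrt (K * (B₁ + B₁)) * 2 ^ (r / 2) + k * B₂ * 2, σ, by positivity, hσ0,
    min_le_right _ _, fun s t hst => ?_⟩
  set d := ‖γ s - γ t‖ with hd
  rcases eq_or_lt_of_le (norm_nonneg (γ s - γ t)) with h0 | h0
  · have : γ s = γ t := sub_eq_zero.1 (norm_eq_zero.1 h0.symm)
    rw [this, sub_self, norm_zero]
    positivity
  have hle : ‖γ s‖ ≤ ‖γ t‖ + 2 := by
    have := norm_sub_norm_le (γ s) (γ t)
    linarith
  have hsplit : γ s ^ k * v (γ s) - γ t ^ k * v (γ t) =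
      γ s ^ k * (v (γ s) - v (γ t)) + (γ s ^ k - γ t ^ k) * v (γ t) := by ring
  have h1 : ‖γ s ^ k * (v (γ s) - v (γ t))‖ ≤ Real.sqrt (K * (B₁ + B₁)) * d ^ (r / 2) := by
    have hsq : (d ^ (r / 2)) ^ 2 = d ^ r := by
      rw [← Real.rpow_natCast, ← Real.rpow_mul h0.le]; congr 1; push_cast; ring
    refine abs_le_of_sq_le_sq' ?_ (by positivity) |>.2
    rw [mul_pow, Real.sq_sqrt (by positivity), hsq, norm_mul, norm_pow, mul_pow, ← pow_mul,
      mul_comm k 2]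
    have e1 : ‖v (γ s) - v (γ t)‖ ^ 2 ≤ K * d ^ r * (‖v (γ s)‖ + ‖v (γ t)‖) := by
      rw [pow_two]
      exact mul_le_mul (hv s t) (norm_sub_le _ _) (norm_nonneg _) (by positivity)
    have e2 : ‖γ s‖ ^ (2 * k) * ‖v (γ s)‖ ≤ B₁ :=
      le_trans (by gcongr; linarith) (hB₁ s)
    have e3 : ‖γ s‖ ^ (2 * k) * ‖v (γ t)‖ ≤ B₁ := le_trans (by gcongr) (hB₁ t)
    calc _ ≤ ‖γ s‖ ^ (2 * k) * (K * d ^ r * (‖v (γ s)‖ + ‖v (γ t)‖)) := by gcongr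
      _ = K * (‖γ s‖ ^ (2 * k) * ‖v (γ s)‖ + ‖γ s‖ ^ (2 * k) * ‖v (γ t)‖) * d ^ r := by ring
      _ ≤ _ := by gcongr
  have h2 : ‖(γ s ^ k - γ t ^ k) * v (γ t)‖ ≤ k * B₂ * d := by
    have e1 : ‖γ s ^ k - γ t ^ k‖ ≤ k * (‖γ t‖ + 2) ^ k * d := by
      rw [← (Commute.all (γ s) (γ t)).mul_geom_sum₂, norm_mul, mul_comm, ← hd]
      gcongr
      refine (norm_sum_le _ _).trans ?_
      calc _ ≤ ∑ i ∈ Finset.range k, (‖γ t‖ + 2) ^ k := by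
            refine Finset.sum_le_sum fun i hi => ?_
            have hik := Finset.mem_range.1 hi
            rw [norm_mul, norm_pow, norm_pow]
            calc _ ≤ (‖γ t‖ + 2) ^ i * (‖γ t‖ + 2) ^ (k - 1 - i) := by gcongr; linarith
              _ = (‖γ t‖ + 2) ^ (k - 1) := by rw [← pow_add]; congr 1; omega
              _ ≤ _ := pow_le_pow_right₀ (by linarith [norm_nonneg (γ t)]) (by omega)
        _ = _ := by rw [Finset.sum_const, Finset.card_range, nsmul_eq_mul]
    rw [norm_mul]
    calc _ ≤ k * (‖γ t‖ + 2) ^ k * d * ‖v (γ t)‖ := by gcongr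
      _ = k * ((‖γ t‖ + 2) ^ k * ‖v (γ t)‖) * d := by ring
      _ ≤ _ := by gcongr; exact hB₂ t
  rw [hsplit, add_mul]
  refine (norm_add_le _ _).trans (add_le_add (h1.trans ?_) (h2.trans ?_))
  · rw [mul_assoc]
    gcongr
    exact hpow d _ h0 hst (min_le_left _ _)
  · rw [mul_assoc _ 2]
    gcongr
    have := hpow d 1 h0 hst (min_le_right _ _)
    rwa [Real.rpow_one, Real.rpow_one] at this

/-- Cauchy transforms of Hölder weights on Carleson curves are bounded off the curve. -/
theorem IsSmoothCurve.exists_cauchy_bound (hγ : IsSmoothCurve γ) (hC : IsCarlesonCurve γ)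
    {v : ℂ → ℂ} {K r : ℝ} (hK : 0 ≤ K) (hr : 0 < r)
    (hv : ∀ s t, ‖v (γ s) - v (γ t)‖ ≤ K * ‖γ s - γ t‖ ^ r)
    (hmom : ∀ n : ℕ, Integrable fun t => γ t ^ n * v (γ t) * deriv γ t) (k : ℕ) :
    ∃ B, ∀ z ∉ Set.range γ, ‖∫ t, (γ t - z)⁻¹ * (γ t ^ k * v (γ t) * deriv γ t)‖ ≤ B := by
  obtain ⟨A', hA'⟩ := hC
  set A := max A' 0
  have hA : ∀ (z : ℂ) (r : ℝ), 0 < r →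
      ∫⁻ t in γ ⁻¹' Metric.ball z r, ‖deriv γ t‖ₑ ≤ ENNReal.ofReal (A * r) := fun z r hr =>
    (hA' z r hr).trans (ENNReal.ofReal_le_ofReal (by gcongr; exact le_max_left _ _))
  have hA0 : 0 ≤ A := le_max_right _ _
  have hdec := hγ.exists_decay hK hr hv hmom
  obtain ⟨H, σ, hH, hσ, hσ1, hhol⟩ := exists_local_holder hK hr hv hdec k
  obtain ⟨M, hM⟩ := hdec k
  obtain ⟨D, hD, hdyad⟩ := exists_lintegral_rpow_le hγ.smooth.continuous hA hσ hσ1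
  set g : ℝ → ℂ := fun t => γ t ^ k * v (γ t) * deriv γ t with hg
  refine ⟨2 * (∫ t, ‖g t‖) + H * 2 ^ σ * D.toReal + M * (4 * Real.pi * A), fun z hz => ?_⟩
  obtain ⟨S, hSm, hS1, hS2, hSint, hSb⟩ := hγ.exists_near_part hA hA0 hz
  have hint := hγ.integrable_div (hmom k) hz
  -- The density is frozen at a point of the curve nearest to `z`, so distances to that point are at
  -- most twice the distances to `z`.
  obtain ⟨w₀, ⟨t₀, rfl⟩, hw₀⟩ := hγ.isClosed_range.exists_infDist_eq_dist (Set.range_nonempty γ) z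
  have hnear : ∀ t, ‖γ t - γ t₀‖ ≤ 2 * ‖γ t - z‖ := by
    intro t
    have h1 : dist z (γ t₀) ≤ dist z (γ t) :=
      hw₀ ▸ Metric.infDist_le_dist_of_mem (Set.mem_range_self t)
    have h2 := dist_triangle (γ t) z (γ t₀)
    rw [dist_comm z (γ t)] at h1
    rw [← dist_eq_norm, ← dist_eq_norm]
    linarith
  rw [← integral_add_compl hSm hint]
  have hfar : ‖∫ t in Sᶜ, (γ t - z)⁻¹ * g t‖ ≤ 2 * ∫ t, ‖g t‖ := by
    calc _ ≤ ∫ t in Sᶜ, 2 * ‖g t‖ := by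
          refine norm_integral_le_of_norm_le ((hmom k).norm.const_mul 2).integrableOn ?_
          refine (ae_restrict_iff' hSm.compl).2 (Eventually.of_forall fun t ht => ?_)
          rw [norm_mul, norm_inv]
          gcongr
          rw [inv_le_comm₀ (lt_trans (by norm_num) (hS2 t ht)) (by norm_num)]
          linarith [hS2 t ht]
      _ ≤ ∫ t, 2 * ‖g t‖ := setIntegral_le_integral ((hmom k).norm.const_mul 2)
          (Eventually.of_forall fun t => by positivity)
      _ = _ := integral_const_mul _ _
  set f₀ := γ t₀ ^ k * v (γ t₀) with hf₀
  have hdiffint : IntegrableOn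
      (fun t => (γ t - z)⁻¹ * g t - f₀ * ((γ t - z)⁻¹ * deriv γ t)) S :=
    hint.integrableOn.sub (hSint.const_mul f₀)
  -- The increment of the density softens the kernel to the exponent `σ - 1`; the frozen value
  -- multiplies the integral of `dw / (w - z)`, bounded by counting arcs.
  have hsplit : ∫ t in S, (γ t - z)⁻¹ * g t =
      (∫ t in S, ((γ t - z)⁻¹ * g t - f₀ * ((γ t - z)⁻¹ * deriv γ t))) +
        f₀ * ∫ t in S, (γ t - z)⁻¹ * deriv γ t := by
    rw [integral_sub hint.integrableOn (hSint.const_mul f₀), integral_const_mul]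
    ring
  have hosc : ‖∫ t in S, ((γ t - z)⁻¹ * g t - f₀ * ((γ t - z)⁻¹ * deriv γ t))‖ ≤
      H * 2 ^ σ * D.toReal := by
    have hpt : ∀ t ∈ S, ‖(γ t - z)⁻¹ * g t - f₀ * ((γ t - z)⁻¹ * deriv γ t)‖ₑ ≤
        ENNReal.ofReal (H * 2 ^ σ) * (ENNReal.ofReal (‖γ t - z‖ ^ (σ - 1)) * ‖deriv γ t‖ₑ) := by
      intro t ht
      have h0 : 0 < ‖γ t - z‖ := norm_pos_iff.2 fun h => hz ⟨t, sub_eq_zero.1 h⟩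
      have e : (γ t - z)⁻¹ * g t - f₀ * ((γ t - z)⁻¹ * deriv γ t) =
          (γ t ^ k * v (γ t) - f₀) * (γ t - z)⁻¹ * deriv γ t := by simp only [hg]; ring
      rw [e, enorm_mul, ← mul_assoc, ← ENNReal.ofReal_mul (by positivity), ← ofReal_norm]
      gcongr
      rw [norm_mul, norm_inv]
      calc _ ≤ H * (2 * ‖γ t - z‖) ^ σ * ‖γ t - z‖⁻¹ := by
            gcongr
            refine (hhol t t₀ ((hnear t).trans (by linarith [hS1 t ht]))).trans ?_
            gcongr
            exact hnear t
        _ = _ := by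
            rw [Real.mul_rpow (by norm_num) h0.le, Real.rpow_sub_one h0.ne']
            field_simp
    have h1 : ‖∫ t in S, ((γ t - z)⁻¹ * g t - f₀ * ((γ t - z)⁻¹ * deriv γ t))‖ₑ ≤
        ENNReal.ofReal (H * 2 ^ σ) * D := by
      calc _ ≤ _ := enorm_integral_le_lintegral_enorm _
        _ ≤ _ := setLIntegral_mono' hSm hpt
        _ ≤ ENNReal.ofReal (H * 2 ^ σ) *
            ∫⁻ t in S, ENNReal.ofReal (‖γ t - z‖ ^ (σ - 1)) * ‖deriv γ t‖ₑ := by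
          rw [lintegral_const_mul' _ _ ENNReal.ofReal_ne_top]
        _ ≤ _ := by gcongr; exact hdyad z hz S hS1 hSm
    rw [← ENNReal.ofReal_toReal hD, ← ENNReal.ofReal_mul (by positivity), ← ofReal_norm,
      ENNReal.ofReal_le_ofReal_iff (by positivity)] at h1
    exact h1
  have hmain : ‖f₀ * ∫ t in S, (γ t - z)⁻¹ * deriv γ t‖ ≤ M * (4 * Real.pi * A) := by
    rw [norm_mul]
    have hf : ‖f₀‖ ≤ M := by
      refine le_trans ?_ (hM t₀)
      rw [hf₀, norm_mul, norm_pow]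
      gcongr
      linarith
    exact mul_le_mul hf hSb (norm_nonneg _) ((norm_nonneg _).trans hf)
  rw [hsplit]
  refine (norm_add_le _ _).trans ?_
  have := norm_add_le (∫ t in S, ((γ t - z)⁻¹ * g t - f₀ * ((γ t - z)⁻¹ * deriv γ t)))
    (f₀ * ∫ t in S, (γ t - z)⁻¹ * deriv γ t)
  linarith

end ConstantJump

namespace ConstantJump

/-! ### Removability of the curve for continuous functions -/

/-- A `C¹` map of the plane whose derivative is the multiplication by a nonzero complex number is
locally onto. -/
lemma map_nhds_eq_of_conformal {g : ℝ × ℝ → ℂ} {x : ℝ × ℝ} {c : ℂ} (hg : ContDiffAt ℝ 1 g x)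
    (hc : c ≠ 0) (hd : HasFDerivAt g ((ContinuousLinearMap.fst ℝ ℝ ℝ).smulRight c +
      (ContinuousLinearMap.snd ℝ ℝ ℝ).smulRight (Complex.I * c)) x) :
    map g (𝓝 x) = 𝓝 (g x) := by
  refine (hg.hasStrictFDerivAt' hd one_ne_zero).map_nhds_eq_of_surj
    (LinearMap.range_eq_top.2 fun w => ⟨((w / c).re, (w / c).im), ?_⟩)
  have := Complex.re_add_im (w / c)
  simp only [ContinuousLinearMap.coe_coe, add_apply,
    ContinuousLinearMap.smulRight_apply, ContinuousLinearMap.coe_fst',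
    ContinuousLinearMap.coe_snd', Complex.real_smul]
  calc _ = ((w / c).re + (w / c).im * Complex.I) * c := by ring
    _ = _ := by rw [this, div_mul_cancel₀ _ hc]

section Flat

variable {γ : ℝ → ℂ} {f : ℂ → ℂ} {c : ℂ}

/-- Coordinates in which the curve is a straight line. -/
def flat (γ : ℝ → ℂ) (c : ℂ) (x : ℝ × ℝ) : ℂ := γ x.1 + x.2 * c

lemma continuous_flat (hγ : Continuous γ) (c : ℂ) : Continuous (flat γ c) := by
  unfold flat; fun_prop

lemma hasFDerivAt_flat (hγ : IsSmoothCurve γ) (c : ℂ) (x : ℝ × ℝ) :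
    HasFDerivAt (flat γ c) ((ContinuousLinearMap.fst ℝ ℝ ℝ).smulRight (deriv γ x.1) +
      (ContinuousLinearMap.snd ℝ ℝ ℝ).smulRight c) x := by
  have h1 : HasFDerivAt (fun x : ℝ × ℝ => γ x.1)
      ((ContinuousLinearMap.fst ℝ ℝ ℝ).smulRight (deriv γ x.1)) x := by
    have := (hγ.hasDerivAt x.1).hasFDerivAt.comp x (hasFDerivAt_fst (𝕜 := ℝ) (p := x))
    convert! this using 1
  have h2 : HasFDerivAt (fun x : ℝ × ℝ => (x.2 : ℂ) * c)
      ((ContinuousLinearMap.snd ℝ ℝ ℝ).smulRight c) x := by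
    have := ((ContinuousLinearMap.snd ℝ ℝ ℝ).smulRight c).hasFDerivAt (x := x)
    convert! this using 1
  exact h1.add h2

/-- Cauchy's theorem in flattened coordinates, for rectangles with one side on the curve. -/
lemma flat_cauchy (hγ : IsSmoothCurve γ) (hf : Continuous f) {a b y : ℝ}
    (hd : ∀ s ∈ Set.uIcc a b, ∀ u ∈ Set.uIcc 0 y, u ≠ 0 →
      DifferentiableAt ℂ f (flat γ c (s, u))) :
    (∫ s in a..b, f (flat γ c (s, y)) * deriv γ s) - (∫ s in a..b, f (flat γ c (s, 0)) * deriv γ s)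
      = (∫ u in (0 : ℝ)..y, f (flat γ c (b, u)) * c) - ∫ u in (0 : ℝ)..y, f (flat γ c (a, u)) * c := by
  let φ : ℝ × ℝ → (ℝ × ℝ →L[ℝ] ℂ) := fun x =>
    ((ContinuousLinearMap.toSpanSingleton ℂ (deriv f (flat γ c x))).restrictScalars ℝ).comp
      ((ContinuousLinearMap.fst ℝ ℝ ℝ).smulRight (deriv γ x.1) +
        (ContinuousLinearMap.snd ℝ ℝ ℝ).smulRight c)
  have hφ : ∀ x, DifferentiableAt ℂ f (flat γ c x) →
      HasFDerivAt (fun x => f (flat γ c x)) (φ x) x := fun x hx =>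
    (hx.hasDerivAt.hasFDerivAt.restrictScalars ℝ).comp x (hasFDerivAt_flat hγ c x)
  -- The divergence theorem asks for a derivative of `γ'`, hence for class `C²`, although this term
  -- drops out in `hzero`.
  let ψ : ℝ × ℝ → (ℝ × ℝ →L[ℝ] ℂ) := fun x =>
    (ContinuousLinearMap.fst ℝ ℝ ℝ).smulRight (deriv (deriv γ) x.1)
  have hψ : ∀ x : ℝ × ℝ, HasFDerivAt (fun x : ℝ × ℝ => deriv γ x.1) (ψ x) x := by
    intro x
    have hdiff : DifferentiableAt ℝ (deriv γ) x.1 :=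
      (hγ.smooth.differentiable_deriv_two) x.1
    have := hdiff.hasDerivAt.hasFDerivAt.comp x (hasFDerivAt_fst (𝕜 := ℝ) (p := x))
    convert! this using 1
  have hcf : Continuous fun x => f (flat γ c x) := hf.comp (continuous_flat hγ.smooth.continuous c)
  have hdI : ∀ x ∈ Set.Ioo (min a b) (max a b) ×ˢ Set.Ioo (min 0 y) (max 0 y) \ (∅ : Set (ℝ × ℝ)),
      DifferentiableAt ℂ f (flat γ c x) := by
    rintro ⟨s, u⟩ ⟨⟨hs, hu⟩, -⟩
    refine hd s (Set.Ioo_subset_Icc_self hs) u (Set.Ioo_subset_Icc_self hu) ?_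
    rintro rfl
    rcases le_total 0 y with h | h
    · rw [min_eq_left h] at hu
      exact lt_irrefl _ hu.1
    · rw [max_eq_left h] at hu
      exact lt_irrefl _ hu.2
  -- The pulled back form `f dz` is closed. As an algebraic identity this holds at every point,
  -- whether or not `f` is differentiable there.
  have hzero : ∀ x, (ContinuousLinearMap.smulRight (φ x) c) (1, 0) +
      (-((f (flat γ c x)) • ψ x + deriv γ x.1 • φ x)) (0, 1) = 0 := by
    intro x
    simp [φ, ψ]
    ring
  have key := integral2_divergence_prod_of_hasFDerivAt_off_countable
    (fun x => f (flat γ c x) * c) (fun x => -(f (flat γ c x) * deriv γ x.1))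
    (fun x => ContinuousLinearMap.smulRight (φ x) c)
    (fun x => -((f (flat γ c x)) • ψ x + deriv γ x.1 • φ x)) a 0 b y ∅ Set.countable_empty
    (hcf.mul continuous_const).continuousOn
    (hcf.mul (hγ.continuous_deriv.comp continuous_fst)).neg.continuousOn
    (fun x hx => by
      have := (hφ x (hdI x hx)).mul_const c
      convert! this using 1
      ext <;> simp [mul_comm])
    (fun x hx => ((hφ x (hdI x hx)).mul (hψ x)).neg)
    (by simp only [hzero]; exact integrableOn_zero)
  simp only [hzero, intervalIntegral.integral_zero, intervalIntegral.integral_neg] at key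
  linear_combination key

/-- A primitive in flattened coordinates. -/
noncomputable def flatPrimitive (γ : ℝ → ℂ) (f : ℂ → ℂ) (c : ℂ) (t₀ : ℝ) (x : ℝ × ℝ) : ℂ :=
  (∫ s in t₀..x.1, f (flat γ c (s, 0)) * deriv γ s) + ∫ u in (0 : ℝ)..x.2, f (flat γ c (x.1, u)) * c

/-- Cauchy's theorem moves the horizontal path from the curve to the height of `x`. The increment
then follows a path from `x` to `x'` made of two short pieces, so continuity of `f` yields a
derivative. -/
lemma flatPrimitive_sub (hγ : IsSmoothCurve γ) (hf : Continuous f) (t₀ : ℝ) {x x' : ℝ × ℝ}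
    (hd : ∀ s ∈ Set.uIcc x.1 x'.1, ∀ u ∈ Set.uIcc 0 x.2, u ≠ 0 →
      DifferentiableAt ℂ f (flat γ c (s, u))) :
    flatPrimitive γ f c t₀ x' - flatPrimitive γ f c t₀ x -
        f (flat γ c x) * (flat γ c x' - flat γ c x) =
      (∫ s in x.1..x'.1, (f (flat γ c (s, x.2)) - f (flat γ c x)) * deriv γ s) +
        ∫ u in x.2..x'.2, (f (flat γ c (x'.1, u)) - f (flat γ c x)) * c := by
  have hcf : Continuous fun x => f (flat γ c x) := hf.comp (continuous_flat hγ.smooth.continuous c)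
  have i1 : ∀ y a b, IntervalIntegrable (fun s => f (flat γ c (s, y)) * deriv γ s) volume a b :=
    fun y a b => ((hcf.comp (by fun_prop : Continuous fun s : ℝ => (s, y))).mul
      hγ.continuous_deriv).intervalIntegrable _ _
  have i2 : ∀ s a b, IntervalIntegrable (fun u => f (flat γ c (s, u)) * c) volume a b :=
    fun s a b => ((hcf.comp (by fun_prop : Continuous fun u : ℝ => (s, u))).mul
      continuous_const).intervalIntegrable _ _
  have e := flat_cauchy (c := c) hγ hf hd
  have e1 := intervalIntegral.integral_add_adjacent_intervals (i1 0 t₀ x.1) (i1 0 x.1 x'.1)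
  have e2 := intervalIntegral.integral_add_adjacent_intervals (i2 x'.1 0 x.2) (i2 x'.1 x.2 x'.2)
  have e3 : ∫ s in x.1..x'.1, (f (flat γ c (s, x.2)) - f (flat γ c x)) * deriv γ s =
      (∫ s in x.1..x'.1, f (flat γ c (s, x.2)) * deriv γ s) -
        f (flat γ c x) * (γ x'.1 - γ x.1) := by
    simp only [sub_mul]
    rw [intervalIntegral.integral_sub (i1 _ _ _)
      ((hγ.continuous_deriv.const_mul _).intervalIntegrable _ _),
      intervalIntegral.integral_const_mul, intervalIntegral.integral_eq_sub_of_hasDerivAt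
      (fun t _ => hγ.hasDerivAt t) (hγ.continuous_deriv.intervalIntegrable _ _)]
  have e4 : ∫ u in x.2..x'.2, (f (flat γ c (x'.1, u)) - f (flat γ c x)) * c =
      (∫ u in x.2..x'.2, f (flat γ c (x'.1, u)) * c) -
        f (flat γ c x) * ((x'.2 - x.2 : ℝ) * c) := by
    simp only [sub_mul]
    rw [intervalIntegral.integral_sub (i2 _ _ _) (continuous_const.intervalIntegrable _ _),
      intervalIntegral.integral_const, Complex.real_smul]
    ring
  rw [e3, e4]
  have e5 : flat γ c x' - flat γ c x = (γ x'.1 - γ x.1) + (x'.2 - x.2 : ℝ) * c := by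
    simp only [flat]; push_cast; ring
  rw [e5]
  simp only [flatPrimitive]
  linear_combination -e1 - e2 - e

end Flat

/-- A continuous function which is holomorphic off a smooth curve is entire. -/
theorem IsSmoothCurve.differentiable_of_continuous {γ : ℝ → ℂ} (hγ : IsSmoothCurve γ) {f : ℂ → ℂ}
    (hf : Continuous f) (hd : DifferentiableOn ℂ f (Set.range γ)ᶜ) : Differentiable ℂ f := by
  have hoff : ∀ z ∉ Set.range γ, DifferentiableAt ℂ f z := fun z hz =>
    hd.differentiableAt (hγ.isClosed_range.isOpen_compl.mem_nhds hz)
  intro z₀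
  by_cases hz₀ : z₀ ∉ Set.range γ
  · exact hoff z₀ hz₀
  obtain ⟨t₀, rfl⟩ := not_not.1 hz₀
  obtain ⟨η, hη, hder, hlin⟩ := hγ.exists_almost_linear t₀
  obtain ⟨ρ, hρ, hfar⟩ := hγ.exists_far (t₀ := t₀) hη
  set c₀ := deriv γ t₀ with hc₀def
  have hc₀ : c₀ ≠ 0 := hγ.regular t₀
  have hn0 : 0 < ‖c₀‖ := norm_pos_iff.2 hc₀
  set c := Complex.I * c₀ with hc
  have hnc : ‖c‖ = ‖c₀‖ := by rw [hc, norm_mul, Complex.norm_I, one_mul]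
  have hflat0 : flat γ c (t₀, 0) = γ t₀ := by simp [flat]
  obtain ⟨h, hh, hball⟩ := Metric.mem_nhds_iff.1
    ((continuous_flat hγ.smooth.continuous c).continuousAt.preimage_mem_nhds
      (Metric.ball_mem_nhds (flat γ c (t₀, 0)) hρ))
  rw [hflat0] at hball
  set κ := min h η with hκ
  have hκ0 : 0 < κ := lt_min hh hη
  -- the coordinate domain
  let R : Set (ℝ × ℝ) := Metric.ball (t₀, 0) κ
  have hR : ∀ x : ℝ × ℝ, x ∈ R ↔ |x.1 - t₀| < κ ∧ |x.2| < κ := fun x => by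
    simp [R, Metric.mem_ball, Prod.dist_eq, Real.dist_eq]
  have hRJ : ∀ x ∈ R, x.1 ∈ Set.Icc (t₀ - η) (t₀ + η) := fun x hx => by
    have h1 := abs_lt.1 ((hR x).1 hx).1
    have h2 : κ ≤ η := min_le_right _ _
    constructor <;> linarith
  have hRoff : ∀ x ∈ R, x.2 ≠ 0 → flat γ c x ∉ Set.range γ := by
    rintro x hx hx0 ⟨t, ht⟩
    have hb : flat γ c x ∈ Metric.ball (γ t₀) ρ :=
      hball (Metric.ball_subset_ball (min_le_left _ _) hx)
    by_cases htJ : t ∈ Set.Icc (t₀ - η) (t₀ + η)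
    · have h1 : (γ t - γ x.1) / c₀ = x.2 * Complex.I := by
        rw [ht, flat, hc]; field_simp; ring
      have h2 := hlin t htJ x.1 (hRJ x hx)
      rw [h1] at h2
      have h3 := (Complex.abs_re_le_norm _).trans h2
      have h4 := (Complex.abs_im_le_norm _).trans h2
      simp only [Complex.sub_re, Complex.mul_re, Complex.ofReal_re, Complex.I_re, mul_zero,
        Complex.ofReal_im, Complex.I_im, mul_one, zero_sub, abs_neg, sub_zero, Complex.sub_im,
        Complex.mul_im, add_zero] at h3 h4
      have h5 := abs_nonneg (t - x.1)
      exact hx0 (abs_nonpos_iff.1 (by linarith))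
    · have h1 := hfar t htJ
      rw [ht] at h1
      rw [Metric.mem_ball, dist_eq_norm] at hb
      linarith
  have hRconv : ∀ x ∈ R, ∀ x' ∈ R, ∀ s ∈ Set.uIcc x.1 x'.1, ∀ u ∈ Set.uIcc 0 x.2, (s, u) ∈ R := by
    intro x hx x' hx' s hs u hu
    rw [hR] at hx hx' ⊢
    have h1 := abs_lt.1 hx.1
    have h2 := abs_lt.1 hx'.1
    have h3 := abs_lt.1 hx.2
    rw [Set.mem_uIcc] at hs hu
    constructor
    · rw [abs_lt]
      rcases hs with hs | hs <;> constructor <;> dsimp only <;> linarith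
    · rw [abs_lt]
      rcases hu with hu | hu <;> constructor <;> dsimp only <;> linarith
  -- the coordinates are bi-Lipschitz
  have hγlip : ∀ s ∈ Set.Icc (t₀ - η) (t₀ + η), ∀ p ∈ Set.Icc (t₀ - η) (t₀ + η),
      ‖γ s - γ p‖ ≤ 5 / 4 * ‖c₀‖ * |s - p| := by
    intro s hs p hp
    have h1 := hlin s hs p hp
    have h2 : ‖(γ s - γ p) / c₀‖ ≤ 5 / 4 * |s - p| := by
      have := norm_add_le ((γ s - γ p) / c₀ - (s - p : ℝ)) ((s - p : ℝ) : ℂ)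
      rw [sub_add_cancel, Complex.norm_real, Real.norm_eq_abs] at this
      linarith
    rw [norm_div, div_le_iff₀ hn0] at h2
    linarith
  have hlow : ∀ x ∈ R, ∀ x' ∈ R,
      |x'.1 - x.1| * ‖c₀‖ ≤ 2 * ‖flat γ c x' - flat γ c x‖ ∧
      |x'.2 - x.2| * ‖c₀‖ ≤ 4 * ‖flat γ c x' - flat γ c x‖ := by
    intro x hx x' hx'
    have h1 := hlin x'.1 (hRJ x' hx') x.1 (hRJ x hx)
    have h2 := (Complex.abs_re_le_norm _).trans h1
    have h3 : (γ x'.1 - γ x.1) / c₀ =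
        (flat γ c x' - flat γ c x) / c₀ - (x'.2 - x.2 : ℝ) * Complex.I := by
      simp only [flat, hc]; field_simp; push_cast; ring
    have h4 := (Complex.abs_re_le_norm ((flat γ c x' - flat γ c x) / c₀))
    rw [norm_div] at h4
    have h5 : |x'.1 - x.1| ≤ 2 * (‖flat γ c x' - flat γ c x‖ / ‖c₀‖) := by
      rw [h3] at h2
      simp only [Complex.sub_re, Complex.mul_re, Complex.ofReal_re, Complex.I_re, mul_zero,
        Complex.ofReal_im, Complex.I_im, mul_one, sub_self, sub_zero] at h2
      have := abs_sub_abs_le_abs_sub (x'.1 - x.1) (((flat γ c x' - flat γ c x) / c₀).re)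
      rw [abs_sub_comm (x'.1 - x.1)] at this
      have := abs_nonneg (x'.1 - x.1)
      linarith
    have h6 : |x'.1 - x.1| * ‖c₀‖ ≤ 2 * ‖flat γ c x' - flat γ c x‖ := by
      rwa [← mul_div_assoc, le_div_iff₀ hn0] at h5
    refine ⟨h6, ?_⟩
    have h7 : ((x'.2 - x.2 : ℝ) : ℂ) * c = (flat γ c x' - flat γ c x) - (γ x'.1 - γ x.1) := by
      simp only [flat]; push_cast; ring
    have h8 := congrArg norm h7
    rw [norm_mul, Complex.norm_real, Real.norm_eq_abs, hnc] at h8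
    have h9 := hγlip x'.1 (hRJ x' hx') x.1 (hRJ x hx)
    have h10 := norm_sub_le (flat γ c x' - flat γ c x) (γ x'.1 - γ x.1)
    have := norm_nonneg (flat γ c x' - flat γ c x)
    linarith
  -- the coordinates cover a neighbourhood
  have hopen : flat γ c '' R ∈ 𝓝 (γ t₀) := by
    have hsmooth : ContDiff ℝ 1 (flat γ c) := by
      have := hγ.smooth.of_le (show (1 : WithTop ℕ∞) ≤ 2 by norm_num)
      exact (this.comp contDiff_fst).add
        ((Complex.ofRealCLM.contDiff.comp contDiff_snd).mul contDiff_const)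
    have hmap := map_nhds_eq_of_conformal hsmooth.contDiffAt hc₀ (hasFDerivAt_flat hγ c (t₀, 0))
    rw [hflat0] at hmap
    rw [← hmap]
    exact image_mem_map (Metric.ball_mem_nhds _ hκ0)
  obtain ⟨δ, hδ, hδR⟩ := Metric.mem_nhds_iff.1 hopen
  -- Any right inverse of the coordinates will do: the lower Lipschitz bounds supply the control
  -- needed.
  choose! ψ hψR hψ using fun z (hz : z ∈ Metric.ball (γ t₀) δ) => hδR hz
  let F : ℂ → ℂ := fun z => flatPrimitive γ f c t₀ (ψ z)
  have hF : ∀ z ∈ Metric.ball (γ t₀) δ, HasDerivAt F (f z) z := by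
    intro z hz
    rw [hasDerivAt_iff_isLittleO, Asymptotics.isLittleO_iff]
    intro ε hε
    -- The two pieces have total weight at most `5 / 4 * 2 + 4 < 7`, and their points lie within `5
    -- * ‖w - z‖ < τ` of `z`.
    obtain ⟨τ, hτ, hτf⟩ := Metric.continuous_iff.1 hf z (ε / 7) (by positivity)
    filter_upwards [Metric.isOpen_ball.mem_nhds hz,
      Metric.ball_mem_nhds z (show 0 < τ / 9 by positivity)] with w hw hwτ
    have hx := hψR z hz
    have hx' := hψR w hw
    rw [Metric.mem_ball, dist_eq_norm] at hwτ
    have hl := hlow _ hx _ hx'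
    rw [hψ z hz, hψ w hw] at hl
    have hdz : f z = f (flat γ c (ψ z)) := by rw [hψ z hz]
    have e := flatPrimitive_sub (c := c) hγ hf t₀ (x := ψ z) (x' := ψ w)
      fun s hs u hu hu0 => hoff _ (hRoff _ (hRconv _ hx _ hx' s hs u hu) hu0)
    rw [hψ z hz, hψ w hw] at e
    rw [smul_eq_mul, mul_comm (w - z), e]
    have hsJ : ∀ s ∈ Set.uIcc (ψ z).1 (ψ w).1, s ∈ Set.Icc (t₀ - η) (t₀ + η) ∧
        |s - (ψ z).1| ≤ |(ψ w).1 - (ψ z).1| := fun s hs =>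
      ⟨Set.uIcc_subset_Icc (hRJ _ hx) (hRJ _ hx') hs, Set.abs_sub_left_of_mem_uIcc hs⟩
    have b1 : ‖∫ s in (ψ z).1..(ψ w).1, (f (flat γ c (s, (ψ z).2)) - f z) * deriv γ s‖ ≤
        ε / 7 * (5 / 4 * ‖c₀‖) * |(ψ w).1 - (ψ z).1| := by
      refine intervalIntegral.norm_integral_le_of_norm_le_const fun s hs => ?_
      obtain ⟨hs1, hs2⟩ := hsJ s (Set.uIoc_subset_uIcc hs)
      rw [norm_mul]
      refine mul_le_mul ?_ ?_ (norm_nonneg _) (by positivity)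
      · rw [← dist_eq_norm]
        refine (hτf _ ?_).le
        have h1 : flat γ c (s, (ψ z).2) - z = γ s - γ (ψ z).1 := by
          nth_rw 2 [← hψ z hz]; simp only [flat]; ring
        rw [dist_eq_norm, h1]
        calc _ ≤ 5 / 4 * ‖c₀‖ * |s - (ψ z).1| := hγlip s hs1 _ (hRJ _ hx)
          _ ≤ 5 / 4 * ‖c₀‖ * |(ψ w).1 - (ψ z).1| := by gcongr
          _ < τ := by linarith
      · have h1 := hder s hs1
        have h2 : ‖deriv γ s / c₀‖ ≤ 5 / 4 := by
          have := norm_add_le (deriv γ s / c₀ - 1) 1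
          rw [sub_add_cancel, norm_one] at this
          linarith
        rwa [norm_div, div_le_iff₀ hn0] at h2
    have b2 : ‖∫ u in (ψ z).2..(ψ w).2, (f (flat γ c ((ψ w).1, u)) - f z) * c‖ ≤
        ε / 7 * ‖c₀‖ * |(ψ w).2 - (ψ z).2| := by
      refine intervalIntegral.norm_integral_le_of_norm_le_const fun u hu => ?_
      have hu2 := Set.abs_sub_right_of_mem_uIcc (Set.uIoc_subset_uIcc hu)
      rw [norm_mul, hnc]
      gcongr
      rw [← dist_eq_norm]
      refine (hτf _ ?_).le
      have h1 : flat γ c ((ψ w).1, u) - z = (w - z) - (((ψ w).2 - u : ℝ) : ℂ) * c := by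
        nth_rw 2 [← hψ w hw]; simp only [flat]; push_cast; ring
      rw [dist_eq_norm, h1]
      calc _ ≤ ‖w - z‖ + ‖(((ψ w).2 - u : ℝ) : ℂ) * c‖ := norm_sub_le _ _
        _ = ‖w - z‖ + |(ψ w).2 - u| * ‖c₀‖ := by
          rw [norm_mul, Complex.norm_real, Real.norm_eq_abs, hnc]
        _ ≤ ‖w - z‖ + |(ψ w).2 - (ψ z).2| * ‖c₀‖ := by gcongr
        _ < τ := by linarith
    refine (norm_add_le _ _).trans ((add_le_add b1 b2).trans ?_)
    calc _ = ε / 7 * (5 / 4 * (|(ψ w).1 - (ψ z).1| * ‖c₀‖) + |(ψ w).2 - (ψ z).2| * ‖c₀‖) := by ring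
      _ ≤ ε / 7 * (5 / 4 * (2 * ‖w - z‖) + 4 * ‖w - z‖) :=
        mul_le_mul_of_nonneg_left (by linarith [hl.1, hl.2]) (by positivity)
      _ ≤ ε * ‖w - z‖ := by nlinarith [norm_nonneg (w - z)]
  have hFd : DifferentiableOn ℂ F (Metric.ball (γ t₀) δ) := fun z hz =>
    (hF z hz).differentiableAt.differentiableWithinAt
  -- Morera's argument: `f` is the derivative of a holomorphic function.
  have h1 := (hFd.deriv Metric.isOpen_ball).congr fun z hz => (hF z hz).deriv.symm
  exact h1.differentiableAt (Metric.ball_mem_nhds _ hδ)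

end ConstantJump

namespace ConstantJump

/-! ### Holomorphic matrix functions -/

section MatrixCalculus

variable {m : Type*} {s : Set ℂ} {F G : ℂ → Matrix m m ℂ}

lemma isEntire_iff : IsEntire F ↔ IsHolomorphicOn F Set.univ := by
  simp [IsEntire, IsHolomorphicOn, differentiableOn_univ]

lemma IsEntire.isHolomorphicOn (h : IsEntire F) (s : Set ℂ) : IsHolomorphicOn F s :=
  fun i j => (h i j).differentiableOn

lemma IsHolomorphicOn.congr (h : IsHolomorphicOn F s) (hFG : Set.EqOn G F s) :
    IsHolomorphicOn G s := fun i j => (h i j).congr fun z hz => by simp only [hFG hz]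

lemma isHolomorphicOn_const (A : Matrix m m ℂ) : IsHolomorphicOn (fun _ => A) s :=
  fun _ _ => differentiableOn_const _

lemma IsHolomorphicOn.add (hF : IsHolomorphicOn F s) (hG : IsHolomorphicOn G s) :
    IsHolomorphicOn (fun z => F z + G z) s := fun i j => (hF i j).add (hG i j)

lemma IsHolomorphicOn.sub (hF : IsHolomorphicOn F s) (hG : IsHolomorphicOn G s) :
    IsHolomorphicOn (fun z => F z - G z) s := fun i j => (hF i j).sub (hG i j)

lemma IsHolomorphicOn.neg (hF : IsHolomorphicOn F s) :
    IsHolomorphicOn (fun z => -F z) s := fun i j => (hF i j).neg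

lemma IsHolomorphicOn.transpose (hF : IsHolomorphicOn F s) :
    IsHolomorphicOn (fun z => (F z).transpose) s := fun i j => hF j i

lemma IsHolomorphicOn.mul [Fintype m] (hF : IsHolomorphicOn F s) (hG : IsHolomorphicOn G s) :
    IsHolomorphicOn (fun z => F z * G z) s := fun i j => by
  simp only [Matrix.mul_apply]
  exact DifferentiableOn.fun_sum fun l _ => (hF i l).mul (hG l j)

lemma IsHolomorphicOn.fromBlocks {N : ℕ} {A B C D : ℂ → Mat N} (hA : IsHolomorphicOn A s)
    (hB : IsHolomorphicOn B s) (hC : IsHolomorphicOn C s) (hD : IsHolomorphicOn D s) :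
    IsHolomorphicOn (fun z => Matrix.fromBlocks (A z) (B z) (C z) (D z)) s := by
  rintro (i | i) (j | j)
  exacts [hA i j, hB i j, hC i j, hD i j]

lemma IsHolomorphicOn.det [Fintype m] [DecidableEq m] (hF : IsHolomorphicOn F s) :
    DifferentiableOn ℂ (fun z => (F z).det) s := by
  simp only [Matrix.det_apply']
  exact DifferentiableOn.fun_sum fun σ _ =>
    (DifferentiableOn.fun_finsetProd fun i _ => hF _ _).const_mul _

lemma IsHolomorphicOn.inv [Fintype m] [DecidableEq m] (hF : IsHolomorphicOn F s)
    (hu : ∀ z ∈ s, IsUnit (F z)) : IsHolomorphicOn (fun z => (F z)⁻¹) s := by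
  intro i j
  have hdet : ∀ z ∈ s, (F z).det ≠ 0 := fun z hz =>
    isUnit_iff_ne_zero.1 ((Matrix.isUnit_iff_isUnit_det _).1 (hu z hz))
  have hadj : DifferentiableOn ℂ (fun z => (F z).adjugate i j) s := by
    simp only [Matrix.adjugate_apply]
    refine IsHolomorphicOn.det (F := fun z => (F z).updateRow j (Pi.single i 1)) fun a b => ?_
    by_cases h : a = j
    · subst h
      simp only [Matrix.updateRow_self]
      exact differentiableOn_const _
    · simp only [Matrix.updateRow_ne h]
      exact hF a b
  simp only [Matrix.inv_def, Matrix.smul_apply, Ring.inverse_eq_inv', smul_eq_mul]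
  exact (hF.det.inv hdet).mul hadj

lemma IsHolomorphicOn.continuousAt (hF : IsHolomorphicOn F s) {z : ℂ} (hz : s ∈ 𝓝 z) :
    ContinuousAt F z :=
  continuousAt_pi.2 fun i => continuousAt_pi.2 fun j =>
    ((hF i j).differentiableAt hz).continuousAt

lemma IsHolomorphicOn.matDeriv (hF : IsHolomorphicOn F s) (hs : IsOpen s) :
    IsHolomorphicOn (ConstantJump.matDeriv F) s := fun i j => by
  simpa [ConstantJump.matDeriv] using (hF i j).deriv hs

lemma matDeriv_congr (hs : IsOpen s) (h : Set.EqOn F G s) {z : ℂ} (hz : z ∈ s) :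
    matDeriv F z = matDeriv G z := by
  ext i j
  refine Filter.EventuallyEq.deriv_eq ?_
  filter_upwards [hs.mem_nhds hz] with w hw
  rw [h hw]

lemma matDeriv_mul [Fintype m] (hF : IsHolomorphicOn F s) (hG : IsHolomorphicOn G s)
    (hs : IsOpen s) {z : ℂ} (hz : z ∈ s) :
    matDeriv (fun w => F w * G w) z = matDeriv F z * G z + F z * matDeriv G z := by
  ext i j
  have hF' i j := (hF i j).differentiableAt (hs.mem_nhds hz)
  have hG' i j := (hG i j).differentiableAt (hs.mem_nhds hz)
  simp only [matDeriv, Matrix.of_apply, Matrix.mul_apply, Matrix.add_apply]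
  rw [deriv_fun_sum fun l _ => (hF' i l).fun_mul (hG' l j), ← Finset.sum_add_distrib]
  exact Finset.sum_congr rfl fun l _ => deriv_fun_mul (hF' i l) (hG' l j)

lemma matDeriv_fromBlocks {N : ℕ} (A B C D : ℂ → Mat N) (z : ℂ) :
    matDeriv (fun z => Matrix.fromBlocks (A z) (B z) (C z) (D z)) z =
      Matrix.fromBlocks (matDeriv A z) (matDeriv B z) (matDeriv C z) (matDeriv D z) := by
  ext (i | i) (j | j) <;> rfl

lemma matDeriv_const (A : Matrix m m ℂ) (z : ℂ) : matDeriv (fun _ => A) z = 0 := by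
  ext i j
  simp [matDeriv]

lemma matDeriv_inv [Fintype m] [DecidableEq m] (hF : IsHolomorphicOn F s) (hs : IsOpen s)
    (hu : ∀ z ∈ s, IsUnit (F z)) {z : ℂ} (hz : z ∈ s) :
    matDeriv (fun w => (F w)⁻¹) z = -((F z)⁻¹ * matDeriv F z) * (F z)⁻¹ := by
  have hdet w hw := (Matrix.isUnit_iff_isUnit_det _).1 (hu w hw)
  have h1 := matDeriv_mul (hF.inv hu) hF hs hz
  rw [matDeriv_congr (G := fun _ => 1) hs (fun w hw => Matrix.nonsing_inv_mul _ (hdet w hw)) hz,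
    matDeriv_const] at h1
  have h2 := eq_neg_of_add_eq_zero_left h1.symm
  rw [← h2, Matrix.mul_assoc, Matrix.mul_nonsing_inv _ (hdet z hz), Matrix.mul_one]

end MatrixCalculus

/-! ### Entire extension across the curve -/

/-- A function off the curve which extends holomorphically across every point of the curve is the
restriction of an entire function. -/
lemma IsSmoothCurve.exists_entire_extension {γ : ℝ → ℂ} (hγ : IsSmoothCurve γ) {h : ℂ → ℂ}
    (hd : DifferentiableOn ℂ h (Set.range γ)ᶜ)
    (hloc : ∀ t, ∃ ρ > 0, ∃ g : ℂ → ℂ, DifferentiableOn ℂ g (Metric.ball (γ t) ρ) ∧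
      ∀ z ∈ Metric.ball (γ t) ρ, z ∉ Set.range γ → h z = g z) :
    ∃ H : ℂ → ℂ, Differentiable ℂ H ∧ ∀ z ∉ Set.range γ, H z = h z := by
  have hext := extendFrom_extends hd.continuousOn
  refine ⟨extendFrom (Set.range γ)ᶜ h, fun z => ?_, hext⟩
  by_cases hz : z ∈ Set.range γ
  · obtain ⟨t, rfl⟩ := hz
    obtain ⟨ρ, hρ, g, hg, hgh⟩ := hloc t
    refine (hg.congr fun z hz => ?_).differentiableAt (Metric.ball_mem_nhds _ hρ)
    refine extendFrom_eq (hγ.dense_compl z) ?_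
    have hball := Metric.isOpen_ball.mem_nhds hz
    refine ((hg.differentiableAt hball).continuousAt.tendsto.mono_left nhdsWithin_le_nhds).congr' ?_
    filter_upwards [mem_nhdsWithin_of_mem_nhds hball, self_mem_nhdsWithin] with w hw hwr
    exact (hgh w hw hwr).symm
  · have hopen := hγ.isClosed_range.isOpen_compl
    exact (hd.congr fun z hz => hext z hz).differentiableAt (hopen.mem_nhds hz)

/-! ### Boundary values of the Cauchy transform of the weight -/

section Weight

variable {N : ℕ} {γ : ℝ → ℂ} {W WL WR : ℂ → Mat N}

lemma isHolomorphicOn_cauchyMoment (hγ : IsSmoothCurve γ) (hmom : HasFiniteMoments γ W) (k : ℕ) :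
    IsHolomorphicOn (fun z => cauchyMoment γ W z k) (Set.range γ)ᶜ := by
  intro i j
  have h := differentiableOn_cauchy (U := (Set.range γ)ᶜ) hγ.smooth.continuous MeasurableSet.univ
    (hmom k i j).integrableOn fun z hz => by
      refine ⟨Metric.infDist z (Set.range γ) / 2, half_pos (hγ.infDist_pos hz), fun w hw t _ => ?_⟩
      have h1 := Metric.infDist_le_dist_of_mem (x := z) (Set.mem_range_self (f := γ) t)
      have h2 := dist_triangle z w (γ t)
      rw [Metric.mem_ball, dist_comm] at hw
      rw [← dist_eq_norm, dist_comm]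
      linarith
  simp only [Measure.restrict_univ] at h
  simpa [cauchyMoment, curveInt, mul_assoc] using h.const_mul (2 * Real.pi * Complex.I)⁻¹

/-- The two sides in `exists_sides` are fixed before the entire density is chosen, so they serve all
matrix entries at once. -/
lemma exists_sides_cauchyMoment (hγ : IsSmoothCurve γ) (hmom : HasFiniteMoments γ W)
    (hfac : ∀ z ∈ Set.range γ, W z = WL z * WR z) (hWL : IsEntire WL) (hWR : IsEntire WR)
    (t₀ : ℝ) :
    ∃ ρ > 0, ∃ Up Um : Set ℂ, IsOpen Up ∧ IsOpen Um ∧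
      (∀ z ∈ Metric.ball (γ t₀) ρ, z ∉ Set.range γ ↔ z ∈ Up ∨ z ∈ Um) ∧
      (∀ᶠ p in 𝓝 t₀ ×ˢ 𝓝[>] 0, normalPoint γ p ∈ Up) ∧
      (∀ᶠ p in 𝓝 t₀ ×ˢ 𝓝[<] 0, normalPoint γ p ∈ Um) ∧
      ∃ Ap Am : ℂ → Mat N, IsHolomorphicOn Ap (Metric.ball (γ t₀) ρ) ∧
        IsHolomorphicOn Am (Metric.ball (γ t₀) ρ) ∧
        (∀ z ∈ Metric.ball (γ t₀) ρ, Ap z - Am z = WL z * WR z) ∧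
        (∀ z ∈ Metric.ball (γ t₀) ρ, z ∈ Up → cauchyMoment γ W z 0 = Ap z) ∧
        (∀ z ∈ Metric.ball (γ t₀) ρ, z ∈ Um → cauchyMoment γ W z 0 = Am z) := by
  obtain ⟨ρ, hρ, Up, Um, hUp, hUm, hside, hp, hm, h⟩ := hγ.exists_sides t₀
  refine ⟨ρ, hρ, Up, Um, hUp, hUm, hside, hp, hm, ?_⟩
  have hW : IsEntire fun z => WL z * WR z :=
    isEntire_iff.2 ((isEntire_iff.1 hWL).mul (isEntire_iff.1 hWR))
  have hint (i j) : Integrable fun t => (WL (γ t) * WR (γ t)) i j * deriv γ t := by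
    have := hmom 0 i j
    simp only [pow_zero, one_mul] at this
    simpa only [hfac _ (Set.mem_range_self _)] using this
  choose qp qm h1 h2 h3 h4 h5 using fun i j => h _ (hW i j) (hint i j)
  have hA (z i j) : cauchyMoment γ W z 0 i j = (2 * Real.pi * Complex.I)⁻¹ *
      ∫ t, (γ t - z)⁻¹ * ((WL (γ t) * WR (γ t)) i j * deriv γ t) := by
    simp [cauchyMoment, curveInt, hfac _ (Set.mem_range_self _), mul_assoc]
  refine ⟨fun z => Matrix.of fun i j => (2 * Real.pi * Complex.I)⁻¹ * qp i j z,
    fun z => Matrix.of fun i j => (2 * Real.pi * Complex.I)⁻¹ * qm i j z,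
    fun i j => (h1 i j).const_mul _, fun i j => (h2 i j).const_mul _, fun z hz => ?_,
    fun z hz hzU => ?_, fun z hz hzU => ?_⟩
  · ext i j
    simp only [Matrix.sub_apply, Matrix.of_apply]
    rw [← mul_sub, h3 i j z hz, inv_mul_cancel_left₀ Complex.two_pi_I_ne_zero]
  · ext i j
    rw [hA, h4 i j z hz hzU]; rfl
  · ext i j
    rw [hA, h5 i j z hz hzU]; rfl

/-! ### Factorization of the fundamental matrices -/

/-- The inverse of the left transfer matrix. -/
noncomputable def transferLInv (PL : ℕ → (Mat N)[X]) (C : ℕ → Mat N) (n : ℕ) (z : ℂ) : Mat2 N :=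
  Matrix.fromBlocks 0 (-(C n)⁻¹) (C n) (C n * (z • (1 : Mat N) - betaL PL n) * (C n)⁻¹)

lemma transferL_mul_inv (PL : ℕ → (Mat N)[X]) {C : ℕ → Mat N} {n : ℕ} (hC : IsUnit (C n))
    (z : ℂ) : transferL PL C n z * transferLInv PL C n z = 1 := by
  have h := (Matrix.isUnit_iff_isUnit_det _).1 hC
  rw [transferL, transferLInv, Matrix.fromBlocks_multiply, ← Matrix.fromBlocks_one]
  congr 1
  · rw [Matrix.mul_zero, zero_add, Matrix.nonsing_inv_mul _ h]
  · rw [Matrix.mul_assoc, Matrix.nonsing_inv_mul_cancel_left _ _ h]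
    simp
  · simp
  · rw [Matrix.zero_mul, add_zero, neg_mul_neg, Matrix.mul_nonsing_inv _ h]

lemma transferLInv_mul (PL : ℕ → (Mat N)[X]) {C : ℕ → Mat N} {n : ℕ} (hC : IsUnit (C n))
    (z : ℂ) : transferLInv PL C n z * transferL PL C n z = 1 :=
  mul_eq_one_comm.1 (transferL_mul_inv PL hC z)

lemma isHolomorphicOn_smul_one (s : Set ℂ) :
    IsHolomorphicOn (fun z : ℂ => z • (1 : Mat N)) s := fun i j => by
  simp only [Matrix.smul_apply, smul_eq_mul]
  exact differentiableOn_id.mul_const _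

lemma isHolomorphicOn_transferL (PL : ℕ → (Mat N)[X]) (C : ℕ → Mat N) (n : ℕ) (s : Set ℂ) :
    IsHolomorphicOn (transferL PL C n) s :=
  ((isHolomorphicOn_smul_one s).sub (isHolomorphicOn_const _)).fromBlocks
    (isHolomorphicOn_const _) (isHolomorphicOn_const _) (isHolomorphicOn_const _)

lemma isHolomorphicOn_transferLInv (PL : ℕ → (Mat N)[X]) (C : ℕ → Mat N) (n : ℕ) (s : Set ℂ) :
    IsHolomorphicOn (transferLInv PL C n) s :=
  (isHolomorphicOn_const _).fromBlocks (isHolomorphicOn_const _) (isHolomorphicOn_const _)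
    (((isHolomorphicOn_const _).mul
      ((isHolomorphicOn_smul_one s).sub (isHolomorphicOn_const _))).mul (isHolomorphicOn_const _))

lemma matDeriv_transferL (PL : ℕ → (Mat N)[X]) (C : ℕ → Mat N) (n : ℕ) (z : ℂ) :
    matDeriv (transferL PL C n) z = proj N := by
  unfold transferL
  rw [matDeriv_fromBlocks, matDeriv_const, matDeriv_const, matDeriv_const, proj]
  congr 1
  ext i j
  simp [matDeriv, Matrix.sub_apply]

/-- The product of the first transfer matrices. -/
noncomputable def transferProd (PL : ℕ → (Mat N)[X]) (C : ℕ → Mat N) : ℕ → ℂ → Mat2 N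
  | 0, _ => 1
  | n + 1, z => transferL PL C n z * transferProd PL C n z

lemma isHolomorphicOn_transferProd (PL : ℕ → (Mat N)[X]) (C : ℕ → Mat N) (n : ℕ) (s : Set ℂ) :
    IsHolomorphicOn (transferProd PL C n) s := by
  induction n with
  | zero => exact isHolomorphicOn_const 1
  | succ n ih => exact (isHolomorphicOn_transferL PL C n s).mul ih

lemma isUnit_transferProd (PL : ℕ → (Mat N)[X]) {C : ℕ → Mat N} (hC : ∀ n, IsUnit (C n)) (n : ℕ)
    (z : ℂ) : IsUnit (transferProd PL C n z) := by
  induction n with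
  | zero => exact isUnit_one
  | succ n ih =>
    exact (IsUnit.of_mul_eq_one _ (transferL_mul_inv PL (hC n) z)).mul ih

/-- The matrix `[[W^L, A (W^R)⁻¹], [0, (W^R)⁻¹]]`. -/
noncomputable def upperMat (WL WR A : ℂ → Mat N) (z : ℂ) : Mat2 N :=
  Matrix.fromBlocks (WL z) (A z * (WR z)⁻¹) 0 (WR z)⁻¹

lemma isHolomorphicOn_upperMat {A : ℂ → Mat N} {s : Set ℂ} (hWL : IsEntire WL) (hWR : IsEntire WR)
    (hWRu : ∀ z, IsUnit (WR z)) (hA : IsHolomorphicOn A s) :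
    IsHolomorphicOn (upperMat WL WR A) s :=
  have h := (hWR.isHolomorphicOn s).inv fun z _ => hWRu z
  (hWL.isHolomorphicOn s).fromBlocks (hA.mul h) (isHolomorphicOn_const _) h

lemma isUnit_upperMat (A : ℂ → Mat N) {z : ℂ} (hWLu : IsUnit (WL z)) (hWRu : IsUnit (WR z)) :
    IsUnit (upperMat WL WR A z) := by
  rw [Matrix.isUnit_iff_isUnit_det, upperMat, Matrix.det_fromBlocks_zero₂₁]
  exact ((Matrix.isUnit_iff_isUnit_det _).1 hWLu).mul
    ((Matrix.isUnit_iff_isUnit_det _).1 (Matrix.isUnit_nonsing_inv_iff.2 hWRu))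

/-- The jump `WL * WR` of `A`, multiplied by `(WR z)⁻¹`, is exactly the first column block. -/
lemma upperMat_jump {Ap Am : ℂ → Mat N} {z : ℂ} (hWRu : IsUnit (WR z))
    (h : Ap z - Am z = WL z * WR z) :
    upperMat WL WR Ap z = upperMat WL WR Am z * Matrix.fromBlocks 1 1 0 1 := by
  have hu := (Matrix.isUnit_iff_isUnit_det _).1 hWRu
  have h1 : Ap z = WL z * WR z + Am z := by rw [← h, sub_add_cancel]
  simp only [upperMat, Matrix.fromBlocks_multiply, h1, Matrix.add_mul,
    Matrix.mul_nonsing_inv_cancel_right _ _ hu]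
  simp

variable {PL PR : ℕ → (Mat N)[X]} {C : ℕ → Mat N}

lemma constJumpL_zero (hγ : IsSmoothCurve γ) (hmom : HasFiniteMoments γ W)
    (h : IsOrthogonal γ W PL PR C) {z : ℂ} (hz : z ∉ Set.range γ) :
    constJumpL γ W WL WR PL C 0 z = upperMat WL WR (fun z => cauchyMoment γ W z 0) z := by
  have hb := h.isBiorthogonal hmom
  rw [constJumpL, fundL, hb.PL_zero, secondKindL_eq hmom hγ hz, upperMat,
    Matrix.fromBlocks_multiply, momL_eq_sum _ (m := 1) (by simp), evalAt]
  simp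

/-- The index enters only through a left factor without jump, so everything local at the curve
reduces to index zero. -/
lemma constJumpL_eq (hγ : IsSmoothCurve γ) (hmom : HasFiniteMoments γ W)
    (h : IsOrthogonal γ W PL PR C) (n : ℕ) {z : ℂ} (hz : z ∉ Set.range γ) :
    constJumpL γ W WL WR PL C n z =
      transferProd PL C n z * upperMat WL WR (fun z => cauchyMoment γ W z 0) z := by
  induction n with
  | zero => rw [constJumpL_zero hγ hmom h hz, transferProd, Matrix.one_mul]
  | succ n ih =>
    rw [← transferL_mul_constJumpL WL WR hγ hmom h n hz, ih, transferProd, Matrix.mul_assoc]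

lemma isHolomorphicOn_constJumpL (hγ : IsSmoothCurve γ) (hmom : HasFiniteMoments γ W)
    (h : IsOrthogonal γ W PL PR C) (hWL : IsEntire WL) (hWR : IsEntire WR)
    (hWRu : ∀ z, IsUnit (WR z)) (n : ℕ) :
    IsHolomorphicOn (constJumpL γ W WL WR PL C n) (Set.range γ)ᶜ :=
  ((isHolomorphicOn_transferProd PL C n _).mul (isHolomorphicOn_upperMat hWL hWR hWRu
    (isHolomorphicOn_cauchyMoment hγ hmom 0))).congr fun _ hz => constJumpL_eq hγ hmom h n hz

lemma isUnit_constJumpL (hγ : IsSmoothCurve γ) (hmom : HasFiniteMoments γ W)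
    (h : IsOrthogonal γ W PL PR C) (hWLu : ∀ z, IsUnit (WL z))
    (hWRu : ∀ z, IsUnit (WR z)) (n : ℕ) {z : ℂ} (hz : z ∉ Set.range γ) :
    IsUnit (constJumpL γ W WL WR PL C n z) := by
  rw [constJumpL_eq hγ hmom h n hz]
  exact (isUnit_transferProd PL h.nonsingular n z).mul (isUnit_upperMat _ (hWLu z) (hWRu z))

/-- Both boundary values exist, are invertible, and satisfy the constant jump condition. Only the
values off the curve matter. -/
lemma exists_boundary_values (hγ : IsSmoothCurve γ) (hmom : HasFiniteMoments γ W)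
    (hfac : ∀ z ∈ Set.range γ, W z = WL z * WR z)
    (h : IsOrthogonal γ W PL PR C) (hWL : IsEntire WL) (hWR : IsEntire WR)
    (hWLu : ∀ z, IsUnit (WL z)) (hWRu : ∀ z, IsUnit (WR z)) (n : ℕ) {Z : ℂ → Mat2 N}
    (hZ : Set.EqOn Z (constJumpL γ W WL WR PL C n) (Set.range γ)ᶜ) (t : ℝ) :
    ∃ Zp Zm : Mat2 N, HasPlusValue γ Z t Zp ∧ HasMinusValue γ Z t Zm ∧
      Zp = Zm * Matrix.fromBlocks 1 1 0 1 ∧ IsUnit Zm := by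
  obtain ⟨ρ, hρ, Up, Um, -, -, hside, hp, hm, Ap, Am, hAp, hAm, hjump, hup, hum⟩ :=
    exists_sides_cauchyMoment hγ hmom hfac hWL hWR t
  have hball := Metric.ball_mem_nhds (γ t) hρ
  -- On either side `Z` coincides with a function holomorphic on the full disc, whose value at `γ t`
  -- is the boundary value.
  have key : ∀ {A : ℂ → Mat N} {U : Set ℂ} {l : Filter (ℝ × ℝ)},
      IsHolomorphicOn A (Metric.ball (γ t) ρ) → (∀ z ∈ U, z ∈ Up ∨ z ∈ Um) →
      (∀ z ∈ Metric.ball (γ t) ρ, z ∈ U → cauchyMoment γ W z 0 = A z) →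
      (∀ᶠ p in l, normalPoint γ p ∈ U) → Tendsto (normalPoint γ) l (𝓝 (γ t)) →
      Tendsto (fun p => Z (normalPoint γ p)) l
        (𝓝 (transferProd PL C n (γ t) * upperMat WL WR A (γ t))) := by
    intro A U l hA hU hAU hl hlim
    have hhol := (isHolomorphicOn_transferProd PL C n _).mul
      (isHolomorphicOn_upperMat hWL hWR hWRu hA)
    refine ((hhol.continuousAt hball).tendsto.comp hlim).congr' ?_
    filter_upwards [hl, hlim hball] with p hpU hpb
    have hr := (hside _ hpb).2 (hU _ hpU)
    rw [hZ hr, constJumpL_eq hγ hmom h n hr]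
    simp only [Function.comp, upperMat, hAU _ hpb hpU]
  refine ⟨_, _, key hAp (fun z hz => Or.inl hz) hup hp (hγ.tendsto_normalPoint t _),
    key hAm (fun z hz => Or.inr hz) hum hm (hγ.tendsto_normalPoint t _), ?_, ?_⟩
  · rw [Matrix.mul_assoc, ← upperMat_jump (hWRu _) (hjump _ (Metric.mem_ball_self hρ))]
  · exact (isUnit_transferProd PL h.nonsingular n _).mul (isUnit_upperMat _ (hWLu _) (hWRu _))

/-! ### Structure matrices -/

/-- The structure matrix of index zero extends to an entire function. -/
lemma exists_entire_structure_zero (hγ : IsSmoothCurve γ) (hmom : HasFiniteMoments γ W)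
    (hfac : ∀ z ∈ Set.range γ, W z = WL z * WR z)
    (h : IsOrthogonal γ W PL PR C) (hWL : IsEntire WL) (hWR : IsEntire WR)
    (hWLu : ∀ z, IsUnit (WL z)) (hWRu : ∀ z, IsUnit (WR z)) :
    ∃ M : ℂ → Mat2 N, IsEntire M ∧ ∀ z ∉ Set.range γ,
      M z * constJumpL γ W WL WR PL C 0 z = matDeriv (constJumpL γ W WL WR PL C 0) z := by
  let a : ℂ → Mat N := fun z => matDeriv WL z * (WL z)⁻¹
  let b : ℂ → Mat N := fun z => -((WR z)⁻¹ * matDeriv WR z)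
  have ha (s) (hs : IsOpen s) : IsHolomorphicOn a s :=
    ((hWL.isHolomorphicOn s).matDeriv hs).mul ((hWL.isHolomorphicOn s).inv fun z _ => hWLu z)
  have hb (s) (hs : IsOpen s) : IsHolomorphicOn b s :=
    (((hWR.isHolomorphicOn s).inv fun z _ => hWRu z).mul
      ((hWR.isHolomorphicOn s).matDeriv hs)).neg
  -- The upper right block of the structure matrix; `a` and `b` are its diagonal blocks.
  let S : (ℂ → Mat N) → ℂ → Mat N := fun A z => matDeriv A z + A z * b z - a z * A z
  have hS {A : ℂ → Mat N} {s : Set ℂ} (hs : IsOpen s) (hA : IsHolomorphicOn A s) :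
      IsHolomorphicOn (S A) s :=
    ((hA.matDeriv hs).add (hA.mul (hb s hs))).sub ((ha s hs).mul hA)
  have hcongr {A B : ℂ → Mat N} {s : Set ℂ} (hs : IsOpen s) (hAB : Set.EqOn A B s) {z : ℂ}
      (hz : z ∈ s) : S A z = S B z := by
    simp only [S, matDeriv_congr hs hAB hz, hAB hz]
  have hopen := hγ.isClosed_range.isOpen_compl
  let A : ℂ → Mat N := fun z => cauchyMoment γ W z 0
  have hA : IsHolomorphicOn A (Set.range γ)ᶜ := isHolomorphicOn_cauchyMoment hγ hmom 0
  have hloc : ∀ t, ∃ ρ > 0, ∃ G : ℂ → Mat N, IsHolomorphicOn G (Metric.ball (γ t) ρ) ∧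
      ∀ z ∈ Metric.ball (γ t) ρ, z ∉ Set.range γ → S A z = G z := by
    intro t
    obtain ⟨ρ, hρ, Up, Um, hUp, hUm, hside, -, -, Ap, Am, hAp, hAm, hjump, hup, hum⟩ :=
      exists_sides_cauchyMoment hγ hmom hfac hWL hWR t
    refine ⟨ρ, hρ, S Ap, hS Metric.isOpen_ball hAp, fun z hz hzr => ?_⟩
    -- The operator `S` annihilates `WL * WR`, since `(WL WR)' = a WL WR - WL WR b`. It therefore
    -- does not see the jump.
    have hSp : S Am z = S Ap z := by
      have hW := matDeriv_mul (hWL.isHolomorphicOn (Metric.ball (γ t) ρ))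
        (hWR.isHolomorphicOn _) Metric.isOpen_ball hz
      have hd : matDeriv Ap z = matDeriv Am z + matDeriv (fun w => WL w * WR w) z := by
        have e : Set.EqOn Ap (fun w => Am w + WL w * WR w) (Metric.ball (γ t) ρ) := fun w hw => by
          simp only [← hjump w hw, add_sub_cancel]
        rw [matDeriv_congr Metric.isOpen_ball e hz]
        ext i j
        simp only [matDeriv, Matrix.of_apply, Matrix.add_apply]
        exact deriv_fun_add ((hAm i j).differentiableAt (Metric.isOpen_ball.mem_nhds hz))
          ((((hWL.isHolomorphicOn _).mul (hWR.isHolomorphicOn _)) i j).differentiableAt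
            (Metric.isOpen_ball.mem_nhds hz))
      have hval : Ap z = Am z + WL z * WR z := by rw [← hjump z hz]; simp
      have uL := (Matrix.isUnit_iff_isUnit_det _).1 (hWLu z)
      have uR := (Matrix.isUnit_iff_isUnit_det _).1 (hWRu z)
      have e1 : WL z * WR z * b z = -(WL z * matDeriv WR z) := by
        simp only [b, Matrix.mul_neg]
        rw [Matrix.mul_assoc, Matrix.mul_nonsing_inv_cancel_left _ _ uR]
      have e2 : a z * (WL z * WR z) = matDeriv WL z * WR z := by
        simp only [a]
        rw [Matrix.mul_assoc, Matrix.nonsing_inv_mul_cancel_left _ _ uL]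
      simp only [S, hd, hW, hval, Matrix.add_mul, Matrix.mul_add, e1, e2]
      abel
    rcases (hside z hz).1 hzr with hzU | hzU
    · exact hcongr (Metric.isOpen_ball.inter hUp) (fun w hw => hup w hw.1 hw.2) ⟨hz, hzU⟩
    · rw [← hSp]
      exact hcongr (Metric.isOpen_ball.inter hUm) (fun w hw => hum w hw.1 hw.2) ⟨hz, hzU⟩
  have hSA := hS hopen hA
  choose E hE hEA using fun i j => hγ.exists_entire_extension (hSA i j) fun t => by
    obtain ⟨ρ, hρ, G, hG, hGS⟩ := hloc t
    exact ⟨ρ, hρ, fun z => G z i j, hG i j, fun z hz hzr => by rw [hGS z hz hzr]⟩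
  let E' : ℂ → Mat N := fun z => Matrix.of fun i j => E i j z
  have hE' : ∀ z ∉ Set.range γ, E' z = S A z := fun z hz => by
    ext i j
    exact hEA i j z hz
  refine ⟨fun z => Matrix.fromBlocks (a z) (E' z) 0 (b z), isEntire_iff.2
    ((ha _ isOpen_univ).fromBlocks (fun i j => (hE i j).differentiableOn)
      (isHolomorphicOn_const _) (hb _ isOpen_univ)), fun z hz => ?_⟩
  rw [matDeriv_congr hopen (fun w hw => constJumpL_zero hγ hmom h hw) hz,
    constJumpL_zero hγ hmom h hz]
  have uL := (Matrix.isUnit_iff_isUnit_det _).1 (hWLu z)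
  unfold upperMat
  rw [matDeriv_fromBlocks, matDeriv_const,
    matDeriv_mul hA ((hWR.isHolomorphicOn _).inv fun z _ => hWRu z) hopen hz,
    matDeriv_inv (hWR.isHolomorphicOn Set.univ) isOpen_univ (fun z _ => hWRu z) trivial,
    Matrix.fromBlocks_multiply, hE' z hz]
  congr 1
  · simp only [a, Matrix.mul_zero, add_zero]
    exact Matrix.nonsing_inv_mul_cancel_right _ _ uL
  · simp only [S, A, b, Matrix.add_mul, Matrix.sub_mul, Matrix.mul_assoc]
    abel
  · simp
  · simp [b]

end Weight

end ConstantJump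

/-! ### Structure matrices of all indices and behaviour at infinity. -/

namespace ConstantJump

section Weight

variable {N : ℕ} {γ : ℝ → ℂ} {W WL WR : ℂ → Mat N} {PL PR : ℕ → (Mat N)[X]} {C : ℕ → Mat N}

/-- The structure matrices exist as entire functions, and satisfy the zero curvature formulas. -/
lemma exists_structureL (hγ : IsSmoothCurve γ) (hmom : HasFiniteMoments γ W)
    (hfac : ∀ z ∈ Set.range γ, W z = WL z * WR z)
    (h : IsOrthogonal γ W PL PR C) (hWL : IsEntire WL) (hWR : IsEntire WR)
    (hWLu : ∀ z, IsUnit (WL z)) (hWRu : ∀ z, IsUnit (WR z)) :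
    ∃ M : ℕ → ℂ → Mat2 N, (∀ n, IsEntire (M n)) ∧
      (∀ n, ∀ z ∉ Set.range γ, M n z = rightLogDeriv (constJumpL γ W WL WR PL C n) z) ∧
      ∀ n z,
        proj N = M (n + 1) z * transferL PL C n z - transferL PL C n z * M n z ∧
        proj N * M n z + M (n + 1) z * proj N =
          M (n + 1) z ^ 2 * transferL PL C n z - transferL PL C n z * M n z ^ 2 := by
  obtain ⟨M₀, hM₀, hMZ⟩ := exists_entire_structure_zero hγ hmom hfac h hWL hWR hWLu hWRu
  -- The recursion is the first zero curvature formula solved for the next matrix. It preserves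
  -- entireness, and differentiating the transfer relation shows that it produces the logarithmic
  -- derivatives.
  let M : ℕ → ℂ → Mat2 N := fun n => Nat.rec M₀ (fun n Mn z =>
    (proj N + transferL PL C n z * Mn z) * transferLInv PL C n z) n
  have hsucc (n z) : M (n + 1) z =
    (proj N + transferL PL C n z * M n z) * transferLInv PL C n z := rfl
  have hTT (n z) := transferLInv_mul PL (h.nonsingular n) z
  have hcurv (n z) : M (n + 1) z * transferL PL C n z = proj N + transferL PL C n z * M n z := by
    rw [hsucc, Matrix.mul_assoc, hTT, Matrix.mul_one]
  have hopen := hγ.isClosed_range.isOpen_compl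
  have hZ (n) := isHolomorphicOn_constJumpL hγ hmom h hWL hWR hWRu n
  refine ⟨M, fun n => ?_, fun n z hz => ?_, fun n z => ?_⟩
  · induction n with
    | zero => exact hM₀
    | succ n ih =>
      exact isEntire_iff.2 (((isHolomorphicOn_const _).add
        ((isHolomorphicOn_transferL PL C n _).mul (ih.isHolomorphicOn _))).mul
          (isHolomorphicOn_transferLInv PL C n _))
  · have key : M n z * constJumpL γ W WL WR PL C n z =
        matDeriv (constJumpL γ W WL WR PL C n) z := by
      induction n with
      | zero => exact hMZ z hz
      | succ n ih =>
        rw [← matDeriv_congr hopen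
            (fun w hw => transferL_mul_constJumpL WL WR hγ hmom h n hw) hz,
          matDeriv_mul (isHolomorphicOn_transferL PL C n _) (hZ n) hopen hz, ← ih,
          ← transferL_mul_constJumpL WL WR hγ hmom h n hz, ← Matrix.mul_assoc, hcurv,
          matDeriv_transferL, Matrix.add_mul, Matrix.mul_assoc]
    have hu := (Matrix.isUnit_iff_isUnit_det _).1 (isUnit_constJumpL hγ hmom h hWLu hWRu n hz)
    rw [rightLogDeriv, ← key, Matrix.mul_nonsing_inv_cancel_right _ _ hu]
  · have e : proj N = M (n + 1) z * transferL PL C n z - transferL PL C n z * M n z := by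
      rw [hcurv, add_sub_cancel_right]
    -- With `proj N` replaced by the first formula, the mixed products cancel.
    refine ⟨e, ?_⟩
    rw [e]
    noncomm_ring

/-! ### Asymptotics -/

/-- All entries are `O(1/z)` as `z → ∞` in `s`. -/
def IsSmallAt {m : Type*} (F : ℂ → Matrix m m ℂ) (s : Set ℂ) : Prop :=
  ∀ i j, (fun z => F z i j) =O[cocompact ℂ ⊓ 𝓟 s] fun z => z⁻¹

section Small

variable {m : Type*} {s : Set ℂ} {F G : ℂ → Matrix m m ℂ}

lemma IsSmallAt.neg (hF : IsSmallAt F s) : IsSmallAt (fun z => -F z) s :=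
  fun i j => (hF i j).neg_left

lemma isSmallAt_zero : IsSmallAt (fun _ => (0 : Matrix m m ℂ)) s :=
  fun _ _ => Asymptotics.isBigO_zero _ _

lemma IsSmallAt.sum {ι : Type*} {t : Finset ι} {F : ι → ℂ → Matrix m m ℂ}
    (hF : ∀ i ∈ t, IsSmallAt (F i) s) : IsSmallAt (fun z => ∑ i ∈ t, F i z) s := fun i j => by
  simp only [Matrix.sum_apply]
  exact Asymptotics.IsBigO.fun_sum fun l hl => hF l hl i j

lemma IsSmallAt.const_mul [Fintype m] (A : Matrix m m ℂ) (hF : IsSmallAt F s) :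
    IsSmallAt (fun z => A * F z) s := fun i j => by
  simp only [Matrix.mul_apply]
  exact Asymptotics.IsBigO.fun_sum fun l _ => (hF l j).const_mul_left _

lemma IsSmallAt.congr (hF : IsSmallAt F s) (h : ∀ z ∈ s, z ≠ 0 → G z = F z) : IsSmallAt G s :=
  fun i j => (hF i j).congr' (by
    have : ∀ᶠ z : ℂ in cocompact ℂ, z ≠ 0 := by
      have := (isCompact_singleton (x := (0 : ℂ))).compl_mem_cocompact
      filter_upwards [this] with z hz using hz
    filter_upwards [mem_inf_of_left this, mem_inf_of_right (mem_principal_self s)] with z hz hzs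
    rw [h z hzs hz]) EventuallyEq.rfl

/-- `1/z` times a bounded matrix is small. -/
lemma isSmallAt_inv_smul (hF : ∀ i j, ∃ B, ∀ z ∈ s, ‖F z i j‖ ≤ B) :
    IsSmallAt (fun z => z⁻¹ • F z) s := fun i j => by
  obtain ⟨B, hB⟩ := hF i j
  refine Asymptotics.IsBigO.of_bound B ?_
  filter_upwards [mem_inf_of_right (mem_principal_self s)] with z hz
  rw [Matrix.smul_apply, smul_eq_mul, norm_mul, mul_comm]
  exact mul_le_mul_of_nonneg_right (hB z hz) (norm_nonneg _)

lemma IsSmallAt.fromBlocks {N : ℕ} {A B C D : ℂ → Mat N} (hA : IsSmallAt A s)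
    (hB : IsSmallAt B s) (hC : IsSmallAt C s) (hD : IsSmallAt D s) :
    IsSmallAt (fun z => Matrix.fromBlocks (A z) (B z) (C z) (D z)) s := by
  rintro (i | i) (j | j)
  exacts [hA i j, hB i j, hC i j, hD i j]

end Small

lemma isSmallAt_inv_pow_smul {m : Type*} (s : Set ℂ) (k : ℕ) (A : Matrix m m ℂ) :
    IsSmallAt (fun z => (z ^ (k + 1))⁻¹ • A) s := by
  refine fun i j => Asymptotics.IsBigO.of_bound ‖A i j‖ (mem_inf_of_left ?_)
  filter_upwards [(isCompact_closedBall (0 : ℂ) 1).compl_mem_cocompact] with z hz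
  have h1 : 1 < ‖z‖ := by simpa using hz
  rw [Matrix.smul_apply, smul_eq_mul, norm_mul, mul_comm, norm_inv, norm_inv, norm_pow]
  gcongr
  exact le_self_pow₀ h1.le k.succ_ne_zero

/-- The leading behaviour of a polynomial at infinity. -/
lemma isSmallAt_evalAt (s : Set ℂ) {p : (Mat N)[X]} {n : ℕ} (hp : p.natDegree < n + 1) :
    IsSmallAt (fun z => (z ^ n)⁻¹ • evalAt p z - p.coeff n) s := by
  -- Since `k < n`, the exponent `n - 1 - k + 1` is `n - k`, without truncation.
  refine (IsSmallAt.sum (t := Finset.range n)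
    fun k _ => isSmallAt_inv_pow_smul s (n - 1 - k) (p.coeff k)).congr fun z _ hz => ?_
  rw [evalAt_eq_sum hp, Finset.sum_range_succ, smul_add, inv_smul_smul₀ (pow_ne_zero _ hz),
    add_sub_cancel_right, Finset.smul_sum]
  refine Finset.sum_congr rfl fun k hk => ?_
  have hk := Finset.mem_range.1 hk
  rw [smul_smul]
  congr 1
  rw [inv_mul_eq_iff_eq_mul₀ (pow_ne_zero _ hz), ← div_eq_mul_inv,
    eq_div_iff (pow_ne_zero _ hz), ← pow_add]
  congr 1
  omega

/-- The Cauchy transform of a polynomial orthogonal to all lower powers. -/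
lemma momL_cauchyMoment_eq_pow_smul (hγ : IsSmoothCurve γ) (hmom : HasFiniteMoments γ W)
    (p : (Mat N)[X]) {z : ℂ} (hz : z ∉ Set.range γ) {n : ℕ}
    (horth : ∀ k < n, momL (moment γ W) p k = 0) :
    momL (cauchyMoment γ W z) p n = z ^ n • momL (cauchyMoment γ W z) p 0 := by
  induction n with
  | zero => simp
  | succ n ih =>
    rw [momL_cauchyMoment_succ hmom hγ hz, horth n n.lt_succ_self, add_zero,
      ih fun k hk => horth k (hk.trans n.lt_succ_self), smul_smul, pow_succ']

/-- Solving the recursion for the lower index writes each Cauchy moment as `z⁻¹` times a bounded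
function; this is why bounds for all `k` are assumed. -/
lemma isSmallAt_momL_cauchyMoment {s : Set ℂ} (hγ : IsSmoothCurve γ) (hmom : HasFiniteMoments γ W)
    (hs : s ⊆ (Set.range γ)ᶜ)
    (hB : ∀ k i j, ∃ B, ∀ z ∈ s, ‖cauchyMoment γ W z k i j‖ ≤ B) (p : (Mat N)[X]) (k : ℕ) :
    IsSmallAt (fun z => momL (cauchyMoment γ W z) p k) s := by
  have hc (k) : IsSmallAt (fun z => cauchyMoment γ W z k) s := by
    refine (isSmallAt_inv_smul (F := fun z => cauchyMoment γ W z (k + 1) - moment γ W k)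
      fun i j => ?_).congr fun z hzs hz => ?_
    · obtain ⟨B, hB⟩ := hB (k + 1) i j
      exact ⟨B + ‖moment γ W k i j‖, fun z hz =>
        (norm_sub_le _ _).trans (add_le_add_left (hB z hz) _)⟩
    · rw [cauchyMoment_succ hmom hγ (hs hzs), add_sub_cancel_right, inv_smul_smul₀ hz]
  simp only [momL_eq_sum _ p.natDegree.lt_succ_self]
  exact IsSmallAt.sum fun i _ => (hc _).const_mul _

/-- The fundamental matrix is asymptotic to `diag(zⁿ, z⁻ⁿ)`. -/
lemma isSmallAt_fundL {s : Set ℂ} (hγ : IsSmoothCurve γ) (hmom : HasFiniteMoments γ W)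
    (h : IsOrthogonal γ W PL PR C) (hs : s ⊆ (Set.range γ)ᶜ)
    (hB : ∀ k i j, ∃ B, ∀ z ∈ s, ‖cauchyMoment γ W z k i j‖ ≤ B) (n : ℕ) :
    IsSmallAt (fun z => fundL γ W PL C n z *
      Matrix.fromBlocks ((z ^ n)⁻¹ • (1 : Mat N)) 0 0 (z ^ n • (1 : Mat N)) - 1) s := by
  have hb := h.isBiorthogonal hmom
  have hq := isSmallAt_momL_cauchyMoment hγ hmom hs hB
  cases n with
  | zero =>
    refine (isSmallAt_zero.fromBlocks (hq (PL 0) 0) isSmallAt_zero isSmallAt_zero).congr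
      fun z hzs hz => ?_
    rw [sub_eq_iff_eq_add, fundL, hb.PL_zero, secondKindL_eq hmom hγ (hs hzs), Matrix.fromBlocks_multiply,
      ← Matrix.fromBlocks_one, Matrix.fromBlocks_add, evalAt]
    simp
  | succ n =>
    have hn := hb.ltL n
    have e1 := isSmallAt_evalAt s (hb.ltL (n + 1))
    have e2 := (isSmallAt_evalAt s (hn.trans (n + 1).lt_succ_self)).const_mul (C n)
    rw [hb.coeffL_self] at e1
    simp only [hb.coeffL_of_lt n.lt_succ_self, sub_zero] at e2
    refine (e1.fromBlocks (hq (PL (n + 1)) (n + 1)) e2.neg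
      ((hq (PL n) (n + 1)).const_mul (C n)).neg).congr fun z hzs hz => ?_
    have q1 := momL_cauchyMoment_eq_pow_smul hγ hmom (PL (n + 1)) (hs hzs) (n := n + 1)
      fun k hk => by rw [hb.orthL _ _ hk.le, if_neg hk.ne]
    have q2 := momL_cauchyMoment_eq_pow_smul hγ hmom (PL n) (hs hzs) (n := n)
      fun k hk => by rw [hb.orthL _ _ hk.le, if_neg hk.ne]
    -- In the lower right block the power `n + 1` is one more than orthogonality permits; the norm
    -- `(C n)⁻¹` appearing at this last step becomes the identity block.
    have q3 := momL_cauchyMoment_succ hmom hγ (hs hzs) (PL n) n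
    rw [hb.orthL n n le_rfl, if_pos rfl, q2, smul_smul, ← pow_succ'] at q3
    rw [sub_eq_iff_eq_add, fundL, secondKindL_eq hmom hγ (hs hzs), secondKindL_eq hmom hγ (hs hzs),
      Matrix.fromBlocks_multiply, ← Matrix.fromBlocks_one, Matrix.fromBlocks_add, q1, q3,
      Matrix.mul_add, Matrix.mul_nonsing_inv _ ((Matrix.isUnit_iff_isUnit_det _).1 (h.nonsingular n))]
    congr 1 <;> simp

lemma hasAsymptoticsL_constJumpL {s : Set ℂ} (hγ : IsSmoothCurve γ) (hmom : HasFiniteMoments γ W)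
    (h : IsOrthogonal γ W PL PR C) (hs : s ⊆ (Set.range γ)ᶜ)
    (hB : ∀ k i j, ∃ B, ∀ z ∈ s, ‖cauchyMoment γ W z k i j‖ ≤ B) (n : ℕ) :
    HasAsymptoticsL WL WR n (constJumpL γ W WL WR PL C n) s := by
  refine ⟨_, isSmallAt_fundL hγ hmom h hs hB n, mem_inf_of_left ?_⟩
  filter_upwards [(isCompact_singleton (x := (0 : ℂ))).compl_mem_cocompact] with z hz
  have hz : z ^ n ≠ 0 := pow_ne_zero _ hz
  rw [add_sub_cancel, Matrix.mul_assoc, Matrix.fromBlocks_multiply, constJumpL]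
  simp [smul_smul, hz]

/-- The Cauchy transforms of the weight are bounded away from the curve. -/
lemma exists_bound_awayFrom (hmom : HasFiniteMoments γ W) {δ : ℝ}
    (hδ : 0 < δ) (k : ℕ) (i j : Fin N) :
    ∃ B, ∀ z ∈ awayFrom γ δ, ‖cauchyMoment γ W z k i j‖ ≤ B := by
  refine ⟨‖(2 * Real.pi * Complex.I)⁻¹‖ *
    ∫ t, δ⁻¹ * ‖γ t ^ k * W (γ t) i j * deriv γ t‖, fun z hz => ?_⟩
  simp only [cauchyMoment, curveInt, Matrix.of_apply, Matrix.smul_apply, smul_eq_mul]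
  rw [norm_mul]
  gcongr
  refine norm_integral_le_of_norm_le ((hmom k i j).norm.const_mul _) (Eventually.of_forall
    fun t => ?_)
  rw [mul_assoc, norm_mul]
  gcongr
  exact norm_inv_sub_le hδ hz t

lemma awayFrom_subset (γ : ℝ → ℂ) {δ : ℝ} (hδ : 0 < δ) : awayFrom γ δ ⊆ (Set.range γ)ᶜ := by
  rintro z hz hzr
  have : δ ≤ 0 := (show δ ≤ _ from hz).trans_eq (Metric.infDist_zero_of_mem hzr)
  linarith

/-- The Cauchy transforms of a Hölder weight on a Carleson curve are bounded. -/
lemma exists_bound_of_isHolderOn (hγ : IsSmoothCurve γ) (hmom : HasFiniteMoments γ W)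
    (hC : IsCarlesonCurve γ) (hH : IsHolderOn γ W) (k : ℕ) (i j : Fin N) :
    ∃ B, ∀ z ∈ (Set.range γ)ᶜ, ‖cauchyMoment γ W z k i j‖ ≤ B := by
  obtain ⟨K, r, hr, hK⟩ := hH i j
  obtain ⟨B, hB⟩ := hγ.exists_cauchy_bound hC (v := fun z => W z i j) K.2 hr (fun s t => by
    have := hK.dist_le (Set.mem_range_self s) (Set.mem_range_self t)
    rwa [dist_eq_norm, dist_eq_norm] at this) (fun n => hmom n i j) k
  refine ⟨‖(2 * Real.pi * Complex.I)⁻¹‖ * B, fun z hz => ?_⟩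
  have := hB z hz
  simp only [cauchyMoment, curveInt, Matrix.of_apply, Matrix.smul_apply, smul_eq_mul]
  rw [norm_mul]
  gcongr
  simpa only [mul_assoc] using this

end Weight

end ConstantJump

namespace ConstantJump

/-! ### Removable singularities along the curve and Liouville's theorem -/

/-- Normal coordinates cover a full neighbourhood, so one-sided limits taken in them control every
approach off the curve. -/
lemma IsSmoothCurve.map_normalPoint {γ : ℝ → ℂ} (hγ : IsSmoothCurve γ) (t : ℝ) :
    map (normalPoint γ) (𝓝 (t, 0)) = 𝓝 (γ t) := by
  have h1 : ContDiff ℝ 1 γ := hγ.smooth.of_le (by norm_num)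
  have h2 : ContDiff ℝ 1 (deriv γ) := (contDiff_succ_iff_deriv.1 hγ.smooth).2.2
  have hsmooth : ContDiff ℝ 1 (normalPoint γ) := by
    have h3 : ContDiff ℝ 1 fun p : ℝ × ℝ => (p.2 : ℂ) :=
      Complex.ofRealCLM.contDiff.comp contDiff_snd
    exact (h1.comp contDiff_fst).add (h3.mul (contDiff_const.mul (h2.comp contDiff_fst)))
  have hd : HasFDerivAt (normalPoint γ) ((ContinuousLinearMap.fst ℝ ℝ ℝ).smulRight (deriv γ t) +
      (ContinuousLinearMap.snd ℝ ℝ ℝ).smulRight (Complex.I * deriv γ t)) (t, 0) := by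
    have e1 : HasFDerivAt (fun p : ℝ × ℝ => γ p.1)
        ((ContinuousLinearMap.fst ℝ ℝ ℝ).smulRight (deriv γ t)) (t, 0) := by
      refine (HasFDerivAt.comp (t, (0 : ℝ)) (g := γ) (f := Prod.fst)
        (hγ.hasDerivAt t).hasFDerivAt hasFDerivAt_fst).congr_fderiv ?_
      ext <;> simp
    have e2 : HasFDerivAt (fun p : ℝ × ℝ => (p.2 : ℂ))
        (Complex.ofRealCLM.comp (ContinuousLinearMap.snd ℝ ℝ ℝ)) (t, 0) :=
      (Complex.ofRealCLM.comp (ContinuousLinearMap.snd ℝ ℝ ℝ)).hasFDerivAt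
    have e3 : DifferentiableAt ℝ (fun p : ℝ × ℝ => Complex.I * deriv γ p.1) (t, 0) :=
      (contDiff_const.mul (h2.comp contDiff_fst)).differentiable one_ne_zero _
    refine (e1.add (e2.mul e3.hasFDerivAt)).congr_fderiv ?_
    ext <;> simp
  have := map_nhds_eq_of_conformal hsmooth.contDiffAt (hγ.regular t) hd
  simpa [normalPoint] using this

/-- Equal limits from both sides of the curve give a limit off the curve. -/
lemma IsSmoothCurve.tendsto_nhdsWithin_compl {γ : ℝ → ℂ} (hγ : IsSmoothCurve γ) {E : Type*}
    {f : ℂ → E} {l : Filter E} {t : ℝ}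
    (hp : Tendsto (fun p => f (normalPoint γ p)) (𝓝 t ×ˢ 𝓝[>] 0) l)
    (hm : Tendsto (fun p => f (normalPoint γ p)) (𝓝 t ×ˢ 𝓝[<] 0) l) :
    Tendsto f (𝓝[(Set.range γ)ᶜ] γ t) l := by
  intro V hV
  have hp' := hp hV
  have hm' := hm hV
  rw [← nhdsWithin_univ t, ← nhdsWithin_prod_eq, mem_map, mem_nhdsWithin_iff_eventually] at hp' hm'
  rw [mem_map, mem_nhdsWithin_iff_eventually, ← hγ.map_normalPoint t, eventually_map]
  filter_upwards [hp', hm'] with p h1 h2 hpr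
  rcases lt_trichotomy p.2 0 with h | h | h
  · exact h2 ⟨trivial, h⟩
  · exact absurd ⟨p.1, by simp [normalPoint, h]⟩ hpr
  · exact h1 ⟨trivial, h⟩

/-- A holomorphic function off the curve with limits on the curve and at infinity is constant. -/
lemma IsSmoothCurve.eq_const_of_tendsto {γ : ℝ → ℂ} (hγ : IsSmoothCurve γ) {h : ℂ → ℂ} {b : ℂ}
    (hd : DifferentiableOn ℂ h (Set.range γ)ᶜ)
    (hlim : ∀ t, ∃ a, Tendsto h (𝓝[(Set.range γ)ᶜ] γ t) (𝓝 a))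
    (hinf : Tendsto h (cocompact ℂ ⊓ 𝓟 (Set.range γ)ᶜ) (𝓝 b)) {z : ℂ} (hz : z ∉ Set.range γ) :
    h z = b := by
  have hopen := hγ.isClosed_range.isOpen_compl
  set H := extendFrom (Set.range γ)ᶜ h
  have hext : ∀ z ∉ Set.range γ, H z = h z := extendFrom_extends hd.continuousOn
  have hcont : Continuous H := continuous_extendFrom hγ.dense_compl fun z => by
    by_cases hz : z ∈ Set.range γ
    · obtain ⟨t, rfl⟩ := hz
      exact hlim t
    · exact ⟨_, hd.continuousOn z hz⟩
  have hH : Differentiable ℂ H :=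
    hγ.differentiable_of_continuous hcont (hd.congr fun z hz => hext z hz)
  rw [← hext z hz]
  refine hH.apply_eq_of_tendsto_cocompact z ?_
  -- The limit at infinity is known only off the curve; closed neighbourhoods of `b` and density of
  -- the complement carry it to the continuous extension.
  refine (closed_nhds_basis b).tendsto_right_iff.2 fun V hV => ?_
  have h1 := mem_inf_principal.1 (hinf hV.1)
  obtain ⟨K, hK, hKs⟩ := mem_cocompact.1 h1
  refine mem_of_superset hK.compl_mem_cocompact fun w hw => ?_
  refine closure_minimal (fun v hv => ?_) (hV.2.preimage hcont)
    (hγ.dense_compl.open_subset_closure_inter hK.isClosed.isOpen_compl hw)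
  rw [Set.mem_preimage, hext v hv.2]
  exact hKs hv.1 hv.2

/-! ### The left Riemann–Hilbert problem -/

section Weight

variable {N : ℕ} {γ : ℝ → ℂ} {W WL WR : ℂ → Mat N} {PL PR : ℕ → (Mat N)[X]} {C : ℕ → Mat N}

lemma tendsto_matrix_inv {m : Type*} [Fintype m] [DecidableEq m] {ι : Type*} {l : Filter ι}
    {F : ι → Matrix m m ℂ} {A : Matrix m m ℂ} (hF : Tendsto F l (𝓝 A)) (hA : IsUnit A) :
    Tendsto (fun x => (F x)⁻¹) l (𝓝 A⁻¹) := by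
  obtain ⟨u, hu⟩ := (Matrix.isUnit_iff_isUnit_det _).1 hA
  exact (continuousAt_matrix_inv A (hu ▸ NormedRing.inverse_continuousAt u)).tendsto.comp hF

lemma IsSmallAt.tendsto {m : Type*} {F : ℂ → Matrix m m ℂ} {s : Set ℂ} (hF : IsSmallAt F s) :
    Tendsto F (cocompact ℂ ⊓ 𝓟 s) (𝓝 0) := by
  have h0 : Tendsto (fun z : ℂ => z⁻¹) (cocompact ℂ ⊓ 𝓟 s) (𝓝 0) :=
    (Metric.cobounded_eq_cocompact (α := ℂ) ▸ tendsto_inv₀_cobounded).mono_left inf_le_left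
  exact tendsto_pi_nhds.2 fun i => tendsto_pi_nhds.2 fun j => (hF i j).trans_tendsto h0

/-- The solution of the left Riemann–Hilbert problem is unique, given one with invertible boundary
values. -/
lemma SolvesRHL.eqOn {n : ℕ} {Z Z' : ℂ → Mat2 N} (hγ : IsSmoothCurve γ)
    (hZ : SolvesRHL γ WL WR n Z) (hZ' : SolvesRHL γ WL WR n Z')
    (hu : ∀ z ∉ Set.range γ, IsUnit (Z' z))
    (hjump : ∀ t, ∃ Zp Zm : Mat2 N, HasPlusValue γ Z' t Zp ∧ HasMinusValue γ Z' t Zm ∧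
      Zp = Zm * Matrix.fromBlocks 1 1 0 1 ∧ IsUnit Zm) :
    Set.EqOn Z Z' (Set.range γ)ᶜ := by
  have hJ : IsUnit (Matrix.fromBlocks 1 1 0 1 : Mat2 N) := by
    rw [Matrix.isUnit_iff_isUnit_det, Matrix.det_fromBlocks_zero₂₁]
    simp
  have hhol : IsHolomorphicOn (fun z => Z z * (Z' z)⁻¹) (Set.range γ)ᶜ :=
    hZ.holomorphic.mul (hZ'.holomorphic.inv hu)
  have hlim (t) : ∃ A, Tendsto (fun z => Z z * (Z' z)⁻¹) (𝓝[(Set.range γ)ᶜ] γ t) (𝓝 A) := by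
    obtain ⟨Zp, Zm, h1, h2, h3⟩ := hZ.jump t
    obtain ⟨Zp', Zm', h1', h2', h3', hum⟩ := hjump t
    have hup : IsUnit Zp' := h3' ▸ hum.mul hJ
    -- The constant jump acts on the right of both solutions and cancels in the quotient.
    have e : Zp * Zp'⁻¹ = Zm * Zm'⁻¹ := by
      rw [h3, h3', Matrix.mul_inv_rev, Matrix.mul_assoc,
        Matrix.mul_nonsing_inv_cancel_left _ _ ((Matrix.isUnit_iff_isUnit_det _).1 hJ)]
    refine ⟨Zm * Zm'⁻¹, hγ.tendsto_nhdsWithin_compl ?_ (h2.mul (tendsto_matrix_inv h2' hum))⟩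
    rw [← e]
    exact h1.mul (tendsto_matrix_inv h1' hup)
  have hinf : Tendsto (fun z => Z z * (Z' z)⁻¹) (cocompact ℂ ⊓ 𝓟 (Set.range γ)ᶜ) (𝓝 1) := by
    obtain ⟨E, hE, hZE⟩ := hZ.asymptotics
    obtain ⟨E', hE', hZE'⟩ := hZ'.asymptotics
    have t1 : Tendsto (fun z => 1 + E z) (cocompact ℂ ⊓ 𝓟 (Set.range γ)ᶜ) (𝓝 1) := by
      simpa using (IsSmallAt.tendsto hE).const_add 1
    have t2 : Tendsto (fun z => 1 + E' z) (cocompact ℂ ⊓ 𝓟 (Set.range γ)ᶜ) (𝓝 1) := by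
      simpa using (IsSmallAt.tendsto hE').const_add 1
    have t3 := t1.mul (tendsto_matrix_inv t2 isUnit_one)
    rw [inv_one, mul_one] at t3
    refine t3.congr' ?_
    filter_upwards [hZE, hZE', mem_inf_of_right (mem_principal_self _)] with z h1 h2 hz
    -- Invertibility of the diagonal factor is read off from that of `Z'`, so it can be cancelled.
    have hD := hu z hz
    rw [h2] at hD
    rw [Matrix.isUnit_iff_isUnit_det, Matrix.det_mul] at hD
    rw [h1, h2, Matrix.mul_inv_rev, Matrix.mul_assoc,
      Matrix.mul_nonsing_inv_cancel_left _ _ (isUnit_of_mul_isUnit_right hD)]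
  intro z hz
  have key : Z z * (Z' z)⁻¹ = 1 := by
    ext i j
    refine hγ.eq_const_of_tendsto (hhol i j) (fun t => ?_) ?_ hz
    · obtain ⟨A, hA⟩ := hlim t
      exact ⟨A i j, tendsto_pi_nhds.1 (tendsto_pi_nhds.1 hA i) j⟩
    · exact tendsto_pi_nhds.1 (tendsto_pi_nhds.1 hinf i) j
  have := congrArg (· * Z' z) key
  simpa [Matrix.mul_assoc,
    Matrix.nonsing_inv_mul _ ((Matrix.isUnit_iff_isUnit_det _).1 (hu z hz))] using this

/-- The Carleson and Hölder conditions serve only to bound the Cauchy transforms up to the curve, so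
that the asymptotics hold on the whole complement. -/
lemma solvesRHL_iff (hγ : IsSmoothCurve γ) (hmom : HasFiniteMoments γ W)
    (hfac : ∀ z ∈ Set.range γ, W z = WL z * WR z)
    (h : IsOrthogonal γ W PL PR C) (hWL : IsEntire WL) (hWR : IsEntire WR)
    (hWLu : ∀ z, IsUnit (WL z)) (hWRu : ∀ z, IsUnit (WR z))
    (hC : IsCarlesonCurve γ) (hH : IsHolderOn γ W) (n : ℕ) (Z : ℂ → Mat2 N) :
    SolvesRHL γ WL WR n Z ↔ Set.EqOn Z (constJumpL γ W WL WR PL C n) (Set.range γ)ᶜ := by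
  have hol := isHolomorphicOn_constJumpL hγ hmom h hWL hWR hWRu n
  have hbd {Z} := exists_boundary_values (Z := Z) hγ hmom hfac h hWL hWR hWLu hWRu n
  have key : ∀ {Z}, Set.EqOn Z (constJumpL γ W WL WR PL C n) (Set.range γ)ᶜ →
      SolvesRHL γ WL WR n Z := fun {Z} hZ => by
    refine ⟨hol.congr hZ, ?_, fun t => ?_⟩
    · obtain ⟨E, hE, hE'⟩ := hasAsymptoticsL_constJumpL (WL := WL) (WR := WR) hγ hmom h subset_rfl
        (exists_bound_of_isHolderOn hγ hmom hC hH) n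
      refine ⟨E, hE, ?_⟩
      filter_upwards [hE', mem_inf_of_right (mem_principal_self _)] with z h1 hz
      rw [hZ hz, h1]
    · obtain ⟨Zp, Zm, h1, h2, h3, -⟩ := hbd hZ t
      exact ⟨Zp, Zm, h1, h2, h3⟩
  refine ⟨fun hZ => hZ.eqOn hγ (key fun _ _ => rfl)
    (fun z hz => isUnit_constJumpL hγ hmom h hWLu hWRu n hz) (hbd fun _ _ => rfl), key⟩

end Weight

end ConstantJump

namespace ConstantJump

/-! ### Transposition of the Riemann–Hilbert problem -/

section Transposition

variable {N : ℕ} {γ : ℝ → ℂ} {WL WR : ℂ → Mat N} {Z : ℂ → Mat2 N}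

lemma HasConstJumpL.transpose (h : HasConstJumpL γ Z) :
    HasConstJumpR γ fun z => (Z z).transpose := fun t => by
  obtain ⟨Zp, Zm, h1, h2, h3⟩ := h t
  refine ⟨Zp.transpose, Zm.transpose, (continuous_id.matrix_transpose.tendsto _).comp h1,
    (continuous_id.matrix_transpose.tendsto _).comp h2, ?_⟩
  simp [h3, Matrix.fromBlocks_transpose]

lemma HasConstJumpR.transpose (h : HasConstJumpR γ Z) :
    HasConstJumpL γ fun z => (Z z).transpose := fun t => by
  obtain ⟨Zp, Zm, h1, h2, h3⟩ := h t
  refine ⟨Zp.transpose, Zm.transpose, (continuous_id.matrix_transpose.tendsto _).comp h1,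
    (continuous_id.matrix_transpose.tendsto _).comp h2, ?_⟩
  simp [h3, Matrix.fromBlocks_transpose]

lemma HasAsymptoticsL.transpose {n : ℕ} {s : Set ℂ} (h : HasAsymptoticsL WL WR n Z s) :
    HasAsymptoticsR (fun z => (WR z).transpose) (fun z => (WL z).transpose) n
      (fun z => (Z z).transpose) s := by
  obtain ⟨E, hE, hZ⟩ := h
  refine ⟨fun z => (E z).transpose, fun i j => hE j i, ?_⟩
  filter_upwards [hZ] with z hz
  simp [hz, Matrix.fromBlocks_transpose, Matrix.transpose_nonsing_inv]

lemma HasAsymptoticsR.transpose {n : ℕ} {s : Set ℂ} (h : HasAsymptoticsR WL WR n Z s) :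
    HasAsymptoticsL (fun z => (WR z).transpose) (fun z => (WL z).transpose) n
      (fun z => (Z z).transpose) s := by
  obtain ⟨E, hE, hZ⟩ := h
  refine ⟨fun z => (E z).transpose, fun i j => hE j i, ?_⟩
  filter_upwards [hZ] with z hz
  simp [hz, Matrix.fromBlocks_transpose, Matrix.transpose_nonsing_inv]

lemma solvesRHR_iff_transpose {n : ℕ} : SolvesRHR γ WL WR n Z ↔
    SolvesRHL γ (fun z => (WR z).transpose) (fun z => (WL z).transpose) n
      fun z => (Z z).transpose :=
  ⟨fun h => ⟨h.holomorphic.transpose, h.asymptotics.transpose, h.jump.transpose⟩,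
    fun h => ⟨h.holomorphic.transpose, h.asymptotics.transpose, h.jump.transpose⟩⟩

lemma leftLogDeriv_transpose {m : Type*} [Fintype m] [DecidableEq m] (F : ℂ → Matrix m m ℂ)
    (z : ℂ) : leftLogDeriv (fun w => (F w).transpose) z = (rightLogDeriv F z).transpose := by
  rw [leftLogDeriv, rightLogDeriv, Matrix.transpose_mul, Matrix.transpose_nonsing_inv]
  rfl

end Transposition

end ConstantJump

/-! ### Assembly of the left and right statements. -/

theorem mainTheorem3 (N : ℕ) (hN : 0 < N) (γ : ℝ → ℂ) (hγ : IsSmoothCurve γ)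
    (W WL WR : ℂ → Mat N)
    (hmom : HasFiniteMoments γ W) (hreg : IsRegularWeight γ W)
    (hfac : ∀ z ∈ Set.range γ, W z = WL z * WR z)
    (hWL : IsEntire WL) (hWR : IsEntire WR)
    (hWLu : ∀ z, IsUnit (WL z)) (hWRu : ∀ z, IsUnit (WR z)) :
    (∃ (PL PR : ℕ → (Mat N)[X]) (C : ℕ → Mat N), IsOrthogonal γ W PL PR C) ∧
    ∀ (PL PR : ℕ → (Mat N)[X]) (C : ℕ → Mat N), IsOrthogonal γ W PL PR C →
      -- holomorphy, invertibility, constant jump, asymptotics away from the curve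
      (∀ n,
        (IsHolomorphicOn (constJumpL γ W WL WR PL C n) (Set.range γ)ᶜ ∧
          (∀ z ∉ Set.range γ, IsUnit (constJumpL γ W WL WR PL C n z)) ∧
          HasConstJumpL γ (constJumpL γ W WL WR PL C n) ∧
          ∀ δ > 0, HasAsymptoticsL WL WR n (constJumpL γ W WL WR PL C n) (awayFrom γ δ)) ∧
        (IsHolomorphicOn (constJumpR γ W WL WR PR C n) (Set.range γ)ᶜ ∧
          (∀ z ∉ Set.range γ, IsUnit (constJumpR γ W WL WR PR C n z)) ∧
          HasConstJumpR γ (constJumpR γ W WL WR PR C n) ∧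
          ∀ δ > 0, HasAsymptoticsR WL WR n (constJumpR γ W WL WR PR C n) (awayFrom γ δ))) ∧
      -- characterization by the Riemann–Hilbert problem
      (IsCarlesonCurve γ → IsHolderOn γ W → ∀ (n : ℕ) (Z : ℂ → Mat2 N),
        (SolvesRHL γ WL WR n Z ↔
          Set.EqOn Z (constJumpL γ W WL WR PL C n) (Set.range γ)ᶜ) ∧
        (SolvesRHR γ WL WR n Z ↔
          Set.EqOn Z (constJumpR γ W WL WR PR C n) (Set.range γ)ᶜ)) ∧
      -- transfer matrices
      (∀ n, ∀ z ∉ Set.range γ,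
        transferL PL C n z * constJumpL γ W WL WR PL C n z =
          constJumpL γ W WL WR PL C (n + 1) z ∧
        constJumpR γ W WL WR PR C n z * transferR PL C n z =
          constJumpR γ W WL WR PR C (n + 1) z) ∧
      -- the structure matrices are entire and satisfy the zero curvature formulas
      ∃ ML MR : ℕ → ℂ → Mat2 N,
        (∀ n, IsEntire (ML n) ∧ IsEntire (MR n)) ∧
        (∀ n, ∀ z ∉ Set.range γ,
          ML n z = rightLogDeriv (constJumpL γ W WL WR PL C n) z ∧
          MR n z = leftLogDeriv (constJumpR γ W WL WR PR C n) z) ∧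
        ∀ n z,
          proj N = ML (n + 1) z * transferL PL C n z - transferL PL C n z * ML n z ∧
          proj N = transferR PL C n z * MR (n + 1) z - MR n z * transferR PL C n z ∧
          proj N * ML n z + ML (n + 1) z * proj N =
            ML (n + 1) z ^ 2 * transferL PL C n z - transferL PL C n z * ML n z ^ 2 ∧
          proj N * MR (n + 1) z + MR n z * proj N =
            transferR PL C n z * MR (n + 1) z ^ 2 - MR n z ^ 2 * transferR PL C n z := by
  refine ⟨exists_isOrthogonal hN hmom hreg, fun PL PR C h => ?_⟩
  have hmom' := hmom.transpose
  have h' := h.transpose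
  have hWL' : IsEntire fun z => (WL z).transpose := fun i j => hWL j i
  have hWR' : IsEntire fun z => (WR z).transpose := fun i j => hWR j i
  have hWLu' : ∀ z, IsUnit (WL z).transpose := fun z => (Matrix.isUnit_transpose _).2 (hWLu z)
  have hWRu' : ∀ z, IsUnit (WR z).transpose := fun z => (Matrix.isUnit_transpose _).2 (hWRu z)
  have hfac' : ∀ z ∈ Set.range γ, (W z).transpose = (WR z).transpose * (WL z).transpose :=
    fun z hz => by rw [hfac z hz, Matrix.transpose_mul]
  -- From here on each right object is a transposed left object for the transposed weight, with the
  -- entire factors interchanged.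
  have hR (n) := funext (constJumpR_eq_transpose (γ := γ) W WL WR PR C n)
  simp only [hR, h.transferR_eq hmom]
  refine ⟨fun n => ⟨⟨?_, ?_, ?_, ?_⟩, ?_, ?_, ?_, ?_⟩, fun hC hH n Z => ⟨?_, ?_⟩,
    fun n z hz => ⟨?_, ?_⟩, ?_⟩
  · exact isHolomorphicOn_constJumpL hγ hmom h hWL hWR hWRu n
  · exact fun z hz => isUnit_constJumpL hγ hmom h hWLu hWRu n hz
  · intro t
    obtain ⟨Zp, Zm, h1, h2, h3, -⟩ :=
      exists_boundary_values hγ hmom hfac h hWL hWR hWLu hWRu n (fun _ _ => rfl) t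
    exact ⟨Zp, Zm, h1, h2, h3⟩
  · exact fun δ hδ => hasAsymptoticsL_constJumpL hγ hmom h (awayFrom_subset γ hδ)
      (exists_bound_awayFrom hmom hδ) n
  · exact (isHolomorphicOn_constJumpL hγ hmom' h' hWR' hWL' hWLu' n).transpose
  · exact fun z hz => (Matrix.isUnit_transpose _).2
      (isUnit_constJumpL hγ hmom' h' hWRu' hWLu' n hz)
  · refine HasConstJumpL.transpose fun t => ?_
    obtain ⟨Zp, Zm, h1, h2, h3, -⟩ :=
      exists_boundary_values hγ hmom' hfac' h' hWR' hWL' hWRu' hWLu' n (fun _ _ => rfl) t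
    exact ⟨Zp, Zm, h1, h2, h3⟩
  · exact fun δ hδ => (hasAsymptoticsL_constJumpL hγ hmom' h' (awayFrom_subset γ hδ)
      (exists_bound_awayFrom hmom' hδ) n).transpose
  · exact solvesRHL_iff hγ hmom hfac h hWL hWR hWLu hWRu hC hH n Z
  · rw [solvesRHR_iff_transpose, solvesRHL_iff hγ hmom' hfac' h' hWR' hWL' hWRu' hWLu' hC
      (fun i j => hH j i)]
    exact forall₂_congr fun z _ => Matrix.transpose_injective.eq_iff (a := (Z z).transpose)
      |>.symm
  · exact transferL_mul_constJumpL WL WR hγ hmom h n hz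
  · rw [← Matrix.transpose_mul, transferL_mul_constJumpL _ _ hγ hmom' h' n hz]
  obtain ⟨ML, l1, l2, l3⟩ := exists_structureL hγ hmom hfac h hWL hWR hWLu hWRu
  obtain ⟨MR, r1, r2, r3⟩ := exists_structureL hγ hmom' hfac' h' hWR' hWL' hWRu' hWLu'
  have hproj : (proj N).transpose = proj N := by simp [proj, Matrix.fromBlocks_transpose]
  refine ⟨ML, fun n z => (MR n z).transpose, fun n => ⟨l1 n, fun i j => r1 n j i⟩,
    fun n z hz => ⟨l2 n z hz, ?_⟩, fun n z => ⟨(l3 n z).1, ?_, (l3 n z).2, ?_⟩⟩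
  · rw [leftLogDeriv_transpose, ← r2 n z hz]
  · simpa [hproj] using congrArg Matrix.transpose (r3 n z).1
  · simpa [hproj, add_comm] using congrArg Matrix.transpose (r3 n z).2
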